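/- All graphs are finite and simple. Rank, independence and circuits refer to a fixed one of two matroids on the pairs of vertices: the 3-dimensional generic rigidity matroid $\mathcal R_3$, or Whiteley's cofactor matroid $\mathcal M_{K_5}$ (bivariate $C^1_2$-splines). A graph or set of pairs is independent if its rank equals its number of edges. A nonedge $f$ of a graph $G$ is *implied* if $G\cup f$ contains a circuit through $f$. **2-thin covers.** A *2-thin cover* of $G$ is a collection $\mathcal X$ of subsets of $V(G)$ (clusters) of size at least $2$, none contained in another, any two meeting in at most two vertices, such that each edge lies in a cluster. Its *shared set* $S(\mathcal X)$ consists of all pairs $\{u,v\}$, $u\ne v$, of the form $X\cap Y$ with $X\neq Y$ in $\mathcal X$; $\mathcal X$ is *independent* if $S(\mathcal X)$ is. For a set $T$ of pairs let $IE_T(G,\mathcal X)=\sum_{X\in\mathcal X}\operatorname{rank}\big((G\cup T)[X]\big)-\sum_{e\in T}(d(\mathcal X,e)-1)$, where $d(\mathcal X,e)$ is the number of clusters containing $e$, and let $IE(G,\mathcal X)=IE_{S(\mathcal X)}(G,\mathcal X)$. **Safe nonedge-split.** Let $\mathcal X$ be a 2-thin cover of $G$ and $\{a,b\}\in S(\mathcal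 X)$ a nonedge of $G$. A nonedge-split replaces $a$ by new vertices $a_1,a_2$ whose neighborhoods partition that of $a$ (parts may be empty), and $b$ by $b_1,b_2$ in the same way; call the result $G^s$. For $X\in\mathcal X$ let $X'$ be obtained from $X\setminus\{a,b\}$ by adding, if $a\in X$, those of $a_1,a_2$ that are adjacent in $G^s$ to some vertex of $X$, and likewise for $b$. The split is *safe* if (i) whenever $X$ contains a nonedge of $G$ lying in $S(\mathcal X)$, $X'$ contains neither $\{a_1,a_2\}$ nor $\{b_1,b_2\}$; and (ii) whenever $X\cap Y=\{a,u\}$ for $X\ne Y$ in $\mathcal X$ and $\{a,u\}$ is a nonedge of $G$ with $u\neq b$, we have $X'\cap\{a_1,a_2\}=Y'\cap\{a_1,a_2\}$, and the same with $a$ and $b$ interchanged. The *safe split cover* $\mathcal X^s$ of $G^s$ consists of all $X'$ with $|X'|>2$ containing neither $\{a_1,a_2\}$ nor $\{b_1,b_2\}$, together with the endpoint sets of the edges of $G^s$ contained in none of these. The *key gluing pairs* of $G^s$ are the pairs of distinct vertices of $\{a_1,a_2,b_1,b_2\}$ contained in some cluster of $\mathcal X^s$. **Safe base graph.** $G$ is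 independent and has an independent 2-thin cover $\mathcal X$ with $\operatorname{rank}(G)=IE(G,\mathcal X)$ and a nonedge $\{a,b\}\in S(\mathcal X)$ that can be split by a safe nonedge-split. **Safe ear.** A graph $H$ with an independent 2-thin cover $\mathcal X^H$ and a set $L\subseteq V(H)$ of gluing vertices such that each cluster of $\mathcal X^H$ contains at most two vertices of $L$; $S(\mathcal X^H)$ together with all pairs of distinct vertices of $L$ is independent; and $\operatorname{rank}(H)=IE_{S(\mathcal X^H)\cup F'}(H,\mathcal X^H)-1$, where $F'$, the set of key gluing pairs of $H$, consists of the pairs of distinct vertices of $L$ contained in a cluster of $\mathcal X^H$. **Safe split-and-glue.** Given a safe base graph $G$ with $\mathcal X$, a safe nonedge-split of $\{a,b\}$ yielding $G^s$, and a safe ear $H$ vertex-disjoint from $G^s$, choose a set $K\subseteq\{a_1,a_2,b_1,b_2\}$ containing the endpoints of all key gluing pairs of $G^s$ and a bijection $K\to L$ under which a pair is a key gluing pair of $G^s$ if and only if its image is a key gluing pair of $H$. Identify vertices along this bijection to obtain $G^s{:}H$, and let $\mathcal X'$ be the collection of all inclusion-maximal members of $\mathcal X^s\cup\mathcal X^H$,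 viewed in $G^s{:}H$. **Theorem 3.7.** For every safe split-and-glue, $\{a,b\}$ is an implied nonedge of $G$. If moreover $G^s{:}H$ is independent, then $G^s{:}H$ has an implied nonedge; in fact every nonedge of $G^s{:}H$ in $S(\mathcal X')$ is implied. Moreover, in that case $\mathcal X'$ is an independent 2-thin cover of $G^s{:}H$ and $\operatorname{rank}(G^s{:}H)=IE(G^s{:}H,\mathcal X')$. -/

import Mathlib

/-! ### The two rigidity matroids -/

/-- The two matroids on the edge set of a complete graph considered here: `barJoint` is the
three-dimensional generic (bar-joint) rigidity matroid, `cofactor` is Whiteley's cofactor matroid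
of bivariate splines of degree 2 and smoothness 1, i.e. the maximal matroid in which every `K₅` is
a circuit. -/
inductive RigidityModel where
  | barJoint
  | cofactor

/-- The vector placed at the endpoint `x` of a bar with endpoints `x`, `y`. The cofactor matroid
lives on points of the plane: there only the first two coordinates are used. -/
def edgeDir : RigidityModel → (Fin 3 → ℝ) → (Fin 3 → ℝ) → (Fin 3 → ℝ)
  | RigidityModel.barJoint, x, y => x - y
  | RigidityModel.cofactor, x, y =>
      ![(x 0 - y 0) ^ 2, (x 0 - y 0) * (x 1 - y 1), (x 1 - y 1) ^ 2]

section Matroid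

variable {V : Type*} [DecidableEq V]

/-- The row of the rigidity (cofactor) matrix of the framework `p` that belongs to the edge `uv`.
Up to a sign it does not depend on the order of `u` and `v`. -/
def rigidityRow (κ : RigidityModel) (p : V → Fin 3 → ℝ) (u v : V) : V → Fin 3 → ℝ :=
  Pi.single u (edgeDir κ (p u) (p v)) - Pi.single v (edgeDir κ (p u) (p v))

/-- The rank of the rigidity (cofactor) matrix of the framework `(E, p)`. -/
noncomputable def frameworkRank (κ : RigidityModel) (p : V → Fin 3 → ℝ) (E : Set (Sym2 V)) : ℕ :=
  Module.finrank ℝ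
    (Submodule.span ℝ {r | ∃ u v : V, s(u, v) ∈ E ∧ r = rigidityRow κ p u v})

/-- The rank of an edge set in the generic matroid: the maximal rank over all frameworks
(for finite `V`, where it is at most `3 * |V|`), equivalently the rank at any generic framework. -/
noncomputable def edgeRank (κ : RigidityModel) (E : Set (Sym2 V)) : ℕ :=
  ⨆ p : V → Fin 3 → ℝ, frameworkRank κ p E

/-- Independence of a set of pairs. -/
def IndepEdges (κ : RigidityModel) (E : Set (Sym2 V)) : Prop :=
  edgeRank κ E = E.ncard

/-- Circuits: minimal dependent edge sets of the complete graph. -/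
def IsRigidityCircuit (κ : RigidityModel) (C : Set (Sym2 V)) : Prop :=
  (∀ e ∈ C, ¬ e.IsDiag) ∧ ¬ IndepEdges κ C ∧ ∀ D : Set (Sym2 V), D ⊂ C → IndepEdges κ D

/-- `e` is an implied nonedge of `G`: it is a pair of distinct vertices that is not an edge of `G`,
and `G ∪ e` contains a circuit through `e`. -/
def IsImpliedNonedge (κ : RigidityModel) (G : SimpleGraph V) (e : Sym2 V) : Prop :=
  ¬ e.IsDiag ∧ e ∉ G.edgeSet ∧
    ∃ C : Set (Sym2 V), C ⊆ insert e G.edgeSet ∧ e ∈ C ∧ IsRigidityCircuit κ C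

end Matroid

/-! ### 2-thin covers and the inclusion-exclusion count -/

section Covers

variable {V : Type*} [DecidableEq V]

/-- 2-thin covers of a graph. -/
structure IsTwoThinCover (G : SimpleGraph V) (𝒳 : Finset (Finset V)) : Prop where
  two_le_card : ∀ X ∈ 𝒳, 2 ≤ X.card
  card_inter_le : ∀ X ∈ 𝒳, ∀ Y ∈ 𝒳, X ≠ Y → (X ∩ Y).card ≤ 2
  not_subset : ∀ X ∈ 𝒳, ∀ Y ∈ 𝒳, X ≠ Y → ¬ X ⊆ Y
  covers : ∀ u v : V, G.Adj u v → ∃ X ∈ 𝒳, u ∈ X ∧ v ∈ X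

variable [Fintype V]

open Classical in
/-- The shared set: all pairs of distinct vertices that are the intersection of two clusters. -/
noncomputable def sharedSet (𝒳 : Finset (Finset V)) : Finset (Sym2 V) :=
  Finset.univ.filter fun e =>
    ∃ u v : V, u ≠ v ∧ e = s(u, v) ∧ ∃ X ∈ 𝒳, ∃ Y ∈ 𝒳, X ≠ Y ∧ X ∩ Y = {u, v}

open Classical in
/-- The number `d(𝒳, e)` of clusters that contain the pair `e`. -/
noncomputable def coverDegree (𝒳 : Finset (Finset V)) (e : Sym2 V) : ℕ :=
  (𝒳.filter fun X => ∀ v ∈ e, v ∈ X).card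

/-- The edge set of `G_T[X]`, the subgraph of `G ∪ T` induced by `X`. -/
def inducedEdges (G : SimpleGraph V) (T : Finset (Sym2 V)) (X : Finset V) : Set (Sym2 V) :=
  {e | (e ∈ G.edgeSet ∨ e ∈ T) ∧ ∀ v ∈ e, v ∈ X}

/-- `∑_{X ∈ 𝒳} rank(G_T[X]) - ∑_{e ∈ T} (d(𝒳, e) - 1)`. With `T` the shared set this is the
inclusion-exclusion count. -/
noncomputable def countWith (κ : RigidityModel) (G : SimpleGraph V) (𝒳 : Finset (Finset V))
    (T : Finset (Sym2 V)) : ℤ :=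
  ∑ X ∈ 𝒳, (edgeRank κ (inducedEdges G T X) : ℤ) - ∑ e ∈ T, ((coverDegree 𝒳 e : ℤ) - 1)

/-- The inclusion-exclusion rank count `IE(G, 𝒳)`. -/
noncomputable def inclExcl (κ : RigidityModel) (G : SimpleGraph V) (𝒳 : Finset (Finset V)) : ℤ :=
  countWith κ G 𝒳 (sharedSet 𝒳)

/-- Independent 2-thin covers: the shared set is independent. -/
structure IsIndepTwoThinCover (κ : RigidityModel) (G : SimpleGraph V)
    (𝒳 : Finset (Finset V)) : Prop extends IsTwoThinCover G 𝒳 where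
  indep : IndepEdges κ (sharedSet 𝒳 : Set (Sym2 V))

open Classical in
/-- All pairs of distinct vertices of `K`. -/
noncomputable def pairsOf (K : Finset V) : Finset (Sym2 V) :=
  Finset.univ.filter fun e => ¬ e.IsDiag ∧ ∀ v ∈ e, v ∈ K

open Classical in
/-- The pairs of distinct vertices of `K` that are contained in a cluster of `𝒳`
(the key gluing pairs, when `K` is the set of candidates for gluing vertices). -/
noncomputable def keyPairs (𝒳 : Finset (Finset V)) (K : Finset V) : Finset (Sym2 V) :=
  (pairsOf K).filter fun e => ∃ X ∈ 𝒳, ∀ v ∈ e, v ∈ X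

end Covers

/-! ### Nonedge-splits -/

section Split

variable {V : Type*}

/-- The vertices of the split graph: the vertices other than `a`, `b`, and the new vertices
`a₁, a₂` (first copy of `Fin 2`) and `b₁, b₂` (second copy of `Fin 2`). -/
abbrev SplitVertex (a b : V) : Type _ := {v : V // v ≠ a ∧ v ≠ b} ⊕ (Fin 2 ⊕ Fin 2)

/-- The new vertex `a₁` (`k = 0`) or `a₂` (`k = 1`). -/
abbrev copyA (a b : V) (k : Fin 2) : SplitVertex a b := Sum.inr (Sum.inl k)

/-- The new vertex `b₁` (`k = 0`) or `b₂` (`k = 1`). -/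
abbrev copyB (a b : V) (k : Fin 2) : SplitVertex a b := Sum.inr (Sum.inr k)

/-- The graph obtained by splitting the nonedge `(a, b)`. A neighbour `v` of `a` becomes a neighbour
of the copy of `a` with index `σ v`, a neighbour `v` of `b` becomes a neighbour of the copy of `b`
with index `τ v`. -/
def splitGraph (G : SimpleGraph V) (a b : V) (σ τ : V → Fin 2) :
    SimpleGraph (SplitVertex a b) :=
  SimpleGraph.fromRel fun x y =>
    match x, y with
    | Sum.inl u, Sum.inl v => G.Adj u.1 v.1
    | Sum.inr (Sum.inl k), Sum.inl v => G.Adj a v.1 ∧ σ v.1 = k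
    | Sum.inr (Sum.inr k), Sum.inl v => G.Adj b v.1 ∧ τ v.1 = k
    | _, _ => False

variable [DecidableEq V] [Fintype V]

open Classical in
/-- The set `X'`: each of `a`, `b` that lies in `X` is replaced by those of its copies that are
adjacent in the split graph to some vertex of `X`. -/
noncomputable def splitCluster (G : SimpleGraph V) (a b : V) (σ τ : V → Fin 2) (X : Finset V) :
    Finset (SplitVertex a b) :=
  Finset.univ.filter fun x =>
    match x with
    | Sum.inl v => v.1 ∈ X
    | Sum.inr (Sum.inl k) => a ∈ X ∧
        ∃ v : {v : V // v ≠ a ∧ v ≠ b}, v.1 ∈ X ∧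
          (splitGraph G a b σ τ).Adj (copyA a b k) (Sum.inl v)
    | Sum.inr (Sum.inr k) => b ∈ X ∧
        ∃ v : {v : V // v ≠ a ∧ v ≠ b}, v.1 ∈ X ∧
          (splitGraph G a b σ τ).Adj (copyB a b k) (Sum.inl v)

/-- `Z` contains neither `{a₁, a₂}` nor `{b₁, b₂}`. -/
def NoTwins {a b : V} (Z : Finset (SplitVertex a b)) : Prop :=
  ¬ ({copyA a b 0, copyA a b 1} ⊆ Z) ∧ ¬ ({copyB a b 0, copyB a b 1} ⊆ Z)

/-- The nonedge-split of `(a, b)` along `σ`, `τ` is safe for the pair `(G, 𝒳)`. -/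
structure IsSafeSplit (G : SimpleGraph V) (𝒳 : Finset (Finset V)) (a b : V)
    (σ τ : V → Fin 2) : Prop where
  mem_shared : s(a, b) ∈ sharedSet 𝒳
  nonedge : ¬ G.Adj a b
  noTwins : ∀ X ∈ 𝒳, (∃ e ∈ sharedSet 𝒳, e ∉ G.edgeSet ∧ ∀ v ∈ e, v ∈ X) →
    NoTwins (splitCluster G a b σ τ X)
  agree_a : ∀ X ∈ 𝒳, ∀ Y ∈ 𝒳, X ≠ Y → ∀ u : V, u ≠ a → u ≠ b → X ∩ Y = {a, u} → ¬ G.Adj a u →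
    splitCluster G a b σ τ X ∩ {copyA a b 0, copyA a b 1} =
      splitCluster G a b σ τ Y ∩ {copyA a b 0, copyA a b 1}
  agree_b : ∀ X ∈ 𝒳, ∀ Y ∈ 𝒳, X ≠ Y → ∀ u : V, u ≠ a → u ≠ b → X ∩ Y = {b, u} → ¬ G.Adj b u →
    splitCluster G a b σ τ X ∩ {copyB a b 0, copyB a b 1} =
      splitCluster G a b σ τ Y ∩ {copyB a b 0, copyB a b 1}

open Classical in
/-- The clusters of size greater than two of the safe split cover. -/
noncomputable def bigSplitClusters (G : SimpleGraph V) (𝒳 : Finset (Finset V)) (a b : V)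
    (σ τ : V → Fin 2) : Finset (Finset (SplitVertex a b)) :=
  (𝒳.image (splitCluster G a b σ τ)).filter fun Z => 2 < Z.card ∧ NoTwins Z

open Classical in
/-- The safe split cover: the clusters of size greater than two, together with the endpoints of
every edge of the split graph that lies in none of these. -/
noncomputable def safeSplitCover (G : SimpleGraph V) (𝒳 : Finset (Finset V)) (a b : V)
    (σ τ : V → Fin 2) : Finset (Finset (SplitVertex a b)) :=
  bigSplitClusters G 𝒳 a b σ τ ∪
    Finset.univ.filter fun Z =>
      (∃ x y, (splitGraph G a b σ τ).Adj x y ∧ Z = {x, y}) ∧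
        ∀ Y ∈ bigSplitClusters G 𝒳 a b σ τ, ¬ Z ⊆ Y

/-- The four new vertices of the split graph. -/
def newVertices (a b : V) : Finset (SplitVertex a b) :=
  {copyA a b 0, copyA a b 1, copyB a b 0, copyB a b 1}

/-- `G` is a safe base graph, as witnessed by the cover `𝒳` and the safe nonedge-split of `(a, b)`
along `σ`, `τ`. -/
structure IsSafeBase (κ : RigidityModel) (G : SimpleGraph V) (𝒳 : Finset (Finset V)) (a b : V)
    (σ τ : V → Fin 2) : Prop where
  indep : IndepEdges κ G.edgeSet
  cover : IsIndepTwoThinCover κ G 𝒳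
  rank_eq : (edgeRank κ G.edgeSet : ℤ) = inclExcl κ G 𝒳
  safe : IsSafeSplit G 𝒳 a b σ τ

end Split

/-! ### Ears and gluing -/

section Glue

/-- `H` is a safe ear with safe ear cover `𝒴` and set of gluing vertices `L`. -/
structure IsSafeEar {W : Type*} [DecidableEq W] [Fintype W] (κ : RigidityModel)
    (H : SimpleGraph W) (𝒴 : Finset (Finset W)) (L : Finset W) : Prop where
  cover : IsIndepTwoThinCover κ H 𝒴
  card_inter_le : ∀ Y ∈ 𝒴, (Y ∩ L).card ≤ 2
  indep : IndepEdges κ ((sharedSet 𝒴 : Set (Sym2 W)) ∪ (pairsOf L : Set (Sym2 W)))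
  rank_eq : (edgeRank κ H.edgeSet : ℤ) = countWith κ H 𝒴 (sharedSet 𝒴 ∪ keyPairs 𝒴 L) - 1

variable {U W : Type*} [DecidableEq W] {K : Finset U} {L : Finset W}

/-- The vertices of the glued graph: those of the first graph and the vertices of the second graph
that are not gluing vertices. -/
abbrev GlueVertex (U : Type*) {W : Type*} (L : Finset W) : Type _ := U ⊕ {w : W // w ∉ L}

/-- The map from the vertices of the second graph to those of the glued graph, where each gluing
vertex is identified with its partner under `φ`. -/
def glueRight (φ : K ≃ L) (w : W) : GlueVertex U L :=
  if h : w ∈ L then Sum.inl (φ.symm ⟨w, h⟩ : K).1 else Sum.inr ⟨w, h⟩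

/-- The graph obtained by gluing `A` and `H` along the bijection `φ` of gluing vertices. -/
def glueGraph (A : SimpleGraph U) (H : SimpleGraph W) (φ : K ≃ L) :
    SimpleGraph (GlueVertex U L) :=
  SimpleGraph.fromRel fun x y =>
    (∃ u v, A.Adj u v ∧ x = Sum.inl u ∧ y = Sum.inl v) ∨
      ∃ u v, H.Adj u v ∧ x = glueRight φ u ∧ y = glueRight φ v

variable [DecidableEq U]

/-- All clusters of the two covers, viewed in the glued graph. -/
def glueClusters (𝒳 : Finset (Finset U)) (𝒴 : Finset (Finset W)) (φ : K ≃ L) :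
    Finset (Finset (GlueVertex U L)) :=
  𝒳.image (fun X => X.image Sum.inl) ∪ 𝒴.image (fun Y => Y.image (glueRight φ))

open Classical in
/-- The induced cover of the glued graph: the maximal clusters of the two covers. -/
noncomputable def glueCover (𝒳 : Finset (Finset U)) (𝒴 : Finset (Finset W)) (φ : K ≃ L) :
    Finset (Finset (GlueVertex U L)) :=
  (glueClusters 𝒳 𝒴 φ).filter fun Z => ∀ Z' ∈ glueClusters 𝒳 𝒴 φ, Z ⊆ Z' → Z' = Z

end Glue

/-- The data of a safe split-and-glue: a safe base graph `G` with its cover `𝒳` and a safe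
nonedge-split of `(a, b)`; a safe ear `H` with its cover `𝒴` and gluing vertices `L`; a set `K` of
gluing vertices of the split graph, consisting of new vertices and containing the endpoints of all
key gluing pairs; and a bijection of the gluing vertices that matches the key gluing pairs. -/
structure IsSafeSplitAndGlue {V W : Type*} [DecidableEq V] [Fintype V] [DecidableEq W] [Fintype W]
    (κ : RigidityModel) (G : SimpleGraph V) (𝒳 : Finset (Finset V)) (a b : V) (σ τ : V → Fin 2)
    (H : SimpleGraph W) (𝒴 : Finset (Finset W)) (K : Finset (SplitVertex a b)) (L : Finset W)
    (φ : K ≃ L) : Prop where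
  base : IsSafeBase κ G 𝒳 a b σ τ
  ear : IsSafeEar κ H 𝒴 L
  gluing_subset : K ⊆ newVertices a b
  key_mem : ∀ e ∈ keyPairs (safeSplitCover G 𝒳 a b σ τ) (newVertices a b), ∀ x ∈ e, x ∈ K
  key_iff : ∀ x y : K,
    s(x.1, y.1) ∈ keyPairs (safeSplitCover G 𝒳 a b σ τ) (newVertices a b) ↔
      s((φ x).1, (φ y).1) ∈ keyPairs 𝒴 L

/-! ### Linear independence of analytically varying vectors on a residual set. -/

section Generic

open Filter Topology

/-! Write N for the glued graph, S for the shared set of the base cover, and R for the ear pairs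
(the shared set of the ear cover together with the key gluing pairs).

Everything rests on one submodularity bound: if clusters are attached one at a time to a set T of
pairs, each along an independent subset of T, the rank is at most rank(T) plus the sum of the ranks
of the clusters relative to these subsets (`edgeRank_union_iUnion_le`). Double counting rewrites an
inclusion-exclusion count as |T| plus an excess per cluster (`countWith_eq`). Hence rank(G ∪ T) is
at most the count for every independent T, and equality for the base graph puts all of S, in
particular ab, in the closure of G.

For N, each pair of S other than ab is lifted to the split vertices. Safety makes the lift unique
(`liftedPairs_injOn`), so there are at most |S| - 1 lifted pairs. Attaching the clusters of both
covers to the lifted pairs and to R gives a rank bound which, apart from the lifts of ab, does not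
exceed |E(N)|: losing the pair ab on the base side matches the -1 in the rank formula of the ear
(`count_le_ncard`, `edgeRank_le`).

A lift of ab whose ends are genuine copies is a key gluing pair, so the ear already provides it. A
cluster may however contain a or b without any neighbour of it; then the missing copy is replaced by
a phantom vertex. The lifts of ab that meet a phantom are removed by zero-extensions
(`edgeRank_union_phantom`). If N is independent, the upper bound is therefore attained by N and
these phantom lifts alone. It follows that no other lifted pair meets a phantom and that all lifted
pairs and ear pairs lie in the closure of N (`inr_notMem_of_mem_gluedLiftedPairs`,
`edgeRank_insert_eq`). Since the shared set of the glued cover consists of such pairs, its nonedges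
are implied. Some ear pair is a nonedge, because otherwise the count of the independent ear could
not exceed its number of edges.

The lifted pairs and R are jointly independent by a splitting lemma (`IndepEdges.union_of_split`).
Suppose that a combination of lifted rows vanishes away from the split vertices. Its image under
identification of the copies is supported on a and b and is in equilibrium, so it is a multiple of
the row of ab; independence of S then forces it to be trivial. So the shared set of the glued cover
is independent, which gives rank(N) ≤ IE. The reverse inequality compares the excess of every glued
cluster with that of the cluster it comes from (`sum_clusterExcess_le`). -/

theorem linearIndependent_iff_det_mul_transpose_ne_zero {ι κ : Type*} [Fintype ι] [DecidableEq ι]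
    [Fintype κ] (M : Matrix ι κ ℝ) :
    LinearIndependent ℝ (fun i => M i) ↔ (M * M.transpose).det ≠ 0 := by
  have h0 : LinearIndependent ℝ (fun i => M i) ↔ Function.Injective M.vecMulLinear :=
    Matrix.vecMul_injective_iff.symm
  rw [h0, ne_eq, ← Matrix.exists_vecMul_eq_zero_iff, injective_iff_map_eq_zero M.vecMulLinear]
  push Not
  -- Over the reals, vMMᵀ = 0 gives |vM|² = 0, so the Gram determinant alone decides independence.
  have key : ∀ v : ι → ℝ, Matrix.vecMul v (M * M.transpose) = 0 ↔ Matrix.vecMul v M = 0 := by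
    intro v
    have := Matrix.vecMul_self_mul_conjTranspose_eq_zero M v
    rwa [Matrix.conjTranspose_eq_transpose_of_trivial] at this
  constructor
  · intro h v hv hv'
    exact hv (h v ((key v).1 hv'))
  · intro h v hv
    by_contra hne
    exact h v hne ((key v).2 hv)

/-- If an analytically varying finite family of vectors is linearly independent somewhere, then it
is linearly independent on a dense open set. -/
theorem eventually_residual_linearIndependent {E ι κ : Type*} [NormedAddCommGroup E]
    [NormedSpace ℝ E] [Finite ι] [Fintype κ] (f : E → ι → κ → ℝ)
    (hf : ∀ i k, AnalyticOnNhd ℝ (fun p => f p i k) Set.univ) (p₀ : E)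
    (h₀ : LinearIndependent ℝ (f p₀)) : ∀ᶠ p in residual E, LinearIndependent ℝ (f p) := by
  classical
  cases nonempty_fintype ι
  let g : E → ℝ := fun p => (Matrix.of (f p) * (Matrix.of (f p)).transpose).det
  have hg : ∀ p, LinearIndependent ℝ (f p) ↔ g p ≠ 0 := fun p =>
    linearIndependent_iff_det_mul_transpose_ne_zero (Matrix.of (f p))
  have hga : AnalyticOnNhd ℝ g Set.univ := by
    intro p _
    have : g = fun p => ∑ s : Equiv.Perm ι, ((Equiv.Perm.sign s : ℤ) : ℝ) *
        ∏ i, ∑ k, f p (s i) k * f p i k := by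
      funext p
      simp only [g, Matrix.det_apply', Matrix.mul_apply, Matrix.transpose_apply, Matrix.of_apply]
    rw [this]
    refine Finset.analyticAt_fun_sum _ fun s _ => analyticAt_const.mul
      (Finset.analyticAt_fun_prod _ fun i _ => Finset.analyticAt_fun_sum _ fun k _ => ?_)
    exact (hf _ _ p trivial).mul (hf _ _ p trivial)
  have hcont : Continuous g := continuousOn_univ.1 hga.continuousOn
  simp only [hg]
  refine residual_of_dense_open (isOpen_ne_fun hcont continuous_const) ?_
  rw [show {p | g p ≠ 0} = {p | g p = 0}ᶜ from rfl, ← interior_eq_empty_iff_dense_compl]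
  by_contra hne
  obtain ⟨p, hp⟩ := Set.nonempty_iff_ne_empty.2 hne
  have hz : g =ᶠ[𝓝 p] 0 := mem_interior_iff_mem_nhds.1 hp
  -- Identity theorem: vanishing near one point of the connected space would propagate to `p₀`.
  have := hga.eqOn_zero_of_preconnected_of_eventuallyEq_zero isPreconnected_univ
    (Set.mem_univ p) hz (Set.mem_univ p₀)
  exact (hg p₀).1 h₀ this

theorem eventually_residual_linearIndependent_pi {E ι V : Type*} [NormedAddCommGroup E]
    [NormedSpace ℝ E] [Finite ι] [Fintype V] (f : E → ι → V → Fin 3 → ℝ)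
    (hf : ∀ i v k, AnalyticOnNhd ℝ (fun p => f p i v k) Set.univ) (p₀ : E)
    (h₀ : LinearIndependent ℝ (f p₀)) : ∀ᶠ p in residual E, LinearIndependent ℝ (f p) := by
  let L := (LinearEquiv.curry ℝ ℝ V (Fin 3)).symm
  have hL : ∀ p, LinearIndependent ℝ (fun i => L (f p i)) ↔ LinearIndependent ℝ (f p) := fun p =>
    L.toLinearMap.linearIndependent_iff_of_injOn L.injective.injOn
  simp only [← hL] at h₀ ⊢
  exact eventually_residual_linearIndependent (fun p i => L (f p i)) (fun i k => hf i k.1 k.2) p₀ h₀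

end Generic

/-! ### Rows of the rigidity matrix and generic frameworks. -/

section Rows

open Filter Topology

variable {V : Type*}

theorem analyticOnNhd_edgeDir [Fintype V] (κ : RigidityModel) (u v : V) (k : Fin 3) :
    AnalyticOnNhd ℝ (fun p : V → Fin 3 → ℝ => edgeDir κ (p u) (p v) k) Set.univ := by
  have h : ∀ (u : V) (k : Fin 3), AnalyticOnNhd ℝ (fun p : V → Fin 3 → ℝ => p u k) Set.univ := by
    intro u k
    exact ((ContinuousLinearMap.proj (R := ℝ) (φ := fun _ : Fin 3 => ℝ) k).comp
      (ContinuousLinearMap.proj (R := ℝ) (φ := fun _ : V => Fin 3 → ℝ) u)).analyticOnNhd _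
  cases κ with
  | barJoint => exact (h u k).sub (h v k)
  | cofactor =>
    have h0 := (h u 0).sub (h v 0)
    have h1 := (h u 1).sub (h v 1)
    fin_cases k
    · exact h0.pow 2
    · exact h0.mul h1
    · exact h1.pow 2

variable [DecidableEq V]

theorem rigidityRow_apply (κ : RigidityModel) (p : V → Fin 3 → ℝ) (u v x : V) :
    rigidityRow κ p u v x = ((if x = u then 1 else 0) - (if x = v then 1 else 0) : ℝ) •
      edgeDir κ (p u) (p v) := by
  simp only [rigidityRow, Pi.sub_apply, Pi.single_apply, sub_smul, ite_smul, one_smul, zero_smul]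

theorem analyticOnNhd_rigidityRow [Fintype V] (κ : RigidityModel) (u v x : V) (k : Fin 3) :
    AnalyticOnNhd ℝ (fun p : V → Fin 3 → ℝ => rigidityRow κ p u v x k) Set.univ := by
  simp only [rigidityRow_apply, Pi.smul_apply, smul_eq_mul]
  exact analyticOnNhd_const.mul (analyticOnNhd_edgeDir κ u v k)

/-- The bar direction is odd in its two points, which cancels the sign of the swap; the cofactor
direction is even, so there the sign survives. -/
theorem rigidityRow_swap (κ : RigidityModel) (p : V → Fin 3 → ℝ) (u v : V) :
    rigidityRow κ p v u = rigidityRow κ p u v ∨ rigidityRow κ p v u = -rigidityRow κ p u v := by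
  cases κ with
  | barJoint =>
    left
    have : edgeDir .barJoint (p v) (p u) = -edgeDir .barJoint (p u) (p v) := (neg_sub _ _).symm
    funext x
    rw [rigidityRow_apply, rigidityRow_apply, this, smul_neg, ← neg_smul, neg_sub]
  | cofactor =>
    right
    have : edgeDir .cofactor (p v) (p u) = edgeDir .cofactor (p u) (p v) := by
      simp only [edgeDir]
      congr 1
      · ring
      congr 1
      · ring
      congr 1
      ring
    funext x
    rw [Pi.neg_apply, rigidityRow_apply, rigidityRow_apply, this, ← neg_smul, neg_sub]

/-- The row of the edge `e`, for a fixed choice of its orientation. -/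
noncomputable def edgeRow (κ : RigidityModel) (p : V → Fin 3 → ℝ) (e : Sym2 V) : V → Fin 3 → ℝ :=
  rigidityRow κ p e.out.1 e.out.2

theorem rigidityRow_eq_or (κ : RigidityModel) (p : V → Fin 3 → ℝ) (u v : V) :
    rigidityRow κ p u v = edgeRow κ p s(u, v) ∨ rigidityRow κ p u v = -edgeRow κ p s(u, v) := by
  have h : s((s(u, v)).out.1, (s(u, v)).out.2) = s(u, v) := Quot.out_eq _
  rcases Sym2.eq_iff.1 h with ⟨h1, h2⟩ | ⟨h1, h2⟩
  · left
    rw [edgeRow, h1, h2]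
  · rw [edgeRow, h1, h2]
    exact rigidityRow_swap κ p v u

theorem span_rigidityRow_eq (κ : RigidityModel) (p : V → Fin 3 → ℝ) (E : Set (Sym2 V)) :
    Submodule.span ℝ {r | ∃ u v : V, s(u, v) ∈ E ∧ r = rigidityRow κ p u v} =
      Submodule.span ℝ (edgeRow κ p '' E) := by
  apply le_antisymm
  · rw [Submodule.span_le]
    rintro _ ⟨u, v, he, rfl⟩
    have hm : edgeRow κ p s(u, v) ∈ Submodule.span ℝ (edgeRow κ p '' E) :=
      Submodule.subset_span ⟨_, he, rfl⟩
    rcases rigidityRow_eq_or κ p u v with h | h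
    · rw [h]; exact hm
    · rw [h]; exact neg_mem hm
  · apply Submodule.span_mono
    rintro _ ⟨e, he, rfl⟩
    refine ⟨e.out.1, e.out.2, ?_, rfl⟩
    have : s(e.out.1, e.out.2) = e := Quot.out_eq _
    rwa [this]

theorem frameworkRank_eq (κ : RigidityModel) (p : V → Fin 3 → ℝ) (E : Set (Sym2 V)) :
    frameworkRank κ p E = Module.finrank ℝ (Submodule.span ℝ (edgeRow κ p '' E)) := by
  rw [frameworkRank, span_rigidityRow_eq]

variable [Fintype V]

theorem frameworkRank_le_edgeRank (κ : RigidityModel) (p : V → Fin 3 → ℝ) (E : Set (Sym2 V)) :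
    frameworkRank κ p E ≤ edgeRank κ E :=
  le_ciSup (f := fun p => frameworkRank κ p E)
    ⟨Module.finrank ℝ (V → Fin 3 → ℝ), by
      rintro _ ⟨p, rfl⟩
      exact Submodule.finrank_le _⟩ p

theorem exists_frameworkRank_eq (κ : RigidityModel) (E : Set (Sym2 V)) :
    ∃ p : V → Fin 3 → ℝ, frameworkRank κ p E = edgeRank κ E :=
  Nat.sSup_mem (Set.range_nonempty fun p : V → Fin 3 → ℝ => frameworkRank κ p E)
    ⟨Module.finrank ℝ (V → Fin 3 → ℝ), by
      rintro _ ⟨p, rfl⟩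
      exact Submodule.finrank_le _⟩

theorem analyticOnNhd_edgeRow (κ : RigidityModel) (e : Sym2 V) (x : V) (k : Fin 3) :
    AnalyticOnNhd ℝ (fun p : V → Fin 3 → ℝ => edgeRow κ p e x k) Set.univ :=
  analyticOnNhd_rigidityRow κ e.out.1 e.out.2 x k

theorem eventually_linearIndepOn_edgeRow (κ : RigidityModel) (E : Set (Sym2 V))
    (p₀ : V → Fin 3 → ℝ) (h : LinearIndepOn ℝ (edgeRow κ p₀) E) :
    ∀ᶠ p in residual (V → Fin 3 → ℝ), LinearIndepOn ℝ (edgeRow κ p) E :=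
  eventually_residual_linearIndependent_pi
    (fun (p : V → Fin 3 → ℝ) (e : E) => edgeRow κ p e)
    (fun e v k => analyticOnNhd_edgeRow κ e v k) p₀ h

theorem finrank_span_image_of_linearIndepOn {ι M : Type*} [AddCommGroup M] [Module ℝ M]
    {f : ι → M} {s : Set ι} (h : LinearIndepOn ℝ f s) (hs : s.Finite) :
    Module.finrank ℝ (Submodule.span ℝ (f '' s)) = s.ncard := by
  have := hs.fintype
  have h1 := finrank_span_eq_card h
  rw [← Set.image_eq_range] at h1
  rw [h1, Set.ncard_eq_toFinset_card', Set.toFinset_card]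

/-- For a single edge set, a basis of rows at a framework of maximal rank stays independent
generically. There are only finitely many edge sets, so one framework attains all the suprema at
once and the generic rank becomes a rank of spans. -/
theorem eventually_frameworkRank_eq (κ : RigidityModel) :
    ∀ᶠ p in residual (V → Fin 3 → ℝ), ∀ E : Set (Sym2 V), frameworkRank κ p E = edgeRank κ E := by
  rw [Filter.eventually_all]
  intro E
  obtain ⟨p₀, hp₀⟩ := exists_frameworkRank_eq κ E
  obtain ⟨B, hB, -, hBE, hBi⟩ := exists_linearIndepOn_extension
    (linearIndepOn_empty ℝ (edgeRow κ p₀)) (Set.empty_subset E)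
  have hspan : Submodule.span ℝ (edgeRow κ p₀ '' B) = Submodule.span ℝ (edgeRow κ p₀ '' E) :=
    le_antisymm (Submodule.span_mono (Set.image_mono hB)) (Submodule.span_le.2 hBE)
  filter_upwards [eventually_linearIndepOn_edgeRow κ B p₀ hBi] with p hp
  refine le_antisymm (frameworkRank_le_edgeRank κ p E) ?_
  rw [← hp₀, frameworkRank_eq, frameworkRank_eq, ← hspan,
    finrank_span_image_of_linearIndepOn hBi B.toFinite,
    ← finrank_span_image_of_linearIndepOn hp B.toFinite]
  exact Submodule.finrank_mono (Submodule.span_mono (Set.image_mono hB))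

/-- A property that holds generically holds at some framework that attains all ranks. -/
theorem exists_generic (κ : RigidityModel) {P : (V → Fin 3 → ℝ) → Prop}
    (hP : ∀ᶠ p in residual (V → Fin 3 → ℝ), P p) :
    ∃ p, P p ∧ ∀ E : Set (Sym2 V),
      Module.finrank ℝ (Submodule.span ℝ (edgeRow κ p '' E)) = edgeRank κ E := by
  obtain ⟨p, hp⟩ := (dense_of_mem_residual
    (hP.and (eventually_frameworkRank_eq (V := V) κ))).nonempty
  exact ⟨p, hp.1, fun E => by rw [← frameworkRank_eq, hp.2]⟩

end Rows

/-! ### Matroid properties of the generic rank. -/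

section RankFacts

open Filter Topology

variable {V : Type*} [DecidableEq V] [Fintype V] (κ : RigidityModel)

theorem exists_generic_rank : ∃ p : V → Fin 3 → ℝ, ∀ E : Set (Sym2 V),
    Module.finrank ℝ (Submodule.span ℝ (edgeRow κ p '' E)) = edgeRank κ E :=
  (exists_generic κ (P := fun _ => True) (Filter.Eventually.of_forall fun _ => trivial)).imp
    fun _ h => h.2

theorem edgeRank_mono {A B : Set (Sym2 V)} (h : A ⊆ B) : edgeRank κ A ≤ edgeRank κ B := by
  obtain ⟨p, hp⟩ := exists_generic_rank (V := V) κ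
  rw [← hp, ← hp]
  exact Submodule.finrank_mono (Submodule.span_mono (Set.image_mono h))

theorem edgeRank_le_ncard (A : Set (Sym2 V)) : edgeRank κ A ≤ A.ncard := by
  classical
  obtain ⟨p, hp⟩ := exists_generic_rank (V := V) κ
  rw [← hp]
  have h1 := finrank_span_le_card (R := ℝ) (edgeRow κ p '' A)
  rw [← Set.ncard_eq_toFinset_card'] at h1
  exact h1.trans (Set.ncard_image_le A.toFinite)

theorem edgeRank_empty : edgeRank κ (∅ : Set (Sym2 V)) = 0 := by
  have := edgeRank_le_ncard κ (∅ : Set (Sym2 V))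
  simpa using this

/-- Submodularity is the dimension formula for two spans at a generic framework; the span of the
common rows lies in the intersection of the spans. -/
theorem edgeRank_union_add_inter_le (A B : Set (Sym2 V)) :
    edgeRank κ (A ∪ B) + edgeRank κ (A ∩ B) ≤ edgeRank κ A + edgeRank κ B := by
  obtain ⟨p, hp⟩ := exists_generic_rank (V := V) κ
  have h1 := Submodule.finrank_sup_add_finrank_inf_eq
    (Submodule.span ℝ (edgeRow κ p '' A)) (Submodule.span ℝ (edgeRow κ p '' B))
  have h2 : Submodule.span ℝ (edgeRow κ p '' (A ∩ B)) ≤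
      Submodule.span ℝ (edgeRow κ p '' A) ⊓ Submodule.span ℝ (edgeRow κ p '' B) :=
    le_inf (Submodule.span_mono (Set.image_mono Set.inter_subset_left))
      (Submodule.span_mono (Set.image_mono Set.inter_subset_right))
  have h3 := Submodule.finrank_mono h2
  rw [← Submodule.span_union, ← Set.image_union, hp, hp, hp] at h1
  rw [hp] at h3
  omega

variable {κ}

theorem edgeRank_union_add_ncard_le {A B D : Set (Sym2 V)} (hD : IndepEdges κ D) (hA : D ⊆ A)
    (hB : D ⊆ B) : edgeRank κ (A ∪ B) + D.ncard ≤ edgeRank κ A + edgeRank κ B := by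
  have h1 := edgeRank_union_add_inter_le κ A B
  have h2 := edgeRank_mono κ (Set.subset_inter hA hB)
  rw [IndepEdges] at hD
  omega

theorem edgeRank_union_le (A B : Set (Sym2 V)) :
    edgeRank κ (A ∪ B) ≤ edgeRank κ A + edgeRank κ B :=
  (Nat.le_add_right _ _).trans (edgeRank_union_add_inter_le κ A B)

theorem IndepEdges.of_ncard_le {A : Set (Sym2 V)} (h : A.ncard ≤ edgeRank κ A) : IndepEdges κ A :=
  le_antisymm (edgeRank_le_ncard κ A) h

theorem IndepEdges.subset {A B : Set (Sym2 V)} (hB : IndepEdges κ B) (h : A ⊆ B) :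
    IndepEdges κ A := by
  apply IndepEdges.of_ncard_le
  have h1 := edgeRank_union_le (κ := κ) A (B \ A)
  rw [Set.union_sdiff_cancel h, hB] at h1
  have h2 := edgeRank_le_ncard κ (B \ A)
  have h3 := Set.ncard_sdiff_add_ncard_of_subset h B.toFinite
  omega

/-- Attaching `A i` to whatever contains `T` costs at most its rank minus the size of the
independent overlap `D i`. All upper bounds on ranks of covered graphs come from here. -/
theorem edgeRank_union_iUnion_le {ι : Type*} (s : Finset ι) (T : Set (Sym2 V))
    (A D : ι → Set (Sym2 V)) (hDA : ∀ i ∈ s, D i ⊆ A i) (hDT : ∀ i ∈ s, D i ⊆ T)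
    (hD : ∀ i ∈ s, IndepEdges κ (D i)) :
    (edgeRank κ (T ∪ ⋃ i ∈ s, A i) : ℤ) ≤
      edgeRank κ T + ∑ i ∈ s, ((edgeRank κ (A i) : ℤ) - (D i).ncard) := by
  classical
  induction s using Finset.induction_on with
  | empty => simp
  | insert i s hi ih =>
    have h1 := ih (fun j hj => hDA j (Finset.mem_insert_of_mem hj))
      (fun j hj => hDT j (Finset.mem_insert_of_mem hj))
      (fun j hj => hD j (Finset.mem_insert_of_mem hj))
    have hmem := Finset.mem_insert_self i s
    have h2 := edgeRank_union_add_ncard_le (A := A i) (B := T ∪ ⋃ i ∈ s, A i) (hD i hmem)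
      (hDA i hmem) ((hDT i hmem).trans Set.subset_union_left)
    rw [Finset.sum_insert hi, Finset.set_biUnion_insert, Set.union_left_comm]
    push_cast [← Int.ofNat_le] at h2
    linarith

/-- In an independent graph, the nonedges in the closure of the edge set are implied. -/
theorem isImpliedNonedge_of_edgeRank_insert {G : SimpleGraph V} {e : Sym2 V}
    (hG : IndepEdges κ G.edgeSet) (hd : ¬ e.IsDiag) (he : e ∉ G.edgeSet)
    (h : edgeRank κ (insert e G.edgeSet) = edgeRank κ G.edgeSet) : IsImpliedNonedge κ G e := by
  -- A minimal edge set that spans `e` becomes a circuit once `e` is added.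
  obtain ⟨D, hDG, hD⟩ := exists_minimal_le_of_wellFoundedLT
    (fun D : Set (Sym2 V) => D ⊆ G.edgeSet ∧ edgeRank κ (insert e D) = edgeRank κ D)
    G.edgeSet ⟨subset_rfl, h⟩
  have heD : e ∉ D := fun h' => he (hDG h')
  have hDi := hG.subset hDG
  refine ⟨hd, he, insert e D, Set.insert_subset_insert hDG, Set.mem_insert _ _, ?_, ?_, ?_⟩
  · rintro f (rfl | hf)
    · exact hd
    · exact G.not_isDiag_of_mem_edgeSet (hDG hf)
  · intro hi
    have h2 := hD.prop.2
    rw [IndepEdges, Set.ncard_insert_of_notMem heD D.toFinite, h2] at hi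
    have := edgeRank_le_ncard κ D
    omega
  · intro C hC
    by_cases heC : e ∈ C
    · have hss : C \ {e} ⊆ D := by
        rintro f ⟨hf, hfe⟩
        exact (hC.1 hf).resolve_left hfe
      -- By minimality of `D`, the proper subset `C \ {e}` does not span `e`, so `e` raises its
      -- rank.
      have hne : edgeRank κ (insert e (C \ {e})) ≠ edgeRank κ (C \ {e}) := by
        intro heq
        have := hD.le_of_le ⟨hss.trans hDG, heq⟩ hss
        apply hC.2
        rintro f (rfl | hf)
        · exact heC
        · exact (this hf).1
      have hi := hDi.subset hss
      have h1 := edgeRank_mono κ (Set.subset_insert e (C \ {e}))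
      rw [Set.insert_sdiff_singleton, Set.insert_eq_of_mem heC] at hne h1
      have h2 := Set.ncard_sdiff_singleton_add_one heC C.toFinite
      rw [IndepEdges] at hi
      apply IndepEdges.of_ncard_le
      omega
    · refine hDi.subset fun f hf => (hC.1 hf).resolve_left ?_
      rintro rfl
      exact heC hf

end RankFacts

/-! ### Invariance of the rank under injective maps of vertices. -/

section Transport

variable {V Ω : Type*} [DecidableEq Ω]

/-- Pushing vectors on the vertices forward along a map of vertices. -/
noncomputable def pushforward [Fintype V] (f : V → Ω) :
    (V → Fin 3 → ℝ) →ₗ[ℝ] (Ω → Fin 3 → ℝ) :=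
  ∑ v : V, (LinearMap.single ℝ (fun _ : Ω => Fin 3 → ℝ) (f v)).comp (LinearMap.proj v)

theorem pushforward_apply [Fintype V] (f : V → Ω) (z : V → Fin 3 → ℝ) :
    pushforward f z = ∑ v : V, Pi.single (f v) (z v) := by
  simp [pushforward]

theorem pushforward_injective [Fintype V] {f : V → Ω} (hf : Function.Injective f) :
    Function.Injective (pushforward f) := by
  rw [injective_iff_map_eq_zero]
  intro z hz
  funext v
  have := congrFun hz (f v)
  rw [pushforward_apply, Finset.sum_apply, Finset.sum_eq_single v] at this
  · simpa using this
  · intro w _ hw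
    rw [Pi.single_eq_of_ne fun h => hw (hf h).symm]
  · simp

variable [DecidableEq V]

theorem pushforward_single [Fintype V] (f : V → Ω) (v : V) (x : Fin 3 → ℝ) :
    pushforward f (Pi.single v x) = Pi.single (f v) x := by
  rw [pushforward_apply, Finset.sum_eq_single v]
  · simp
  · intro w _ hw
    rw [Pi.single_eq_of_ne hw, Pi.single_zero]
  · simp

theorem pushforward_rigidityRow [Fintype V] (κ : RigidityModel) (f : V → Ω)
    (p : Ω → Fin 3 → ℝ) (u v : V) :
    pushforward f (rigidityRow κ (p ∘ f) u v) = rigidityRow κ p (f u) (f v) := by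
  simp only [rigidityRow, map_sub, pushforward_single, Function.comp_apply]

theorem frameworkRank_image [Fintype V] (κ : RigidityModel) {f : V → Ω}
    (hf : Function.Injective f) (p : Ω → Fin 3 → ℝ) (E : Set (Sym2 V)) :
    frameworkRank κ p (Sym2.map f '' E) = frameworkRank κ (p ∘ f) E := by
  have h : {r | ∃ u v : Ω, s(u, v) ∈ Sym2.map f '' E ∧ r = rigidityRow κ p u v} =
      pushforward f '' {r | ∃ u v : V, s(u, v) ∈ E ∧ r = rigidityRow κ (p ∘ f) u v} := by
    ext r
    constructor
    · rintro ⟨u, v, ⟨e, he, heq⟩, rfl⟩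
      induction e using Sym2.ind with
      | _ x y =>
        rw [Sym2.map_mk] at heq
        rcases Sym2.eq_iff.1 heq with ⟨rfl, rfl⟩ | ⟨rfl, rfl⟩
        · exact ⟨_, ⟨x, y, he, rfl⟩, pushforward_rigidityRow κ f p x y⟩
        · exact ⟨_, ⟨y, x, Sym2.eq_swap ▸ he, rfl⟩, pushforward_rigidityRow κ f p y x⟩
    · rintro ⟨_, ⟨x, y, he, rfl⟩, rfl⟩
      exact ⟨f x, f y, ⟨_, he, rfl⟩, pushforward_rigidityRow κ f p x y⟩
  rw [frameworkRank, frameworkRank, h, ← Submodule.map_span]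
  exact (Submodule.equivMapOfInjective _ (pushforward_injective hf) _).finrank_eq.symm

/-- The generic rank is invariant under injective maps of vertices. -/
theorem edgeRank_image [Fintype V] (κ : RigidityModel) {f : V → Ω}
    (hf : Function.Injective f) (E : Set (Sym2 V)) :
    edgeRank κ (Sym2.map f '' E) = edgeRank κ E := by
  simp only [edgeRank, frameworkRank_image κ hf]
  -- Every placement of the source extends along an injective map, so both suprema run over the same
  -- values.
  exact hf.surjective_comp_right.iSup_comp (fun p => frameworkRank κ p E)

theorem IndepEdges.image [Fintype V] {κ : RigidityModel} {f : V → Ω}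
    (hf : Function.Injective f) {E : Set (Sym2 V)} (h : IndepEdges κ E) :
    IndepEdges κ (Sym2.map f '' E) := by
  rw [IndepEdges, edgeRank_image κ hf, h, Set.ncard_image_of_injective _ (Sym2.map.injective hf)]

end Transport

/-! ### Zero-extensions: a new vertex with at most three edges. -/

section ZeroExtension

open Filter Topology

theorem LinearIndependent.of_eq_or_eq_neg {ι M : Type*} [AddCommGroup M] [Module ℝ M]
    {v w : ι → M} (hv : LinearIndependent ℝ v) (h : ∀ i, w i = v i ∨ w i = -v i) :
    LinearIndependent ℝ w := by
  classical
  have : w = (fun i => if w i = v i then (1 : ℝˣ) else -1) • v := by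
    funext i
    simp only [Pi.smul_apply']
    split_ifs with h'
    · rw [one_smul, h']
    · rw [Units.neg_smul, one_smul, (h i).resolve_left h']
  rw [this]
  exact hv.units_smul _

/-- Three points that are joined to the origin by independent edge vectors. -/
def tripodPoint : RigidityModel → Fin 3 → (Fin 3 → ℝ)
  | RigidityModel.barJoint => ![![1, 0, 0], ![0, 1, 0], ![0, 0, 1]]
  | RigidityModel.cofactor => ![![1, 0, 0], ![0, 1, 0], ![1, 1, 0]]

/-- The bar directions are the negated unit vectors. The cofactor directions are (1,0,0), (0,0,1)
and (1,1,1), since the three points have distinct slopes. -/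
theorem linearIndependent_tripod (κ : RigidityModel) :
    LinearIndependent ℝ (fun i => edgeDir κ 0 (tripodPoint κ i)) := by
  rw [Fintype.linearIndependent_iff]
  intro g hg
  have h0 := congrFun hg 0
  have h1 := congrFun hg 1
  have h2 := congrFun hg 2
  cases κ <;> simp [Fin.sum_univ_three, edgeDir, tripodPoint] at h0 h1 h2 <;> intro i <;>
    fin_cases i <;> simp <;> linarith

variable {V : Type*} [DecidableEq V]

theorem edgeRow_mk_apply_left (κ : RigidityModel) (p : V → Fin 3 → ℝ) {x v : V} (h : v ≠ x) :
    edgeRow κ p s(x, v) x = edgeDir κ (p x) (p v) ∨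
      edgeRow κ p s(x, v) x = -edgeDir κ (p x) (p v) := by
  have hx : rigidityRow κ p x v x = edgeDir κ (p x) (p v) := by
    simp [rigidityRow_apply, h.symm]
  rcases rigidityRow_eq_or κ p x v with h1 | h1
  · left
    rw [← h1, hx]
  · right
    rw [← hx, h1, Pi.neg_apply, neg_neg]

theorem edgeRow_apply_of_notMem (κ : RigidityModel) (p : V → Fin 3 → ℝ) {e : Sym2 V} {x : V}
    (h : x ∉ e) : edgeRow κ p e x = 0 := by
  have he : s(e.out.1, e.out.2) = e := Quot.out_eq _
  have h1 : x ≠ e.out.1 := fun h' => h (he ▸ h' ▸ Sym2.mem_mk_left _ _)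
  have h2 : x ≠ e.out.2 := fun h' => h (he ▸ h' ▸ Sym2.mem_mk_right _ _)
  simp [edgeRow, rigidityRow_apply, h1, h2]

variable [Fintype V] {κ : RigidityModel}

theorem eventually_linearIndependent_star (κ : RigidityModel) {x : V} {D : Set (Sym2 V)}
    (hD : ∀ e ∈ D, x ∈ e ∧ ¬ e.IsDiag) (hc : D.ncard ≤ 3) :
    ∀ᶠ p in residual (V → Fin 3 → ℝ), LinearIndependent ℝ (fun e : D => edgeRow κ p e x) := by
  classical
  obtain ⟨g⟩ : Nonempty (D ↪ Fin 3) := by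
    apply Function.Embedding.nonempty_of_card_le
    rwa [Fintype.card_fin, ← Set.toFinset_card, ← Set.ncard_eq_toFinset_card']
  -- The centre `x` goes to the origin, because `D` has no diagonal pair, and its neighbours go to
  -- distinct tripod points.
  let p₀ : V → Fin 3 → ℝ := fun v =>
    if h : s(x, v) ∈ D then tripodPoint κ (g ⟨_, h⟩) else 0
  refine eventually_residual_linearIndependent
    (fun (p : V → Fin 3 → ℝ) (e : D) => edgeRow κ p e x)
    (fun e k => analyticOnNhd_edgeRow κ e x k) p₀ ?_
  refine ((linearIndependent_tripod κ).comp g g.injective).of_eq_or_eq_neg ?_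
  rintro ⟨e, he⟩
  obtain ⟨hx, hd⟩ := hD e he
  obtain ⟨v, rfl⟩ := Sym2.mem_iff_exists.1 hx
  have hv : v ≠ x := fun h => hd (h ▸ rfl)
  have hpx : p₀ x = 0 := by
    have : s(x, x) ∉ D := fun h => (hD _ h).2 rfl
    simp [p₀, this]
  have hpv : p₀ v = tripodPoint κ (g ⟨_, he⟩) := by
    simp [p₀, he]
  have := edgeRow_mk_apply_left κ p₀ hv
  rwa [hpx, hpv] at this

/-- Zero-extension: adding a new vertex together with at most three edges at this vertex increases
the rank by the number of these edges. -/
theorem edgeRank_union_star {x : V} {E D : Set (Sym2 V)} (hE : ∀ e ∈ E, x ∉ e)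
    (hD : ∀ e ∈ D, x ∈ e ∧ ¬ e.IsDiag) (hc : D.ncard ≤ 3) :
    edgeRank κ (E ∪ D) = edgeRank κ E + D.ncard := by
  obtain ⟨p, hp, hr⟩ := exists_generic κ (eventually_linearIndependent_star κ hD hc)
  have hli : LinearIndependent ℝ ((LinearMap.proj (R := ℝ) (φ := fun _ : V => Fin 3 → ℝ) x) ∘
    fun e : D => edgeRow κ p e) := hp
  have hD' : LinearIndepOn ℝ (edgeRow κ p) D := hli.of_comp _
  -- The rows of `D` are independent already in the block at `x`, where all rows of `E` vanish;
  -- hence the two spans meet trivially.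
  have hdis := Submodule.range_ker_disjoint hli
  rw [← Set.image_eq_range] at hdis
  have hker : Submodule.span ℝ (edgeRow κ p '' E) ≤
      LinearMap.ker (LinearMap.proj (R := ℝ) (φ := fun _ : V => Fin 3 → ℝ) x) := by
    rw [Submodule.span_le]
    rintro _ ⟨e, he, rfl⟩
    exact edgeRow_apply_of_notMem κ p (hE e he)
  have hinf : Submodule.span ℝ (edgeRow κ p '' E) ⊓ Submodule.span ℝ (edgeRow κ p '' D) = ⊥ :=
    (hdis.mono_right hker).symm.eq_bot
  have h1 := Submodule.finrank_sup_add_finrank_inf_eq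
    (Submodule.span ℝ (edgeRow κ p '' E)) (Submodule.span ℝ (edgeRow κ p '' D))
  rw [hinf, finrank_bot, ← Submodule.span_union, ← Set.image_union, hr, hr,
    finrank_span_image_of_linearIndepOn hD' D.toFinite] at h1
  omega

end ZeroExtension

/-! ### Equilibrium of row combinations and stresses supported on two vertices. -/

section Pinning

variable {V : Type*} [DecidableEq V] [Fintype V] {κ : RigidityModel}

theorem sum_eq_zero_of_mem_span_edgeRow {p z : V → Fin 3 → ℝ}
    (hz : z ∈ Submodule.span ℝ (Set.range (edgeRow κ p))) : ∑ x, z x = 0 := by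
  induction hz using Submodule.span_induction with
  | mem z hz =>
    obtain ⟨e, rfl⟩ := hz
    simp [edgeRow, rigidityRow]
  | zero => simp
  | add y z _ _ hy hz => simp [Finset.sum_add_distrib, hy, hz]
  | smul c z _ hz => simp [← Finset.smul_sum, hz]

/-- A matrix `M` that gives rise to the trivial infinitesimal motion `x ↦ Mᵀ x`. -/
def IsTrivialMotion (κ : RigidityModel) (M : Matrix (Fin 3) (Fin 3) ℝ) : Prop :=
  ∀ x y : Fin 3 → ℝ, (x - y) ⬝ᵥ M.mulVec (edgeDir κ x y) = 0

/-- A row puts opposite multiples of its direction at its two ends, so its pairing with the motion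
reduces to the expression that vanishes by `hM`. This is the moment condition. -/
theorem sum_dotProduct_eq_zero_of_mem_span_edgeRow {M : Matrix (Fin 3) (Fin 3) ℝ}
    (hM : IsTrivialMotion κ M) {p z : V → Fin 3 → ℝ}
    (hz : z ∈ Submodule.span ℝ (Set.range (edgeRow κ p))) :
    ∑ x, p x ⬝ᵥ M.mulVec (z x) = 0 := by
  induction hz using Submodule.span_induction with
  | mem z hz =>
    obtain ⟨e, rfl⟩ := hz
    have h := hM (p e.out.1) (p e.out.2)
    rw [sub_dotProduct] at h
    simp only [edgeRow, rigidityRow_apply, Matrix.mulVec_smul, dotProduct_smul, smul_eq_mul,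
      sub_mul, ite_mul, one_mul, zero_mul, Finset.sum_sub_distrib, Finset.sum_ite_eq',
      Finset.mem_univ, if_true]
    exact h
  | zero => simp
  | add y z _ _ hy hz =>
    simp [Matrix.mulVec_add, dotProduct_add, Finset.sum_add_distrib, hy, hz]
  | smul c z _ hz =>
    simp only [Pi.smul_apply, Matrix.mulVec_smul, dotProduct_smul, ← Finset.smul_sum, hz, smul_zero]

/-- In the bar-joint case skew matrices produce all 2×2 minors of the pair (x - y, w). In the
cofactor case, with s and t the first two coordinates of x - y, two explicit motions give t w₀ = s
w₁ and t w₁ = s w₂, which force w to be proportional to (s², st, t²). -/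
theorem exists_eq_smul_edgeDir {x y w : Fin 3 → ℝ} (hd : edgeDir κ x y ≠ 0)
    (h : ∀ M, IsTrivialMotion κ M → (x - y) ⬝ᵥ M.mulVec w = 0) :
    ∃ c : ℝ, w = c • edgeDir κ x y := by
  cases κ with
  | barJoint =>
    have hM : ∀ i j : Fin 3, (x - y) i * w j = (x - y) j * w i := by
      intro i j
      have h1 : ∀ u v : Fin 3 → ℝ,
          u ⬝ᵥ (Matrix.single i j (1 : ℝ) - Matrix.single j i 1).mulVec v =
            u i * v j - u j * v i := by
        intro u v
        rw [Matrix.sub_mulVec, dotProduct_sub]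
        simp [Matrix.single_mulVec, dotProduct, Function.update_apply]
      have := h (Matrix.single i j 1 - Matrix.single j i 1) (by
        intro u v
        rw [h1]
        simp only [edgeDir]
        ring)
      rw [h1] at this
      linarith
    obtain ⟨i, hi⟩ := Function.ne_iff.1 hd
    simp only [edgeDir, Pi.zero_apply] at hi
    refine ⟨w i / (x - y) i, ?_⟩
    funext j
    have := hM i j
    simp only [edgeDir, Pi.smul_apply, smul_eq_mul]
    field_simp
    linarith
  | cofactor =>
    have h1 := h !![0, -1, 0; 1, 0, 0; 0, 0, 0] (by
      intro u v
      simp [edgeDir, Matrix.mulVec, dotProduct, Fin.sum_univ_three]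
      ring)
    have h2 := h !![0, 0, -1; 0, 1, 0; 0, 0, 0] (by
      intro u v
      simp [edgeDir, Matrix.mulVec, dotProduct, Fin.sum_univ_three]
      ring)
    simp [Matrix.mulVec, dotProduct, Fin.sum_univ_three] at h1 h2
    by_cases hx : x 0 - y 0 = 0
    · have hy : x 1 - y 1 ≠ 0 := by
        intro hy
        apply hd
        funext i
        fin_cases i <;> simp [edgeDir, hx, hy]
      rw [hx] at h1 h2
      have hw0 : w 0 = 0 := by simpa [hy] using h1
      have hw1 : w 1 = 0 := by simpa [hy] using h2
      refine ⟨w 2 / (x 1 - y 1) ^ 2, ?_⟩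
      funext i
      fin_cases i <;> simp [edgeDir, hx, hw0, hw1, hy]
    · refine ⟨w 0 / (x 0 - y 0) ^ 2, ?_⟩
      have hw1 : w 1 = w 0 * (x 1 - y 1) / (x 0 - y 0) := by
        field_simp
        linarith
      have hw2 : w 2 = w 1 * (x 1 - y 1) / (x 0 - y 0) := by
        field_simp
        linarith
      funext i
      fin_cases i
      · simp [edgeDir, hx]
      · simp [edgeDir, hw1]
        field_simp
      · simp [edgeDir, hw2, hw1]
        field_simp

/-- A combination of rows that is supported on two joined vertices is a multiple of the row of the
edge that joins them. -/
theorem exists_eq_smul_rigidityRow {p z : V → Fin 3 → ℝ} {a b : V} (hab : a ≠ b)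
    (hd : edgeDir κ (p a) (p b) ≠ 0) (hz : z ∈ Submodule.span ℝ (Set.range (edgeRow κ p)))
    (hsupp : ∀ v, v ≠ a → v ≠ b → z v = 0) : ∃ c : ℝ, z = c • rigidityRow κ p a b := by
  have hsum : ∀ {M : Type _} [AddCommMonoid M] (f : V → M), (∀ v, v ≠ a → v ≠ b → f v = 0) →
      ∑ v, f v = f a + f b := by
    intro M _ f hf
    rw [← Finset.sum_pair hab]
    refine (Finset.sum_subset (Finset.subset_univ _) fun v _ hv => ?_).symm
    simp only [Finset.mem_insert, Finset.mem_singleton, not_or] at hv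
    exact hf v hv.1 hv.2
  have h1 := sum_eq_zero_of_mem_span_edgeRow hz
  rw [hsum z hsupp] at h1
  have hb : z b = -z a := (neg_eq_of_add_eq_zero_right h1).symm
  -- Force balance makes the values at `a` and `b` opposite; the moment conditions then align them
  -- with the edge direction.
  obtain ⟨c, hc⟩ := exists_eq_smul_edgeDir (κ := κ) (x := p a) (y := p b) (w := z a) hd (by
    intro M hM
    have h2 := sum_dotProduct_eq_zero_of_mem_span_edgeRow hM hz
    rw [hsum (fun v => p v ⬝ᵥ M.mulVec (z v)) (by
      intro v h h'
      simp [hsupp v h h']), hb, Matrix.mulVec_neg, dotProduct_neg] at h2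
    rw [sub_dotProduct]
    linarith)
  refine ⟨c, ?_⟩
  funext v
  rw [Pi.smul_apply, rigidityRow_apply]
  by_cases hva : v = a
  · subst hva
    simp [hab, hc]
  · by_cases hvb : v = b
    · subst hvb
      simp [hva, hb, hc]
    · simp [hva, hvb, hsupp v hva hvb]

end Pinning

/-! ### Independence after splitting the ends of an edge. -/

section SplitIndependence

open Filter Topology

variable {V Ω : Type*}

/-- The linear map that forgets the values at the vertices where `P` holds. -/
noncomputable def mask (P : Ω → Prop) [DecidablePred P] :
    (Ω → Fin 3 → ℝ) →ₗ[ℝ] (Ω → Fin 3 → ℝ) :=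
  LinearMap.pi fun x => if P x then 0 else LinearMap.proj x

theorem mask_apply (P : Ω → Prop) [DecidablePred P] (z : Ω → Fin 3 → ℝ) (x : Ω) :
    mask P z x = if P x then 0 else z x := by
  simp only [mask, LinearMap.pi_apply]
  split_ifs <;> rfl

variable [DecidableEq V] [DecidableEq Ω] [Fintype Ω]

theorem pushforward_edgeRow (κ : RigidityModel) (f : Ω → V) (p : V → Fin 3 → ℝ) (e : Sym2 Ω) :
    pushforward f (edgeRow κ (p ∘ f) e) = edgeRow κ p (Sym2.map f e) ∨
      pushforward f (edgeRow κ (p ∘ f) e) = -edgeRow κ p (Sym2.map f e) := by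
  have he : s(e.out.1, e.out.2) = e := Quot.out_eq _
  rw [edgeRow, pushforward_rigidityRow]
  have h := rigidityRow_eq_or κ p (f e.out.1) (f e.out.2)
  rwa [← Sym2.map_mk, he] at h

variable [Fintype V] {κ : RigidityModel}

theorem linearIndepOn_edgeRow_iff {p : V → Fin 3 → ℝ} {E : Set (Sym2 V)} :
    LinearIndepOn ℝ (edgeRow κ p) E ↔
      Module.finrank ℝ (Submodule.span ℝ (edgeRow κ p '' E)) = E.ncard := by
  classical
  refine ⟨fun h => finrank_span_image_of_linearIndepOn h E.toFinite, fun h => ?_⟩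
  rw [LinearIndepOn, linearIndependent_iff_card_eq_finrank_span, ← Set.toFinset_card,
    ← Set.ncard_eq_toFinset_card', ← h, Set.finrank, Set.image_eq_range]

theorem IndepEdges.of_linearIndepOn {p : V → Fin 3 → ℝ} {E : Set (Sym2 V)}
    (h : LinearIndepOn ℝ (edgeRow κ p) E) : IndepEdges κ E := by
  apply IndepEdges.of_ncard_le
  rw [← linearIndepOn_edgeRow_iff.1 h, ← frameworkRank_eq]
  exact frameworkRank_le_edgeRank κ p E

theorem IndepEdges.exists_linearIndepOn {E : Set (Sym2 V)} (h : IndepEdges κ E) :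
    ∃ p : V → Fin 3 → ℝ, LinearIndepOn ℝ (edgeRow κ p) E := by
  obtain ⟨p, hp⟩ := exists_generic_rank (V := V) κ
  exact ⟨p, linearIndepOn_edgeRow_iff.2 ((hp E).trans h)⟩

/-- Splitting the endpoints of an edge of an independent set: the rows of the other edges stay
independent even if their values at the split vertices are forgotten. -/
theorem linearIndependent_mask_edgeRow {π : Ω → V} {S : Set (Sym2 V)} {a b : V} (hab : a ≠ b)
    (hmem : s(a, b) ∈ S) {T : Set (Sym2 Ω)} (hinj : Set.InjOn (Sym2.map π) T)
    (hmaps : ∀ e ∈ T, Sym2.map π e ∈ S ∧ Sym2.map π e ≠ s(a, b))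
    [DecidablePred fun x => π x = a ∨ π x = b] {p : V → Fin 3 → ℝ}
    (hp : LinearIndepOn ℝ (edgeRow κ p) S) :
    LinearIndependent ℝ
      (fun e : T => mask (fun x => π x = a ∨ π x = b) (edgeRow κ (p ∘ π) e)) := by
  classical
  have hS : insert s(a, b) (S \ {s(a, b)}) = S := by
    rw [Set.insert_sdiff_singleton, Set.insert_eq_of_mem hmem]
  rw [← hS, linearIndepOn_insert (by simp)] at hp
  obtain ⟨hp1, hp2⟩ := hp
  let g : T → (S \ {s(a, b)} : Set (Sym2 V)) := fun e => ⟨Sym2.map π e, hmaps e e.2⟩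
  have hg : Function.Injective g := fun e f h => Subtype.ext (hinj e.2 f.2 (congrArg Subtype.val h))
  have hw : LinearIndependent ℝ (fun e : T => pushforward π (edgeRow κ (p ∘ π) e)) :=
    (LinearIndependent.comp hp1 g hg).of_eq_or_eq_neg fun e => pushforward_edgeRow κ π p e
  have hwmem : ∀ e : T, pushforward π (edgeRow κ (p ∘ π) e) ∈
      Submodule.span ℝ (edgeRow κ p '' (S \ {s(a, b)})) := by
    intro e
    have : edgeRow κ p (Sym2.map π e) ∈ Submodule.span ℝ (edgeRow κ p '' (S \ {s(a, b)})) :=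
      Submodule.subset_span ⟨_, hmaps e e.2, rfl⟩
    rcases pushforward_edgeRow κ π p e with h | h
    · rwa [h]
    · rw [h]
      exact neg_mem this
  -- A zero direction would make the row of `ab` zero, contradicting its independence of the other
  -- rows.
  have hd : edgeDir κ (p a) (p b) ≠ 0 := by
    intro h
    apply hp2
    have h0 : rigidityRow κ p a b = 0 := by
      simp [rigidityRow, h]
    rcases rigidityRow_eq_or κ p a b with h' | h' <;> rw [h0] at h'
    · rw [← h']
      exact zero_mem _
    · rw [neg_eq_zero.1 h'.symm]
      exact zero_mem _
  rw [Fintype.linearIndependent_iff] at hw ⊢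
  intro c hc
  apply hw
  have hz0 : mask (fun x => π x = a ∨ π x = b) (∑ e : T, c e • edgeRow κ (p ∘ π) e) = 0 := by
    rw [map_sum]
    simpa only [map_smul] using hc
  have hsum : ∑ e : T, c e • pushforward π (edgeRow κ (p ∘ π) e) =
      pushforward π (∑ e : T, c e • edgeRow κ (p ∘ π) e) := by
    rw [map_sum]
    simp only [map_smul]
  have hmem' : ∑ e : T, c e • pushforward π (edgeRow κ (p ∘ π) e) ∈
      Submodule.span ℝ (edgeRow κ p '' (S \ {s(a, b)})) :=
    sum_mem fun e _ => Submodule.smul_mem _ _ (hwmem e)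
  -- A dependence of the masked rows vanishes outside the fibres over `a` and `b`. Its pushforward
  -- is therefore supported on `a` and `b`, and is a multiple `t` of the row of `ab`; a nonzero `t`
  -- would put that row in the span of the others.
  obtain ⟨t, ht⟩ := exists_eq_smul_rigidityRow (κ := κ) (p := p) hab hd
    (Submodule.span_mono (Set.image_subset_range _ _) hmem') (by
      intro v hva hvb
      rw [hsum, pushforward_apply, Finset.sum_apply]
      refine Finset.sum_eq_zero fun x _ => ?_
      by_cases hx : π x = v
      · have h1 := congrFun hz0 x
        rw [mask_apply, if_neg (by rw [hx]; tauto)] at h1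
        rw [h1, Pi.zero_apply, Pi.single_zero, Pi.zero_apply]
      · exact Pi.single_eq_of_ne (Ne.symm hx) _)
  by_cases ht0 : t = 0
  · rw [ht, ht0, zero_smul]
  · exfalso
    apply hp2
    have h1 : rigidityRow κ p a b ∈ Submodule.span ℝ (edgeRow κ p '' (S \ {s(a, b)})) := by
      rw [ht] at hmem'
      exact (Submodule.smul_mem_iff _ ht0).1 hmem'
    rcases rigidityRow_eq_or κ p a b with h' | h' <;> rw [h'] at h1
    · exact h1
    · exact neg_mem_iff.1 h1

/-- If the endpoints of an edge `ab` of an independent set `S` are split, then the remaining edges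
can be combined with any independent set on the split vertices and further new vertices. -/
theorem IndepEdges.union_of_split {π : Ω → V} {S : Set (Sym2 V)} (hS : IndepEdges κ S) {a b : V}
    (hab : a ≠ b) (hmem : s(a, b) ∈ S) {T B : Set (Sym2 Ω)} (hinj : Set.InjOn (Sym2.map π) T)
    (hmaps : ∀ e ∈ T, Sym2.map π e ∈ S ∧ Sym2.map π e ≠ s(a, b)) (hB : IndepEdges κ B)
    (hBπ : ∀ e ∈ B, ∀ x ∈ e, π x = a ∨ π x = b) : IndepEdges κ (T ∪ B) := by
  classical
  obtain ⟨p₀, hp₀⟩ := hS.exists_linearIndepOn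
  obtain ⟨p₁, hp₁⟩ := hB.exists_linearIndepOn
  let m := mask (fun x => π x = a ∨ π x = b)
  have hev : ∀ᶠ p in residual (Ω → Fin 3 → ℝ), LinearIndependent ℝ
      (fun e : T => m (edgeRow κ p e)) := by
    -- The special framework `p₀ ∘ π` places all copies of a vertex at the same point; independence
    -- found there persists generically.
    refine eventually_residual_linearIndependent_pi
      (fun (p : Ω → Fin 3 → ℝ) (e : T) => m (edgeRow κ p e)) ?_ (p₀ ∘ π)
      (linearIndependent_mask_edgeRow hab hmem hinj hmaps hp₀)
    intro e x k
    simp only [m, mask_apply]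
    split_ifs
    · exact analyticOnNhd_const
    · exact analyticOnNhd_edgeRow κ e x k
  obtain ⟨p, ⟨hp1, hp2⟩, -⟩ := exists_generic κ
    (hev.and (eventually_linearIndepOn_edgeRow κ B p₁ hp₁))
  have hp1' : LinearIndependent ℝ (m ∘ fun e : T => edgeRow κ p e) := hp1
  refine IndepEdges.of_linearIndepOn (p := p) (LinearIndepOn.union (hp1'.of_comp _) hp2 ?_)
  have hdis := Submodule.range_ker_disjoint hp1'
  rw [← Set.image_eq_range] at hdis
  -- The rows of `B` live on the masked vertices, so they lie in the kernel of the mask, which meets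
  -- the span of the rows of `T` trivially.
  refine hdis.mono_right ?_
  rw [Submodule.span_le]
  rintro _ ⟨e, he, rfl⟩
  funext x
  rw [mask_apply]
  split_ifs with hx
  · rfl
  · exact edgeRow_apply_of_notMem κ p fun h => hx (hBπ e he x h)

end SplitIndependence

/-! ### Inclusion-exclusion counts as sums of cluster excesses. -/

section Counting

/-- The elements of `T` that are contained in `X`. -/
def pairsIn {V : Type*} (T : Finset (Sym2 V)) (X : Finset V) : Set (Sym2 V) :=
  {e | e ∈ T ∧ ∀ v ∈ e, v ∈ X}

theorem pairsIn_subset_inducedEdges {V : Type*} (G : SimpleGraph V) (T : Finset (Sym2 V))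
    (X : Finset V) : pairsIn T X ⊆ inducedEdges G T X :=
  fun _ he => ⟨Or.inr he.1, he.2⟩

theorem pairsIn_subset {V : Type*} (T : Finset (Sym2 V)) (X : Finset V) : pairsIn T X ⊆ T :=
  fun _ he => he.1

theorem sum_le_sum_sum_of_subset_biUnion {ι α : Type*} [DecidableEq α] (s : Finset ι)
    (t : ι → Finset α) (A : Finset α) (f : α → ℤ) (hA : A ⊆ s.biUnion t)
    (hf : ∀ i ∈ s, ∀ x ∈ t i, 0 ≤ f x) : ∑ x ∈ A, f x ≤ ∑ i ∈ s, ∑ x ∈ t i, f x := by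
  refine (Finset.sum_le_sum_of_subset_of_nonneg hA ?_).trans ?_
  · intro x hx _
    obtain ⟨i, hi, hxi⟩ := Finset.mem_biUnion.1 hx
    exact hf i hi x hxi
  · clear hA
    classical
    induction s using Finset.induction_on with
    | empty => simp
    | insert i s hi ih =>
      rw [Finset.sum_insert hi, Finset.biUnion_insert]
      have h1 := Finset.sum_union_inter (s₁ := t i) (s₂ := s.biUnion t) (f := f)
      have h2 : 0 ≤ ∑ x ∈ t i ∩ s.biUnion t, f x := Finset.sum_nonneg fun x hx =>
        hf i (Finset.mem_insert_self _ _) x (Finset.mem_inter.1 hx).1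
      have h3 := ih fun j hj => hf j (Finset.mem_insert_of_mem hj)
      linarith

variable {V : Type*} [DecidableEq V] [Fintype V] {κ : RigidityModel}

theorem sum_ncard_pairsIn (𝒳 : Finset (Finset V)) (T : Finset (Sym2 V)) :
    ∑ X ∈ 𝒳, (pairsIn T X).ncard = ∑ e ∈ T, coverDegree 𝒳 e := by
  simp only [coverDegree, Finset.card_filter]
  rw [Finset.sum_comm]
  refine Finset.sum_congr rfl fun X _ => ?_
  rw [← Finset.card_filter, ← Set.ncard_coe_finset]
  congr 1
  ext e
  simp [pairsIn]

/-- Counting incidences between pairs and clusters turns the correction term into a sum over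
clusters. This is the shape in which `edgeRank_union_iUnion_le` delivers its bound. -/
theorem countWith_eq (G : SimpleGraph V) (𝒳 : Finset (Finset V)) (T : Finset (Sym2 V)) :
    countWith κ G 𝒳 T = T.card +
      ∑ X ∈ 𝒳, ((edgeRank κ (inducedEdges G T X) : ℤ) - (pairsIn T X).ncard) := by
  have h := sum_ncard_pairsIn 𝒳 T
  rw [countWith, Finset.sum_sub_distrib, Finset.sum_sub_distrib]
  zify at h
  simp only [Finset.sum_const, nsmul_eq_mul, mul_one]
  linarith

theorem mem_sharedSet_of_subset {G : SimpleGraph V} {𝒳 : Finset (Finset V)}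
    (h𝒳 : IsTwoThinCover G 𝒳) {X Y : Finset V} (hX : X ∈ 𝒳) (hY : Y ∈ 𝒳) (hXY : X ≠ Y) {e : Sym2 V}
    (he : ¬ e.IsDiag) (heX : ∀ v ∈ e, v ∈ X) (heY : ∀ v ∈ e, v ∈ Y) : e ∈ sharedSet 𝒳 := by
  induction e using Sym2.ind with
  | _ u v =>
    have huv : u ≠ v := he
    simp only [Sym2.mem_iff, forall_eq_or_imp, forall_eq] at heX heY
    simp only [sharedSet, Finset.mem_filter, Finset.mem_univ, true_and]
    refine ⟨u, v, huv, rfl, X, hX, Y, hY, hXY, (Finset.eq_of_subset_of_card_le ?_ ?_).symm⟩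
    · intro w hw
      rw [Finset.mem_insert, Finset.mem_singleton] at hw
      rw [Finset.mem_inter]
      rcases hw with rfl | rfl
      · exact ⟨heX.1, heY.1⟩
      · exact ⟨heX.2, heY.2⟩
    · rw [Finset.card_pair huv]
      exact h𝒳.card_inter_le X hX Y hY hXY

theorem coverDegree_le_one {G : SimpleGraph V} {𝒳 : Finset (Finset V)}
    (h𝒳 : IsTwoThinCover G 𝒳) {e : Sym2 V} (he : ¬ e.IsDiag) (hS : e ∉ sharedSet 𝒳) :
    coverDegree 𝒳 e ≤ 1 := by
  classical
  rw [coverDegree, Finset.card_le_one]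
  intro X hX Y hY
  simp only [Finset.mem_filter] at hX hY
  by_contra hXY
  exact hS (mem_sharedSet_of_subset h𝒳 hX.1 hY.1 hXY he hX.2 hY.2)

/-- A further pair cannot lower any cluster rank, and its correction d - 1 is at most 0, whether it
lies in one cluster or in none. -/
theorem countWith_mono {G : SimpleGraph V} {𝒳 : Finset (Finset V)} {S T : Finset (Sym2 V)}
    (hST : S ⊆ T) (hd : ∀ e ∈ T, e ∉ S → coverDegree 𝒳 e ≤ 1) :
    countWith κ G 𝒳 S ≤ countWith κ G 𝒳 T := by
  have h1 : ∑ X ∈ 𝒳, (edgeRank κ (inducedEdges G S X) : ℤ) ≤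
      ∑ X ∈ 𝒳, (edgeRank κ (inducedEdges G T X) : ℤ) := by
    refine Finset.sum_le_sum fun X _ => ?_
    exact_mod_cast edgeRank_mono κ (show inducedEdges G S X ⊆ inducedEdges G T X from
      fun e he => ⟨he.1.imp_right fun h => hST h, he.2⟩)
  have h2 : ∑ e ∈ T \ S, ((coverDegree 𝒳 e : ℤ) - 1) ≤ 0 := by
    refine Finset.sum_nonpos fun e he => ?_
    rw [Finset.mem_sdiff] at he
    have := hd e he.1 he.2
    omega
  have h3 := Finset.sum_sdiff (f := fun e => (coverDegree 𝒳 e : ℤ) - 1) hST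
  rw [countWith, countWith]
  linarith

/-- Start from `T` and attach each cluster along the part of `T` inside it, which is independent. -/
theorem edgeRank_union_le_countWith {G : SimpleGraph V} {𝒳 : Finset (Finset V)}
    (h𝒳 : IsTwoThinCover G 𝒳) {T : Finset (Sym2 V)} (hT : IndepEdges κ (T : Set (Sym2 V))) :
    (edgeRank κ (G.edgeSet ∪ T) : ℤ) ≤ countWith κ G 𝒳 T := by
  have h1 := edgeRank_union_iUnion_le (κ := κ) 𝒳 (T : Set (Sym2 V)) (inducedEdges G T)
    (pairsIn T) (fun X _ => pairsIn_subset_inducedEdges G T X) (fun X _ => pairsIn_subset T X)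
    (fun X _ => hT.subset (pairsIn_subset T X))
  rw [hT, Set.ncard_coe_finset] at h1
  rw [countWith_eq]
  refine le_trans ?_ h1
  norm_cast
  apply edgeRank_mono
  rintro e (he | he)
  · induction e using Sym2.ind with
    | _ u v =>
      obtain ⟨X, hX, hu, hv⟩ := h𝒳.covers u v he
      right
      simp only [Set.mem_iUnion]
      refine ⟨X, hX, Or.inl he, ?_⟩
      simp [hu, hv]
  · exact Or.inl he

/-- Enlarging `T` to the full edge set does not lower the count, and then no cluster has positive
excess. Contrapositively, an independent ear, whose count exceeds its rank by one, has a nonedge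
among its ear pairs. -/
theorem countWith_le_ncard_of_subset {G : SimpleGraph V} {𝒳 : Finset (Finset V)}
    (h𝒳 : IsTwoThinCover G 𝒳) {T : Finset (Sym2 V)} (hS : sharedSet 𝒳 ⊆ T)
    (hT : (T : Set (Sym2 V)) ⊆ G.edgeSet) : countWith κ G 𝒳 T ≤ G.edgeSet.ncard := by
  classical
  let F : Finset (Sym2 V) := G.edgeSet.toFinite.toFinset
  have hF : (F : Set (Sym2 V)) = G.edgeSet := by simp [F]
  have hmono : countWith κ G 𝒳 T ≤ countWith κ G 𝒳 F := by
    refine countWith_mono (fun e he => ?_) fun e he heT => ?_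
    · exact Finset.mem_coe.1 (hF ▸ hT he)
    · rw [← Finset.mem_coe, hF] at he
      exact coverDegree_le_one h𝒳 (G.not_isDiag_of_mem_edgeSet he) fun h => heT (hS h)
  refine hmono.trans ?_
  rw [countWith_eq, ← hF, Set.ncard_coe_finset]
  suffices h : ∑ X ∈ 𝒳, ((edgeRank κ (inducedEdges G F X) : ℤ) - (pairsIn F X).ncard) ≤ 0 by
    linarith
  refine Finset.sum_nonpos fun X _ => ?_
  have h : inducedEdges G F X = pairsIn F X := by
    ext e
    have : e ∈ F ↔ e ∈ G.edgeSet := by rw [← hF, Finset.mem_coe]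
    simp [inducedEdges, pairsIn, this]
  rw [h]
  have := edgeRank_le_ncard κ (pairsIn F X)
  omega

/-- Two successive zero-extensions. -/
theorem edgeRank_union_two_stars {x y : V} {E Q : Set (Sym2 V)} (hE : ∀ e ∈ E, x ∉ e ∧ y ∉ e)
    (hQ : ∀ e ∈ Q, (x ∈ e ∨ y ∈ e) ∧ ¬ e.IsDiag) (hx : {e ∈ Q | y ∉ e}.ncard ≤ 3)
    (hy : {e ∈ Q | y ∈ e}.ncard ≤ 3) : edgeRank κ (E ∪ Q) = edgeRank κ E + Q.ncard := by
  have hU : {e ∈ Q | y ∉ e} ∪ {e ∈ Q | y ∈ e} = Q := by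
    ext e
    simp only [Set.mem_union, Set.mem_ofPred_eq]
    tauto
  have hdis : Disjoint {e ∈ Q | y ∉ e} {e ∈ Q | y ∈ e} :=
    Set.disjoint_left.2 fun e h h' => h.2 h'.2
  have h1 := edgeRank_union_star (κ := κ) (x := x) (E := E) (D := {e ∈ Q | y ∉ e})
    (fun e he => (hE e he).1)
    (fun e he => ⟨(hQ e he.1).1.resolve_right he.2, (hQ e he.1).2⟩) hx
  -- The vertex `y` is added second, so a pair `xy` is charged to the star of `y`.
  have h2 := edgeRank_union_star (κ := κ) (x := y) (E := E ∪ {e ∈ Q | y ∉ e})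
    (D := {e ∈ Q | y ∈ e})
    (by
      rintro e (he | he)
      · exact (hE e he).2
      · exact he.2)
    (fun e he => ⟨he.2, (hQ e he.1).2⟩) hy
  rw [Set.union_assoc, hU] at h2
  rw [h2, h1, add_assoc, ← Set.ncard_union_eq hdis (Set.toFinite _) (Set.toFinite _), hU]

end Counting

/-! ### The split graph and the projection onto the base graph. -/

section SplitGraph

variable {V : Type*} {a b : V}

/-- The projection of the split vertices that identifies the copies of `a` and of `b`. -/
def splitProj : SplitVertex a b → V
  | Sum.inl v => v.1
  | Sum.inr (Sum.inl _) => a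
  | Sum.inr (Sum.inr _) => b

variable {G : SimpleGraph V} {σ τ : V → Fin 2}

theorem splitGraph_adj_inl_inl (u v : {v : V // v ≠ a ∧ v ≠ b}) :
    (splitGraph G a b σ τ).Adj (Sum.inl u) (Sum.inl v) ↔ G.Adj u.1 v.1 := by
  simp only [splitGraph, SimpleGraph.fromRel_adj, ne_eq, Sum.inl.injEq]
  constructor
  · rintro ⟨-, h | h⟩
    · exact h
    · exact h.symm
  · intro h
    exact ⟨fun h' => h.ne (congrArg Subtype.val h'), Or.inl h⟩

theorem splitGraph_adj_copyA (k : Fin 2) (v : {v : V // v ≠ a ∧ v ≠ b}) :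
    (splitGraph G a b σ τ).Adj (copyA a b k) (Sum.inl v) ↔ G.Adj a v.1 ∧ σ v.1 = k := by
  simp [splitGraph, SimpleGraph.fromRel_adj]

theorem splitGraph_adj_copyB (k : Fin 2) (v : {v : V // v ≠ a ∧ v ≠ b}) :
    (splitGraph G a b σ τ).Adj (copyB a b k) (Sum.inl v) ↔ G.Adj b v.1 ∧ τ v.1 = k := by
  simp [splitGraph, SimpleGraph.fromRel_adj]

theorem not_splitGraph_adj_inr_inr (x y : Fin 2 ⊕ Fin 2) :
    ¬ (splitGraph G a b σ τ).Adj (Sum.inr x) (Sum.inr y) := by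
  rcases x with x | x <;> rcases y with y | y <;> simp [splitGraph, SimpleGraph.fromRel_adj]

/-- A case analysis for the edges of the split graph. -/
theorem splitGraph_adj_cases {P : SplitVertex a b → SplitVertex a b → Prop}
    (hsymm : ∀ x y, P x y → P y x)
    (h₁ : ∀ u v : {v : V // v ≠ a ∧ v ≠ b}, G.Adj u.1 v.1 → P (Sum.inl u) (Sum.inl v))
    (h₂ : ∀ v : {v : V // v ≠ a ∧ v ≠ b}, G.Adj a v.1 → P (copyA a b (σ v.1)) (Sum.inl v))
    (h₃ : ∀ v : {v : V // v ≠ a ∧ v ≠ b}, G.Adj b v.1 → P (copyB a b (τ v.1)) (Sum.inl v))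
    {x y : SplitVertex a b} (h : (splitGraph G a b σ τ).Adj x y) : P x y := by
  have key : ∀ (x : Fin 2 ⊕ Fin 2) (v : {v : V // v ≠ a ∧ v ≠ b}),
      (splitGraph G a b σ τ).Adj (Sum.inr x) (Sum.inl v) → P (Sum.inr x) (Sum.inl v) := by
    rintro (k | k) v h
    · obtain ⟨h', rfl⟩ := (splitGraph_adj_copyA k v).1 h
      exact h₂ v h'
    · obtain ⟨h', rfl⟩ := (splitGraph_adj_copyB k v).1 h
      exact h₃ v h'
  rcases x with u | x <;> rcases y with v | y
  · exact h₁ u v ((splitGraph_adj_inl_inl u v).1 h)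
  · exact hsymm _ _ (key y u h.symm)
  · exact key x v h
  · exact absurd h (not_splitGraph_adj_inr_inr x y)

theorem splitGraph_adj_proj {x y : SplitVertex a b} (h : (splitGraph G a b σ τ).Adj x y) :
    G.Adj (splitProj x) (splitProj y) :=
  splitGraph_adj_cases (P := fun x y => G.Adj (splitProj x) (splitProj y))
    (fun _ _ h => h.symm) (fun _ _ h => h) (fun _ h => h) (fun _ h => h) h

theorem map_splitProj_mem_edgeSet {f : Sym2 (SplitVertex a b)}
    (hf : f ∈ (splitGraph G a b σ τ).edgeSet) : Sym2.map splitProj f ∈ G.edgeSet := by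
  induction f using Sym2.ind with
  | _ x y => exact splitGraph_adj_proj hf

theorem exists_splitGraph_edge (hab : ¬ G.Adj a b) {e : Sym2 V} (he : e ∈ G.edgeSet) :
    ∃ f ∈ (splitGraph G a b σ τ).edgeSet, Sym2.map splitProj f = e := by
  classical
  have key : ∀ u v, G.Adj u v → v ≠ a → v ≠ b →
      ∃ f ∈ (splitGraph G a b σ τ).edgeSet, Sym2.map splitProj f = s(u, v) := by
    intro u v h hva hvb
    by_cases hua : u = a
    · subst hua
      exact ⟨s(copyA u b (σ v), Sum.inl ⟨v, hva, hvb⟩),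
        (splitGraph_adj_copyA (σ := σ) (τ := τ) _ _).2 ⟨h, rfl⟩, rfl⟩
    by_cases hub : u = b
    · subst hub
      exact ⟨s(copyB a u (τ v), Sum.inl ⟨v, hva, hvb⟩),
        (splitGraph_adj_copyB (σ := σ) (τ := τ) _ _).2 ⟨h, rfl⟩, rfl⟩
    exact ⟨s(Sum.inl ⟨u, hua, hub⟩, Sum.inl ⟨v, hva, hvb⟩),
      (splitGraph_adj_inl_inl (σ := σ) (τ := τ) _ _).2 h, rfl⟩
  induction e using Sym2.ind with
  | _ u v =>
    have h : G.Adj u v := he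
    by_cases hv : v ≠ a ∧ v ≠ b
    · exact key u v h hv.1 hv.2
    · rw [Sym2.eq_swap]
      refine key v u h.symm ?_ ?_ <;> rintro rfl <;>
        rw [not_and_or, not_not, not_not] at hv <;> rcases hv with rfl | rfl
      · exact h.ne rfl
      · exact hab h
      · exact hab h.symm
      · exact h.ne rfl

/-- Every edge of the split graph has an old end, and this end determines through `σ` or `τ` which
copy the other end is. -/
theorem splitGraph_edge_injOn (hab : a ≠ b) :
    Set.InjOn (Sym2.map splitProj) (splitGraph G a b σ τ).edgeSet := by
  have key : ∀ {x y x' y' : SplitVertex a b}, (splitGraph G a b σ τ).Adj x y →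
      (splitGraph G a b σ τ).Adj x' y' → splitProj x = splitProj x' →
      splitProj y = splitProj y' → x = x' := by
    intro x y x' y' h h' hx hy
    rcases x with u | k | k <;> rcases x' with u' | k' | k'
    · exact congrArg Sum.inl (Subtype.ext hx)
    · exact absurd hx u.2.1
    · exact absurd hx u.2.2
    · exact absurd hx.symm u'.2.1
    · rcases y with v | y
      · rcases y' with v' | y'
        · have hv : v = v' := Subtype.ext hy
          obtain ⟨-, h1⟩ := (splitGraph_adj_copyA k v).1 h
          obtain ⟨-, h2⟩ := (splitGraph_adj_copyA k' v').1 h'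
          rw [← h1, ← h2, hv]
        · exact absurd h' (not_splitGraph_adj_inr_inr _ _)
      · exact absurd h (not_splitGraph_adj_inr_inr _ _)
    · exact absurd hx hab
    · exact absurd hx.symm u'.2.2
    · exact absurd hx.symm hab
    · rcases y with v | y
      · rcases y' with v' | y'
        · have hv : v = v' := Subtype.ext hy
          obtain ⟨-, h1⟩ := (splitGraph_adj_copyB k v).1 h
          obtain ⟨-, h2⟩ := (splitGraph_adj_copyB k' v').1 h'
          rw [← h1, ← h2, hv]
        · exact absurd h' (not_splitGraph_adj_inr_inr _ _)
      · exact absurd h (not_splitGraph_adj_inr_inr _ _)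
  intro f hf f' hf' heq
  induction f using Sym2.ind with
  | _ x y =>
    induction f' using Sym2.ind with
    | _ x' y' =>
      have h : (splitGraph G a b σ τ).Adj x y := hf
      have h' : (splitGraph G a b σ τ).Adj x' y' := hf'
      rw [Sym2.map_mk, Sym2.map_mk] at heq
      rcases Sym2.eq_iff.1 heq with ⟨h1, h2⟩ | ⟨h1, h2⟩
      · rw [key h h' h1 h2, key h.symm h'.symm h2 h1]
      · rw [key h h'.symm h1 h2, key h.symm h' h2 h1, Sym2.eq_swap]

theorem exists_inl_mem_of_mem_edgeSet {f : Sym2 (SplitVertex a b)}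
    (hf : f ∈ (splitGraph G a b σ τ).edgeSet) :
    ∃ v : {v : V // v ≠ a ∧ v ≠ b}, Sum.inl v ∈ f := by
  induction f using Sym2.ind with
  | _ x y =>
    rcases x with u | x
    · exact ⟨u, Sym2.mem_mk_left _ _⟩
    rcases y with v | y
    · exact ⟨v, Sym2.mem_mk_right _ _⟩
    exact absurd hf (not_splitGraph_adj_inr_inr _ _)

/-- Without twins a set contains at most one copy of `a` and one of `b`, so the projection is
injective on it. -/
theorem eq_of_splitProj_eq [DecidableEq V] (hab : a ≠ b)
    {Z : Finset (SplitVertex a b)} (hZ : NoTwins Z) {x y : SplitVertex a b} (hx : x ∈ Z)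
    (hy : y ∈ Z) (h : splitProj x = splitProj y) : x = y := by
  have hA : ∀ k l : Fin 2, copyA a b k ∈ Z → copyA a b l ∈ Z → k = l := by
    intro k l hk hl
    by_contra hkl
    apply hZ.1
    intro z hz
    rw [Finset.mem_insert, Finset.mem_singleton] at hz
    fin_cases k <;> fin_cases l <;> rcases hz with rfl | rfl <;> first | assumption | simp at hkl
  have hB : ∀ k l : Fin 2, copyB a b k ∈ Z → copyB a b l ∈ Z → k = l := by
    intro k l hk hl
    by_contra hkl
    apply hZ.2
    intro z hz
    rw [Finset.mem_insert, Finset.mem_singleton] at hz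
    fin_cases k <;> fin_cases l <;> rcases hz with rfl | rfl <;> first | assumption | simp at hkl
  rcases x with u | k | k <;> rcases y with v | l | l
  · exact congrArg Sum.inl (Subtype.ext h)
  · exact absurd h u.2.1
  · exact absurd h u.2.2
  · exact absurd h.symm v.2.1
  · rw [hA k l hx hy]
  · exact absurd h hab
  · exact absurd h.symm v.2.2
  · exact absurd h.symm hab
  · rw [hB k l hx hy]

section Cluster

variable [DecidableEq V] [Fintype V] {X : Finset V}

theorem inl_mem_splitCluster {v : {v : V // v ≠ a ∧ v ≠ b}} :
    Sum.inl v ∈ splitCluster G a b σ τ X ↔ v.1 ∈ X := by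
  simp [splitCluster]

theorem copyA_mem_splitCluster {k : Fin 2} : copyA a b k ∈ splitCluster G a b σ τ X ↔
    a ∈ X ∧ ∃ v : {v : V // v ≠ a ∧ v ≠ b}, v.1 ∈ X ∧
      (splitGraph G a b σ τ).Adj (copyA a b k) (Sum.inl v) := by
  simp only [splitCluster, Finset.mem_filter, Finset.mem_univ, true_and]

theorem copyB_mem_splitCluster {k : Fin 2} : copyB a b k ∈ splitCluster G a b σ τ X ↔
    b ∈ X ∧ ∃ v : {v : V // v ≠ a ∧ v ≠ b}, v.1 ∈ X ∧
      (splitGraph G a b σ τ).Adj (copyB a b k) (Sum.inl v) := by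
  simp only [splitCluster, Finset.mem_filter, Finset.mem_univ, true_and]

theorem splitProj_mem_of_mem_splitCluster {x : SplitVertex a b}
    (hx : x ∈ splitCluster G a b σ τ X) : splitProj x ∈ X := by
  rcases x with v | k | k
  · exact inl_mem_splitCluster.1 hx
  · exact (copyA_mem_splitCluster.1 hx).1
  · exact (copyB_mem_splitCluster.1 hx).1

theorem mem_splitCluster_of_adj {x y : SplitVertex a b} (h : (splitGraph G a b σ τ).Adj x y)
    (hx : splitProj x ∈ X) (hy : splitProj y ∈ X) : x ∈ splitCluster G a b σ τ X := by
  rcases x with v | k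
  · exact inl_mem_splitCluster.2 hx
  rcases y with v | l
  · rcases k with k | k
    · exact copyA_mem_splitCluster.2 ⟨hx, v, hy, h⟩
    · exact copyB_mem_splitCluster.2 ⟨hx, v, hy, h⟩
  · exact absurd h (not_splitGraph_adj_inr_inr _ _)

theorem mem_splitCluster_of_mem_edge {f : Sym2 (SplitVertex a b)}
    (hf : f ∈ (splitGraph G a b σ τ).edgeSet) (hX : ∀ v ∈ Sym2.map splitProj f, v ∈ X) :
    ∀ x ∈ f, x ∈ splitCluster G a b σ τ X := by
  induction f using Sym2.ind with
  | _ x y =>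
    have h : (splitGraph G a b σ τ).Adj x y := hf
    simp only [Sym2.map_mk, Sym2.mem_iff, forall_eq_or_imp, forall_eq] at hX ⊢
    exact ⟨mem_splitCluster_of_adj h hX.1 hX.2, mem_splitCluster_of_adj h.symm hX.2 hX.1⟩

theorem exists_inl_mem_of_inr_mem {k : Fin 2 ⊕ Fin 2}
    (h : Sum.inr k ∈ splitCluster G a b σ τ X) :
    ∃ v : {v : V // v ≠ a ∧ v ≠ b}, Sum.inl v ∈ splitCluster G a b σ τ X ∧
      (splitGraph G a b σ τ).Adj (Sum.inr k) (Sum.inl v) := by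
  rcases k with k | k
  · obtain ⟨-, v, hv, hadj⟩ := copyA_mem_splitCluster.1 h
    exact ⟨v, inl_mem_splitCluster.2 hv, hadj⟩
  · obtain ⟨-, v, hv, hadj⟩ := copyB_mem_splitCluster.1 h
    exact ⟨v, inl_mem_splitCluster.2 hv, hadj⟩

end Cluster

end SplitGraph

theorem inter_eq_pair {V : Type*} [DecidableEq V] {G : SimpleGraph V} {𝒳 : Finset (Finset V)}
    {X Y : Finset V} (h𝒳 : IsTwoThinCover G 𝒳) (hX : X ∈ 𝒳) (hY : Y ∈ 𝒳) (hXY : X ≠ Y) {u v : V}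
    (huv : u ≠ v) (hu : u ∈ X ∩ Y) (hv : v ∈ X ∩ Y) : X ∩ Y = {u, v} := by
  refine (Finset.eq_of_subset_of_card_le ?_ ?_).symm
  · intro w hw
    rw [Finset.mem_insert, Finset.mem_singleton] at hw
    rcases hw with rfl | rfl <;> assumption
  · rw [Finset.card_pair huv]
    exact h𝒳.card_inter_le X hX Y hY hXY

/-! ### Lifting clusters and shared pairs, with phantoms for missing copies. -/

section Phantom

variable {V : Type*} {a b : V}

/-- The split vertices, together with a further copy of `a` and a further copy of `b` that are used
for the clusters in which these vertices have no neighbours. -/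
abbrev PhantomVertex (a b : V) : Type _ := SplitVertex a b ⊕ Fin 2

/-- The projection of the split and phantom vertices. -/
def phantomProj : PhantomVertex a b → V
  | Sum.inl x => splitProj x
  | Sum.inr k => if k = 0 then a else b

theorem map_phantomProj_inl (f : Sym2 (SplitVertex a b)) :
    Sym2.map phantomProj (Sym2.map Sum.inl f : Sym2 (PhantomVertex a b)) =
      Sym2.map splitProj f := by
  rw [Sym2.map_map]
  rfl

variable [DecidableEq V] [Fintype V]

open Classical in
/-- The embedding of the vertices that sends every vertex to its copy in the cluster `X'`. -/
noncomputable def clusterLift (G : SimpleGraph V) (a b : V) (σ τ : V → Fin 2) (X : Finset V)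
    (v : V) : PhantomVertex a b :=
  if h : ∃ x ∈ splitCluster G a b σ τ X, splitProj x = v then Sum.inl h.choose
  else if h : v ≠ a ∧ v ≠ b then Sum.inl (Sum.inl ⟨v, h⟩)
  else if v = a then Sum.inr 0 else Sum.inr 1

variable {G : SimpleGraph V} {σ τ : V → Fin 2} {X Y : Finset V}

theorem phantomProj_clusterLift (v : V) : phantomProj (clusterLift G a b σ τ X v) = v := by
  rw [clusterLift]
  split_ifs with h1 h2 h3
  · exact h1.choose_spec.2
  · rfl
  · simp [phantomProj, h3]
  · have : v = b := by
      by_contra h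
      exact h2 ⟨h3, h⟩
    simp [phantomProj, this]

theorem clusterLift_injective : Function.Injective (clusterLift G a b σ τ X) :=
  Function.LeftInverse.injective phantomProj_clusterLift

theorem map_phantomProj_clusterLift (e : Sym2 V) :
    Sym2.map phantomProj (Sym2.map (clusterLift G a b σ τ X) e) = e := by
  rw [Sym2.map_map, show phantomProj ∘ clusterLift G a b σ τ X = id from
    funext phantomProj_clusterLift, Sym2.map_id, id]

theorem clusterLift_splitProj (hab : a ≠ b) (hX : NoTwins (splitCluster G a b σ τ X))
    {x : SplitVertex a b} (hx : x ∈ splitCluster G a b σ τ X) :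
    clusterLift G a b σ τ X (splitProj x) = Sum.inl x := by
  have h : ∃ y ∈ splitCluster G a b σ τ X, splitProj y = splitProj x := ⟨x, hx, rfl⟩
  rw [clusterLift, dif_pos h]
  exact congrArg Sum.inl (eq_of_splitProj_eq hab hX h.choose_spec.1 hx h.choose_spec.2)

theorem clusterLift_of_ne {v : V} (h : v ≠ a ∧ v ≠ b) :
    clusterLift G a b σ τ X v = Sum.inl (Sum.inl ⟨v, h⟩) := by
  rw [clusterLift]
  split_ifs with h1
  · obtain ⟨-, h2⟩ := h1.choose_spec
    congr 1
    revert h2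
    generalize h1.choose = x
    rcases x with u | k | k
    · rintro rfl
      rfl
    · intro h2
      exact absurd h2.symm h.1
    · intro h2
      exact absurd h2.symm h.2
  · rfl

/-- The copy of a vertex of `X` lies in `X'`, or it is a phantom. -/
theorem clusterLift_cases {v : V} (hv : v ∈ X) :
    (∃ x ∈ splitCluster G a b σ τ X, splitProj x = v ∧
      clusterLift G a b σ τ X v = Sum.inl x) ∨
    ((∀ x ∈ splitCluster G a b σ τ X, splitProj x ≠ v) ∧
      ((v = a ∧ clusterLift G a b σ τ X v = Sum.inr 0) ∨
        (v = b ∧ clusterLift G a b σ τ X v = Sum.inr 1))) := by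
  rw [clusterLift]
  split_ifs with h1 h2 h3
  · exact Or.inl ⟨h1.choose, h1.choose_spec.1, h1.choose_spec.2, rfl⟩
  · exact absurd ⟨Sum.inl ⟨v, h2⟩, inl_mem_splitCluster.2 hv, rfl⟩ h1
  · push Not at h1
    exact Or.inr ⟨h1, Or.inl ⟨h3, rfl⟩⟩
  · push Not at h1
    refine Or.inr ⟨h1, Or.inr ⟨?_, rfl⟩⟩
    by_contra h
    exact h2 ⟨h3, h⟩

theorem map_clusterLift_of_mem_edgeSet (hab : a ≠ b) (hX : NoTwins (splitCluster G a b σ τ X))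
    {f : Sym2 (SplitVertex a b)} (hf : ∀ x ∈ f, x ∈ splitCluster G a b σ τ X) :
    Sym2.map (clusterLift G a b σ τ X) (Sym2.map splitProj f) = Sym2.map Sum.inl f := by
  induction f using Sym2.ind with
  | _ x y =>
    simp only [Sym2.mem_iff, forall_eq_or_imp, forall_eq] at hf
    rw [Sym2.map_mk, Sym2.map_mk, Sym2.map_mk, clusterLift_splitProj hab hX hf.1,
      clusterLift_splitProj hab hX hf.2]

/-- The pairs of the shared set, other than `ab`, viewed in the split graph. -/
def liftedPairs (G : SimpleGraph V) (𝒳 : Finset (Finset V)) (a b : V) (σ τ : V → Fin 2) :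
    Set (Sym2 (PhantomVertex a b)) :=
  {e | (∃ X ∈ 𝒳, NoTwins (splitCluster G a b σ τ X) ∧ ∃ f ∈ sharedSet 𝒳, f ≠ s(a, b) ∧
      (∀ v ∈ f, v ∈ X) ∧ e = Sym2.map (clusterLift G a b σ τ X) f) ∨
    ∃ f ∈ (splitGraph G a b σ τ).edgeSet, Sym2.map splitProj f ∈ sharedSet 𝒳 ∧
      e = Sym2.map Sum.inl f}

variable {𝒳 : Finset (Finset V)}

theorem map_phantomProj_mem_of_mem_liftedPairs (hab : ¬ G.Adj a b)
    {e : Sym2 (PhantomVertex a b)} (he : e ∈ liftedPairs G 𝒳 a b σ τ) :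
    Sym2.map phantomProj e ∈ sharedSet 𝒳 ∧ Sym2.map phantomProj e ≠ s(a, b) := by
  rcases he with ⟨X, hX, -, f, hf, hne, -, rfl⟩ | ⟨f, hf, hS, rfl⟩
  · rw [map_phantomProj_clusterLift]
    exact ⟨hf, hne⟩
  · rw [map_phantomProj_inl]
    refine ⟨hS, fun h => hab ?_⟩
    have := map_splitProj_mem_edgeSet hf
    rwa [h] at this

theorem not_isDiag_of_mem_sharedSet {e : Sym2 V} (he : e ∈ sharedSet 𝒳) : ¬ e.IsDiag := by
  simp only [sharedSet, Finset.mem_filter, Finset.mem_univ, true_and] at he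
  obtain ⟨u, v, huv, rfl, -⟩ := he
  exact huv

/-- A shared nonedge other than `ab` meets {a, b} in at most one vertex. For that vertex the second
safety condition makes both split clusters contain the same copies, and the first one excludes
twins; so both lifts use the same copy, or both use the phantom. -/
theorem map_clusterLift_eq (hab : a ≠ b) (h𝒳 : IsTwoThinCover G 𝒳)
    (hsafe : IsSafeSplit G 𝒳 a b σ τ) (hX : X ∈ 𝒳) (hY : Y ∈ 𝒳) {f : Sym2 V}
    (hf : f ∈ sharedSet 𝒳) (hne : f ≠ s(a, b)) (hfG : f ∉ G.edgeSet) (hfX : ∀ v ∈ f, v ∈ X)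
    (hfY : ∀ v ∈ f, v ∈ Y) :
    Sym2.map (clusterLift G a b σ τ X) f = Sym2.map (clusterLift G a b σ τ Y) f := by
  by_cases hXY : X = Y
  · rw [hXY]
  have hYt := hsafe.noTwins Y hY ⟨f, hf, hfG, hfY⟩
  have haux : ∀ c v : V, (c = a ∨ c = b) → f = s(c, v) →
      Sym2.map (clusterLift G a b σ τ X) f = Sym2.map (clusterLift G a b σ τ Y) f := by
    rintro c v hc rfl
    simp only [Sym2.mem_iff, forall_eq_or_imp, forall_eq] at hfX hfY
    have hcv : c ≠ v := not_isDiag_of_mem_sharedSet hf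
    have hv : v ≠ a ∧ v ≠ b := by
      constructor <;> rintro rfl <;> rcases hc with rfl | rfl
      · exact hcv rfl
      · exact hne Sym2.eq_swap
      · exact hne rfl
      · exact hcv rfl
    have hint := inter_eq_pair h𝒳 hX hY hXY hcv (Finset.mem_inter.2 ⟨hfX.1, hfY.1⟩)
      (Finset.mem_inter.2 ⟨hfX.2, hfY.2⟩)
    have hmem : ∀ x : SplitVertex a b, splitProj x = c →
        (x ∈ splitCluster G a b σ τ X ↔ x ∈ splitCluster G a b σ τ Y) := by
      intro x hx
      rcases hc with rfl | rfl
      · have h := hsafe.agree_a X hX Y hY hXY v hv.1 hv.2 hint hfG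
        have hx' : x ∈ ({copyA c b 0, copyA c b 1} : Finset (SplitVertex c b)) := by
          rcases x with u | k | k
          · exact absurd hx u.2.1
          · fin_cases k <;> simp
          · exact absurd hx.symm hab
        have := Finset.ext_iff.1 h x
        simpa [Finset.mem_inter, hx'] using this
      · have h := hsafe.agree_b X hX Y hY hXY v hv.1 hv.2 hint hfG
        have hx' : x ∈ ({copyB a c 0, copyB a c 1} : Finset (SplitVertex a c)) := by
          rcases x with u | k | k
          · exact absurd hx u.2.2
          · exact absurd hx hab
          · fin_cases k <;> simp
        have := Finset.ext_iff.1 h x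
        simpa [Finset.mem_inter, hx'] using this
    have hcc : clusterLift G a b σ τ X c = clusterLift G a b σ τ Y c := by
      rcases clusterLift_cases (G := G) (σ := σ) (τ := τ) hfX.1 with
        ⟨x, hx, hxc, hl⟩ | ⟨hno, hl⟩
      · rw [hl, ← clusterLift_splitProj hab hYt ((hmem x hxc).1 hx), hxc]
      · rcases clusterLift_cases (G := G) (σ := σ) (τ := τ) hfY.1 with
          ⟨y, hy, hyc, -⟩ | ⟨-, hl'⟩
        · exact absurd hyc (hno y ((hmem y hyc).2 hy))
        · rcases hl with ⟨h1, hl⟩ | ⟨h1, hl⟩ <;> rcases hl' with ⟨h2, hl'⟩ | ⟨h2, hl'⟩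
          · rw [hl, hl']
          · exact absurd (h1.symm.trans h2) hab
          · exact absurd (h2.symm.trans h1) hab
          · rw [hl, hl']
    rw [Sym2.map_mk, Sym2.map_mk, hcc, clusterLift_of_ne hv, clusterLift_of_ne hv]
  induction f using Sym2.ind with
  | _ u v =>
    by_cases hu : u ≠ a ∧ u ≠ b
    · by_cases hv : v ≠ a ∧ v ≠ b
      · rw [Sym2.map_mk, Sym2.map_mk, clusterLift_of_ne hu, clusterLift_of_ne hu,
          clusterLift_of_ne hv, clusterLift_of_ne hv]
      · exact haux v u (by tauto) Sym2.eq_swap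
    · exact haux u v (by tauto) rfl

/-- Over an edge of G the only lift is the corresponding edge of the split graph; over a nonedge
uniqueness is `map_clusterLift_eq`. This bounds the number of lifted pairs. -/
theorem liftedPairs_injOn (h𝒳 : IsTwoThinCover G 𝒳) (hsafe : IsSafeSplit G 𝒳 a b σ τ)
    (hab : a ≠ b) : Set.InjOn (Sym2.map phantomProj) (liftedPairs G 𝒳 a b σ τ) := by
  have hedge : ∀ e ∈ liftedPairs G 𝒳 a b σ τ, Sym2.map phantomProj e ∈ G.edgeSet →
      ∃ g ∈ (splitGraph G a b σ τ).edgeSet, e = Sym2.map Sum.inl g := by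
    rintro e (⟨X, hX, ht, f, hf, hne, hfX, rfl⟩ | ⟨f, hf, -, rfl⟩) he
    · rw [map_phantomProj_clusterLift] at he
      obtain ⟨g, hg, rfl⟩ := exists_splitGraph_edge (σ := σ) (τ := τ) hsafe.nonedge he
      exact ⟨g, hg, map_clusterLift_of_mem_edgeSet hab ht (mem_splitCluster_of_mem_edge hg hfX)⟩
    · exact ⟨f, hf, rfl⟩
  intro e he e' he' heq
  by_cases hG : Sym2.map phantomProj e ∈ G.edgeSet
  · obtain ⟨g, hg, rfl⟩ := hedge e he hG
    obtain ⟨g', hg', rfl⟩ := hedge e' he' (heq ▸ hG)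
    rw [map_phantomProj_inl, map_phantomProj_inl] at heq
    rw [splitGraph_edge_injOn hab hg hg' heq]
  · have hG' := heq ▸ hG
    rcases he with ⟨X, hX, ht, f, hf, hne, hfX, rfl⟩ | ⟨f, hf, -, rfl⟩
    · rcases he' with ⟨Y, hY, ht', f', hf', hne', hfY, rfl⟩ | ⟨f', hf', -, rfl⟩
      · rw [map_phantomProj_clusterLift] at heq hG
        rw [map_phantomProj_clusterLift] at heq
        subst heq
        exact map_clusterLift_eq hab h𝒳 hsafe hX hY hf hne hG hfX hfY
      · rw [map_phantomProj_inl] at hG'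
        exact absurd (map_splitProj_mem_edgeSet hf') hG'
    · rw [map_phantomProj_inl] at hG
      exact absurd (map_splitProj_mem_edgeSet hf) hG

end Phantom

/-! ### The safe split cover. -/

section SplitCover

theorem noTwins_pair {V : Type*} [DecidableEq V] {a b : V} {G : SimpleGraph V}
    {σ τ : V → Fin 2} {x y : SplitVertex a b} (h : (splitGraph G a b σ τ).Adj x y) :
    NoTwins ({x, y} : Finset (SplitVertex a b)) := by
  have key : ∀ k l : Fin 2 ⊕ Fin 2, k ≠ l →
      ¬ ({Sum.inr k, Sum.inr l} : Finset (SplitVertex a b)) ⊆ {x, y} := by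
    intro k l hkl hss
    have hk := hss (Finset.mem_insert_self _ _)
    have hl := hss (Finset.mem_insert_of_mem (Finset.mem_singleton_self _))
    rw [Finset.mem_insert, Finset.mem_singleton] at hk hl
    have hne : (Sum.inr k : SplitVertex a b) ≠ Sum.inr l := fun h => hkl (Sum.inr_injective h)
    rcases hk with hk | hk <;> rcases hl with hl | hl
    · exact hne (hk.trans hl.symm)
    · exact not_splitGraph_adj_inr_inr k l (hk ▸ hl ▸ h)
    · exact not_splitGraph_adj_inr_inr l k (hk ▸ hl ▸ h)
    · exact hne (hk.trans hl.symm)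
  exact ⟨key _ _ (by simp), key _ _ (by simp)⟩

theorem mem_newVertices {V : Type*} [DecidableEq V] {a b : V} {x : SplitVertex a b} :
    x ∈ newVertices a b ↔ splitProj x = a ∨ splitProj x = b := by
  rcases x with v | k | k
  · simp [newVertices, splitProj, v.2.1, v.2.2]
  · fin_cases k <;> simp [newVertices, splitProj]
  · fin_cases k <;> simp [newVertices, splitProj]

variable {V : Type*} [DecidableEq V] [Fintype V] {a b : V} {G : SimpleGraph V} {σ τ : V → Fin 2}
  {𝒳 : Finset (Finset V)} {X : Finset V} {κ : RigidityModel}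

/-- A split cluster that contains a copy of `a` and a copy of `b` has more than two vertices. -/
theorem two_lt_card_of_new (hab : a ≠ b) {x y : SplitVertex a b}
    (hx : x ∈ splitCluster G a b σ τ X) (hy : y ∈ splitCluster G a b σ τ X)
    (hxa : splitProj x = a) (hyb : splitProj y = b) : 2 < (splitCluster G a b σ τ X).card := by
  classical
  rcases x with v | k
  · exact absurd hxa v.2.1
  -- A copy belongs to a split cluster only because of an old neighbour there, which is the third
  -- vertex.
  obtain ⟨v, hv, -⟩ := exists_inl_mem_of_inr_mem hx
  rw [Finset.two_lt_card]
  refine ⟨_, hx, _, hy, _, hv, ?_, ?_, ?_⟩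
  · rintro rfl
    exact hab (hxa.symm.trans hyb)
  · simp
  · rintro rfl
    exact v.2.2 hyb

theorem mem_bigSplitClusters {Z : Finset (SplitVertex a b)} :
    Z ∈ bigSplitClusters G 𝒳 a b σ τ ↔
      ∃ X ∈ 𝒳, splitCluster G a b σ τ X = Z ∧ 2 < Z.card ∧ NoTwins Z := by
  classical
  simp only [bigSplitClusters, Finset.mem_filter, Finset.mem_image]
  constructor
  · rintro ⟨⟨X, hX, rfl⟩, h⟩
    exact ⟨X, hX, rfl, h⟩
  · rintro ⟨X, hX, rfl, h⟩
    exact ⟨⟨X, hX, rfl⟩, h⟩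

theorem mem_safeSplitCover {Z : Finset (SplitVertex a b)} :
    Z ∈ safeSplitCover G 𝒳 a b σ τ ↔ Z ∈ bigSplitClusters G 𝒳 a b σ τ ∨
      (∃ x y, (splitGraph G a b σ τ).Adj x y ∧ Z = {x, y}) ∧
        ∀ Y ∈ bigSplitClusters G 𝒳 a b σ τ, ¬ Z ⊆ Y := by
  simp only [safeSplitCover, Finset.mem_union, Finset.mem_filter, Finset.mem_univ, true_and]

theorem mem_pairsOf {K : Finset V} {u v : V} :
    s(u, v) ∈ pairsOf K ↔ u ≠ v ∧ u ∈ K ∧ v ∈ K := by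
  simp [pairsOf]

theorem mem_keyPairs {K : Finset V} {u v : V} :
    s(u, v) ∈ keyPairs 𝒳 K ↔ (u ≠ v ∧ u ∈ K ∧ v ∈ K) ∧ ∃ X ∈ 𝒳, u ∈ X ∧ v ∈ X := by
  simp [keyPairs, mem_pairsOf]

theorem noTwins_of_mem_safeSplitCover {Z : Finset (SplitVertex a b)}
    (hZ : Z ∈ safeSplitCover G 𝒳 a b σ τ) : NoTwins Z := by
  rcases mem_safeSplitCover.1 hZ with h | ⟨⟨x, y, h, rfl⟩, -⟩
  · obtain ⟨X, -, -, -, h⟩ := mem_bigSplitClusters.1 h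
    exact h
  · exact noTwins_pair h

theorem two_le_card_of_mem_safeSplitCover {Z : Finset (SplitVertex a b)}
    (hZ : Z ∈ safeSplitCover G 𝒳 a b σ τ) : 2 ≤ Z.card := by
  rcases mem_safeSplitCover.1 hZ with h | ⟨⟨x, y, h, rfl⟩, -⟩
  · obtain ⟨X, -, -, h, -⟩ := mem_bigSplitClusters.1 h
    exact h.le
  · rw [Finset.card_pair h.ne]

theorem exists_mem_safeSplitCover {x y : SplitVertex a b} (h : (splitGraph G a b σ τ).Adj x y) :
    ∃ Z ∈ safeSplitCover G 𝒳 a b σ τ, x ∈ Z ∧ y ∈ Z := by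
  by_cases hbig : ∃ Y ∈ bigSplitClusters G 𝒳 a b σ τ, ({x, y} : Finset (SplitVertex a b)) ⊆ Y
  · obtain ⟨Y, hY, hss⟩ := hbig
    exact ⟨Y, mem_safeSplitCover.2 (Or.inl hY), hss (by simp), hss (by simp)⟩
  · push Not at hbig
    exact ⟨{x, y}, mem_safeSplitCover.2 (Or.inr ⟨⟨x, y, h, rfl⟩, hbig⟩), by simp, by simp⟩

/-- Two vertices in the intersection of two clusters of the safe split cover come from a common
pair of two clusters of the original cover. -/
theorem exists_clusters_of_mem_inter {Z Z' : Finset (SplitVertex a b)}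
    (hZ : Z ∈ safeSplitCover G 𝒳 a b σ τ) (hZ' : Z' ∈ safeSplitCover G 𝒳 a b σ τ) (hne : Z ≠ Z')
    {x y : SplitVertex a b} (hxy : x ≠ y) (hx : x ∈ Z ∩ Z') (hy : y ∈ Z ∩ Z') :
    ∃ X ∈ 𝒳, ∃ Y ∈ 𝒳, X ≠ Y ∧ splitCluster G a b σ τ X = Z ∧ splitCluster G a b σ τ Y = Z' := by
  have hpair : ∀ {Z : Finset (SplitVertex a b)} {u v}, x ∈ Z → y ∈ Z → Z = {u, v} → Z = {x, y} := by
    rintro _ u v hx hy rfl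
    rw [Finset.mem_insert, Finset.mem_singleton] at hx hy
    rcases hx with rfl | rfl <;> rcases hy with rfl | rfl
    · exact absurd rfl hxy
    · rfl
    · exact Finset.pair_comm _ _
    · exact absurd rfl hxy
  have hsub : ({x, y} : Finset (SplitVertex a b)) ⊆ Z ∩ Z' := by
    intro z hz
    rw [Finset.mem_insert, Finset.mem_singleton] at hz
    rcases hz with rfl | rfl <;> assumption
  rw [Finset.mem_inter] at hx hy
  rcases mem_safeSplitCover.1 hZ with h | ⟨⟨u, v, -, h1⟩, h2⟩
  · rcases mem_safeSplitCover.1 hZ' with h' | ⟨⟨u, v, -, h1⟩, h2⟩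
    · obtain ⟨X, hX, rfl, -⟩ := mem_bigSplitClusters.1 h
      obtain ⟨Y, hY, rfl, -⟩ := mem_bigSplitClusters.1 h'
      exact ⟨X, hX, Y, hY, fun h => hne (h ▸ rfl), rfl, rfl⟩
    · refine absurd ?_ (h2 Z h)
      rw [hpair hx.2 hy.2 h1]
      exact hsub.trans Finset.inter_subset_left
  · rcases mem_safeSplitCover.1 hZ' with h' | ⟨⟨u', v', -, h1'⟩, -⟩
    · refine absurd ?_ (h2 Z' h')
      rw [hpair hx.1 hy.1 h1]
      exact hsub.trans Finset.inter_subset_right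
    · exact absurd ((hpair hx.1 hy.1 h1).trans (hpair hx.2 hy.2 h1').symm) hne

theorem card_inter_le_of_mem_safeSplitCover (hab : a ≠ b) (h𝒳 : IsTwoThinCover G 𝒳)
    {Z Z' : Finset (SplitVertex a b)}
    (hZ : Z ∈ safeSplitCover G 𝒳 a b σ τ) (hZ' : Z' ∈ safeSplitCover G 𝒳 a b σ τ) (hne : Z ≠ Z') :
    (Z ∩ Z').card ≤ 2 := by
  by_contra! hcard
  obtain ⟨x, hx, y, hy, hxy⟩ := Finset.one_lt_card.1 ((by norm_num : 1 < 2).trans hcard)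
  obtain ⟨X, hX, Y, hY, hXY, rfl, rfl⟩ := exists_clusters_of_mem_inter hZ hZ' hne hxy hx hy
  have h1 := h𝒳.card_inter_le X hX Y hY hXY
  have h2 := Finset.card_le_card_of_injOn (s := splitCluster G a b σ τ X ∩ splitCluster G a b σ τ Y)
    (t := X ∩ Y) splitProj (by
      intro x hx
      rw [Finset.mem_coe, Finset.mem_inter] at hx ⊢
      exact ⟨splitProj_mem_of_mem_splitCluster hx.1, splitProj_mem_of_mem_splitCluster hx.2⟩) (by
      intro x hx y hy h
      rw [Finset.mem_coe, Finset.mem_inter] at hx hy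
      exact eq_of_splitProj_eq hab (noTwins_of_mem_safeSplitCover hZ) hx.1 hy.1 h)
  omega

/-- A cluster whose split contains twins contains no nonedges of the shared set, so its rank is the
number of its edges. -/
theorem ncard_le_of_not_noTwins (hG : IndepEdges κ G.edgeSet) (hab : a ≠ b)
    (hsafe : IsSafeSplit G 𝒳 a b σ τ) (hX : X ∈ 𝒳) (ht : ¬ NoTwins (splitCluster G a b σ τ X)) :
    ({f | f ∈ (splitGraph G a b σ τ).edgeSet ∧ (∀ v ∈ Sym2.map splitProj f, v ∈ X) ∧
        Sym2.map splitProj f ∉ sharedSet 𝒳}.ncard : ℤ) ≤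
      (edgeRank κ (inducedEdges G (sharedSet 𝒳) X) : ℤ) - (pairsIn (sharedSet 𝒳) X).ncard := by
  -- This is the contrapositive of the first safety condition: a cluster with twins contains no
  -- shared nonedge.
  have h1 : inducedEdges G (sharedSet 𝒳) X ⊆ G.edgeSet := by
    rintro e ⟨he | he, heX⟩
    · exact he
    · by_contra h
      exact ht (hsafe.noTwins X hX ⟨e, he, h, heX⟩)
  have h2 : edgeRank κ (inducedEdges G (sharedSet 𝒳) X) =
      (inducedEdges G (sharedSet 𝒳) X).ncard := hG.subset h1
  have h3 := Set.ncard_sdiff_add_ncard_of_subset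
    (pairsIn_subset_inducedEdges G (sharedSet 𝒳) X) (Set.toFinite _)
  have h4 := Set.ncard_le_ncard_of_injOn (s := {f | f ∈ (splitGraph G a b σ τ).edgeSet ∧
      (∀ v ∈ Sym2.map splitProj f, v ∈ X) ∧ Sym2.map splitProj f ∉ sharedSet 𝒳})
    (t := inducedEdges G (sharedSet 𝒳) X \ pairsIn (sharedSet 𝒳) X) (Sym2.map splitProj) (by
      rintro f ⟨hf, hfX, hfS⟩
      exact ⟨⟨Or.inl (map_splitProj_mem_edgeSet hf), hfX⟩, fun h => hfS h.1⟩)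
    ((splitGraph_edge_injOn hab).mono fun f hf => hf.1) (Set.toFinite _)
  omega

/-- The projection is a proper pair different from `ab`, so one end lies outside {a, b}. This
separates lifted pairs from ear pairs, and from lifts of `ab` at a phantom. -/
theorem exists_eq_of_mem_liftedPairs (hab : ¬ G.Adj a b) {e : Sym2 (PhantomVertex a b)}
    (he : e ∈ liftedPairs G 𝒳 a b σ τ) :
    ∃ (z : PhantomVertex a b) (v : {v : V // v ≠ a ∧ v ≠ b}), e = s(z, Sum.inl (Sum.inl v)) := by
  obtain ⟨h1, h2⟩ := map_phantomProj_mem_of_mem_liftedPairs hab he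
  have hold : ∀ z : PhantomVertex a b, phantomProj z ≠ a ∧ phantomProj z ≠ b →
      ∃ v, z = Sum.inl (Sum.inl v) := by
    rintro ((v | k | k) | k) ⟨hza, hzb⟩
    · exact ⟨v, rfl⟩
    · exact absurd rfl hza
    · exact absurd rfl hzb
    · fin_cases k <;> simp [phantomProj] at hza hzb
  clear he
  induction e using Sym2.ind with
  | _ x y =>
    have hd : phantomProj x ≠ phantomProj y := not_isDiag_of_mem_sharedSet h1
    rw [Sym2.map_mk] at h2
    by_cases hx : phantomProj x ≠ a ∧ phantomProj x ≠ b
    · obtain ⟨v, rfl⟩ := hold x hx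
      exact ⟨y, v, Sym2.eq_swap⟩
    · by_cases hy : phantomProj y ≠ a ∧ phantomProj y ≠ b
      · obtain ⟨v, rfl⟩ := hold y hy
        exact ⟨x, v, rfl⟩
      · exfalso
        rw [not_and_or, not_not, not_not] at hx hy
        rcases hx with hx | hx <;> rcases hy with hy | hy
        · exact hd (hx.trans hy.symm)
        · exact h2 (by rw [hx, hy])
        · exact h2 (by rw [hx, hy, Sym2.eq_swap])
        · exact hd (hx.trans hy.symm)

end SplitCover

/-! ### Vertices and edges of the glued graph. -/

section Gluing

variable {U W : Type*} [DecidableEq W] {K : Finset U} {L : Finset W}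

theorem glueRight_eq_inl {φ : K ≃ L} {w : W} {u : U} (h : glueRight φ w = Sum.inl u) :
    ∃ hu : u ∈ K, (φ ⟨u, hu⟩).1 = w := by
  rw [glueRight] at h
  split_ifs at h with hw
  have h' := Sum.inl_injective h
  subst h'
  exact ⟨(φ.symm ⟨w, hw⟩).2, by simp⟩

theorem glueRight_apply (φ : K ≃ L) (k : K) : glueRight φ (φ k).1 = Sum.inl k.1 := by
  rw [glueRight, dif_pos (φ k).2]
  simp

theorem glueRight_injective (φ : K ≃ L) : Function.Injective (glueRight φ) := by
  intro w w' h
  by_cases hw : w ∈ L <;> by_cases hw' : w' ∈ L <;> simp only [glueRight, hw, hw', dif_pos,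
    dif_neg, not_false_eq_true, reduceCtorEq, Sum.inl.injEq, Sum.inr.injEq, Subtype.mk.injEq] at h
  · simpa using φ.symm.injective (Subtype.ext h)
  · exact h

theorem glueGraph_edgeSet (A : SimpleGraph U) (H : SimpleGraph W) (φ : K ≃ L) :
    (glueGraph A H φ).edgeSet =
      Sym2.map Sum.inl '' A.edgeSet ∪ Sym2.map (glueRight φ) '' H.edgeSet := by
  ext e
  induction e using Sym2.ind with
  | _ x y =>
    rw [SimpleGraph.mem_edgeSet, glueGraph, SimpleGraph.fromRel_adj]
    constructor
    · rintro ⟨-, (⟨u, v, h, rfl, rfl⟩ | ⟨u, v, h, rfl, rfl⟩) |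
        (⟨u, v, h, rfl, rfl⟩ | ⟨u, v, h, rfl, rfl⟩)⟩
      · exact Or.inl ⟨s(u, v), h, rfl⟩
      · exact Or.inr ⟨s(u, v), h, rfl⟩
      · exact Or.inl ⟨s(v, u), h.symm, rfl⟩
      · exact Or.inr ⟨s(v, u), h.symm, rfl⟩
    · rintro (⟨e, he, heq⟩ | ⟨e, he, heq⟩)
      · induction e using Sym2.ind with
        | _ u v =>
          have hadj : A.Adj u v := he
          have hne : (Sum.inl u : GlueVertex U L) ≠ Sum.inl v := fun h =>
            hadj.ne (Sum.inl_injective h)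
          rw [Sym2.map_mk] at heq
          rcases Sym2.eq_iff.1 heq with ⟨rfl, rfl⟩ | ⟨rfl, rfl⟩
          · exact ⟨hne, Or.inl (Or.inl ⟨u, v, hadj, rfl, rfl⟩)⟩
          · exact ⟨hne.symm, Or.inr (Or.inl ⟨u, v, hadj, rfl, rfl⟩)⟩
      · induction e using Sym2.ind with
        | _ u v =>
          have hadj : H.Adj u v := he
          have hne : glueRight φ u ≠ glueRight φ v := fun h =>
            hadj.ne (glueRight_injective φ h)
          rw [Sym2.map_mk] at heq
          rcases Sym2.eq_iff.1 heq with ⟨rfl, rfl⟩ | ⟨rfl, rfl⟩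
          · exact ⟨hne, Or.inl (Or.inr ⟨u, v, hadj, rfl, rfl⟩)⟩
          · exact ⟨hne.symm, Or.inr (Or.inr ⟨u, v, hadj, rfl, rfl⟩)⟩

end Gluing

/-! ### Inclusions into the glued graph with phantoms, and its projection. -/

section GluedGraph

variable {V W : Type*} {a b : V} {L : Finset W}

/-- The vertices of the glued graph and the two phantoms. -/
abbrev PhantomGlueVertex (a b : V) (L : Finset W) : Type _ := GlueVertex (SplitVertex a b) L ⊕ Fin 2

/-- The inclusion of the split and phantom vertices. -/
def leftMap (L : Finset W) : PhantomVertex a b → PhantomGlueVertex a b L := Sum.map Sum.inl id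

theorem leftMap_injective : Function.Injective (leftMap L : PhantomVertex a b → _) :=
  Sum.map_injective.2 ⟨Sum.inl_injective, Function.injective_id⟩

/-- The map to the vertices of the base graph that is a projection on the split and phantom
vertices. -/
def glueProj : PhantomGlueVertex a b L → V
  | Sum.inl (Sum.inl x) => splitProj x
  -- The choice of `a` rather than `b` is immaterial: ear vertices only have to lie over {a, b} for
  -- `IndepEdges.union_of_split`.
  | Sum.inl (Sum.inr _) => a
  | Sum.inr k => if k = 0 then a else b

theorem glueProj_leftMap (z : PhantomVertex a b) : glueProj (leftMap L z) = phantomProj z := by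
  rcases z with x | k <;> rfl

theorem map_glueProj_leftMap (e : Sym2 (PhantomVertex a b)) :
    Sym2.map glueProj (Sym2.map (leftMap L) e) = Sym2.map phantomProj e := by
  rw [Sym2.map_map, show glueProj ∘ leftMap L = phantomProj from funext glueProj_leftMap]

theorem map_inl_inl (f : Sym2 (SplitVertex a b)) :
    (Sym2.map Sum.inl (Sym2.map Sum.inl f : Sym2 (GlueVertex (SplitVertex a b) L)) :
      Sym2 (PhantomGlueVertex a b L)) = Sym2.map (leftMap L) (Sym2.map Sum.inl f) := by
  rw [Sym2.map_map, Sym2.map_map]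
  rfl

variable [DecidableEq W] {K : Finset (SplitVertex a b)}

/-- The inclusion of the vertices of the ear. -/
def rightMap (φ : K ≃ L) (w : W) : PhantomGlueVertex a b L := Sum.inl (glueRight φ w)

theorem rightMap_injective (φ : K ≃ L) : Function.Injective (rightMap φ) :=
  Sum.inl_injective.comp (glueRight_injective φ)

theorem map_inl_glueRight (φ : K ≃ L) (e : Sym2 W) :
    (Sym2.map Sum.inl (Sym2.map (glueRight φ) e) : Sym2 (PhantomGlueVertex a b L)) =
      Sym2.map (rightMap φ) e := by
  rw [Sym2.map_map]
  rfl

theorem inr_notMem_map_inl {α β : Type*} (e : Sym2 α) (k : β) :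
    (Sum.inr k : α ⊕ β) ∉ Sym2.map Sum.inl e := by
  rw [Sym2.mem_map]
  rintro ⟨x, -, hx⟩
  exact Sum.inl_ne_inr hx

theorem inr_notMem_map_rightMap (φ : K ≃ L) (e : Sym2 W) (k : Fin 2) :
    (Sum.inr k : PhantomGlueVertex a b L) ∉ Sym2.map (rightMap φ) e := by
  rw [← map_inl_glueRight]
  exact inr_notMem_map_inl _ _

theorem exists_map_inl_eq {α β : Type*} {e : Sym2 (α ⊕ β)} (h : ∀ k : β, Sum.inr k ∉ e) :
    ∃ f : Sym2 α, Sym2.map Sum.inl f = e := by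
  induction e using Sym2.ind with
  | _ x y =>
    rcases x with x | x
    · rcases y with y | y
      · exact ⟨s(x, y), rfl⟩
      · exact absurd (Sym2.mem_mk_right _ _) (h y)
    · exact absurd (Sym2.mem_mk_left _ _) (h x)

theorem glueProj_rightMap [DecidableEq V] {φ : K ≃ L} (hK : K ⊆ newVertices a b) (w : W) :
    glueProj (rightMap φ w) = a ∨ glueProj (rightMap φ w) = b := by
  rw [rightMap]
  rcases h : glueRight φ w with x | x
  · obtain ⟨hx, -⟩ := glueRight_eq_inl h
    exact mem_newVertices.1 (hK hx)
  · exact Or.inl rfl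

end GluedGraph

/-! ### Counts and lifted pairs for a safe split-and-glue. -/

section SplitAndGlue

set_option linter.unusedSectionVars false

variable {V W : Type*} [DecidableEq V] [Fintype V] [DecidableEq W] [Fintype W]

/-- The pairs of the ear cover that are used in the rank count of the ear. -/
noncomputable def earPairs (𝒴 : Finset (Finset W)) (L : Finset W) : Finset (Sym2 W) :=
  sharedSet 𝒴 ∪ keyPairs 𝒴 L

/-- The lifts of the pairs of the shared set other than `ab`, viewed in the glued graph. -/
def gluedLiftedPairs (G : SimpleGraph V) (𝒳 : Finset (Finset V)) (a b : V) (σ τ : V → Fin 2)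
    (L : Finset W) : Set (Sym2 (PhantomGlueVertex a b L)) :=
  Sym2.map (leftMap L) '' liftedPairs G 𝒳 a b σ τ

/-- The pairs of the ear, viewed in the glued graph. -/
def gluedEarPairs {a b : V} (𝒴 : Finset (Finset W)) {K : Finset (SplitVertex a b)} {L : Finset W}
    (φ : K ≃ L) : Set (Sym2 (PhantomGlueVertex a b L)) :=
  Sym2.map (rightMap φ) '' earPairs 𝒴 L

/-- The lift to the glued graph of the embedding along a cluster. -/
noncomputable def glueLift (G : SimpleGraph V) (a b : V) (σ τ : V → Fin 2) (L : Finset W)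
    (X : Finset V) (v : V) : PhantomGlueVertex a b L :=
  leftMap L (clusterLift G a b σ τ X v)

/-- The lifts of the pair `ab`. -/
def liftsOfPair (G : SimpleGraph V) (𝒳 : Finset (Finset V)) (a b : V) (σ τ : V → Fin 2)
    (L : Finset W) : Set (Sym2 (PhantomGlueVertex a b L)) :=
  {e | ∃ X ∈ 𝒳, a ∈ X ∧ b ∈ X ∧ e = Sym2.map (glueLift G a b σ τ L X) s(a, b)}

/-- The edges of the glued graph, viewed among the pairs of its vertices and the phantoms. -/
def gluedEdges {a b : V} (G : SimpleGraph V) (σ τ : V → Fin 2) (H : SimpleGraph W)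
    {K : Finset (SplitVertex a b)} {L : Finset W} (φ : K ≃ L) :
    Set (Sym2 (PhantomGlueVertex a b L)) :=
  Sym2.map Sum.inl '' (glueGraph (splitGraph G a b σ τ) H φ).edgeSet

variable {κ : RigidityModel} {G : SimpleGraph V} {𝒳 : Finset (Finset V)} {a b : V}
  {σ τ : V → Fin 2} {H : SimpleGraph W} {𝒴 : Finset (Finset W)} {K : Finset (SplitVertex a b)}
  {L : Finset W} {φ : K ≃ L}

theorem glueLift_injective (X : Finset V) : Function.Injective (glueLift G a b σ τ L X) :=
  leftMap_injective.comp clusterLift_injective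

theorem map_glueLift (X : Finset V) (e : Sym2 V) : Sym2.map (glueLift G a b σ τ L X) e =
    Sym2.map (leftMap L) (Sym2.map (clusterLift G a b σ τ X) e) := by
  rw [Sym2.map_map]
  rfl

theorem gluedEdges_eq (φ : K ≃ L) : gluedEdges G σ τ H φ =
    (fun f => Sym2.map (leftMap L) (Sym2.map Sum.inl f)) '' (splitGraph G a b σ τ).edgeSet ∪
      Sym2.map (rightMap φ) '' H.edgeSet := by
  rw [gluedEdges, glueGraph_edgeSet, Set.image_union, Set.image_image, Set.image_image]
  simp only [map_inl_glueRight, map_inl_inl]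

theorem IsSafeSplitAndGlue.ne
    (hsg : IsSafeSplitAndGlue κ G 𝒳 a b σ τ H 𝒴 K L φ) : a ≠ b :=
  not_isDiag_of_mem_sharedSet hsg.base.safe.mem_shared

/-- The rank of G together with the shared set is at most the count, which equals rank(G); so the
whole shared set lies in the closure of G. -/
theorem IsSafeSplitAndGlue.isImpliedNonedge_base
    (hsg : IsSafeSplitAndGlue κ G 𝒳 a b σ τ H 𝒴 K L φ) : IsImpliedNonedge κ G s(a, b) := by
  refine isImpliedNonedge_of_edgeRank_insert hsg.base.indep hsg.ne hsg.base.safe.nonedge ?_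
  have h1 := edgeRank_union_le_countWith hsg.base.cover.toIsTwoThinCover hsg.base.cover.indep
  have h2 := hsg.base.rank_eq
  rw [inclExcl] at h2
  have h3 : insert s(a, b) G.edgeSet ⊆ G.edgeSet ∪ sharedSet 𝒳 :=
    Set.insert_subset (Or.inr hsg.base.safe.mem_shared) Set.subset_union_left
  have h4 := edgeRank_mono κ h3
  have h5 := edgeRank_mono κ (Set.subset_insert s(a, b) G.edgeSet)
  omega

/-- The number of edges of the glued graph is at least the count that arises from the counts of the
base graph and of the ear. -/
theorem IsSafeSplitAndGlue.count_le_ncard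
    (hsg : IsSafeSplitAndGlue κ G 𝒳 a b σ τ H 𝒴 K L φ) :
    ((sharedSet 𝒳).card : ℤ) - 1 + (earPairs 𝒴 L).card +
      ∑ X ∈ 𝒳, ((edgeRank κ (inducedEdges G (sharedSet 𝒳) X) : ℤ) -
        (pairsIn (sharedSet 𝒳) X).ncard) +
      ∑ Y ∈ 𝒴, ((edgeRank κ (inducedEdges H (earPairs 𝒴 L) Y) : ℤ) -
        (pairsIn (earPairs 𝒴 L) Y).ncard) ≤
    (glueGraph (splitGraph G a b σ τ) H φ).edgeSet.ncard := by
  have h1 := hsg.base.rank_eq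
  have h2 := hsg.ear.rank_eq
  rw [inclExcl, countWith_eq] at h1
  rw [countWith_eq] at h2
  have h3 := edgeRank_le_ncard κ G.edgeSet
  have h4 := edgeRank_le_ncard κ H.edgeSet
  have h5 : G.edgeSet.ncard ≤ (splitGraph G a b σ τ).edgeSet.ncard :=
    (Set.ncard_le_ncard (t := Sym2.map splitProj '' (splitGraph G a b σ τ).edgeSet)
      (fun e he => exists_splitGraph_edge hsg.base.safe.nonedge he) (Set.toFinite _)).trans
      (Set.ncard_image_le (Set.toFinite _))
  -- An edge of the split graph has an old end, which is never a gluing vertex, so no edge is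
  -- identified with an edge of the ear.
  have hdis : Disjoint (Sym2.map Sum.inl '' (splitGraph G a b σ τ).edgeSet)
      (Sym2.map (glueRight φ) '' H.edgeSet) := by
    rw [Set.disjoint_left]
    rintro _ ⟨f, hf, rfl⟩ ⟨h, -, heq⟩
    obtain ⟨v, hv⟩ := exists_inl_mem_of_mem_edgeSet hf
    have h' : (Sum.inl (Sum.inl v) : GlueVertex (SplitVertex a b) L) ∈
        Sym2.map (glueRight φ) h := by
      rw [heq]
      exact Sym2.mem_map.2 ⟨_, hv, rfl⟩
    obtain ⟨w, -, hw⟩ := Sym2.mem_map.1 h'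
    obtain ⟨hvK, -⟩ := glueRight_eq_inl hw
    rcases mem_newVertices.1 (hsg.gluing_subset hvK) with h | h
    · exact v.2.1 h
    · exact v.2.2 h
  rw [glueGraph_edgeSet, Set.ncard_union_eq hdis (Set.toFinite _) (Set.toFinite _),
    Set.ncard_image_of_injective _ (Sym2.map.injective Sum.inl_injective),
    Set.ncard_image_of_injective _ (Sym2.map.injective (glueRight_injective φ))]
  rw [← earPairs] at h2
  push_cast
  omega

/-- Lifted pairs project injectively into the shared set without `ab`. The pair gained here pays for
the -1 in the rank formula of the ear. -/
theorem IsSafeSplitAndGlue.ncard_gluedLiftedPairs_le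
    (hsg : IsSafeSplitAndGlue κ G 𝒳 a b σ τ H 𝒴 K L φ) :
    (gluedLiftedPairs G 𝒳 a b σ τ L).ncard + 1 ≤ (sharedSet 𝒳).card := by
  have h1 := Set.ncard_le_ncard_of_injOn (s := liftedPairs G 𝒳 a b σ τ)
    (t := (sharedSet 𝒳 : Set (Sym2 V)) \ {s(a, b)}) (Sym2.map phantomProj)
    (fun e he => map_phantomProj_mem_of_mem_liftedPairs hsg.base.safe.nonedge he)
    (liftedPairs_injOn hsg.base.cover.toIsTwoThinCover hsg.base.safe hsg.ne) (Set.toFinite _)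
  have h2 := Set.ncard_sdiff_singleton_add_one (s := (sharedSet 𝒳 : Set (Sym2 V)))
    (a := s(a, b)) hsg.base.safe.mem_shared (Set.toFinite _)
  rw [Set.ncard_coe_finset] at h2
  rw [gluedLiftedPairs, Set.ncard_image_of_injective _ (Sym2.map.injective leftMap_injective)]
  omega

theorem IsSafeSplitAndGlue.mem_gluedEarPairs_of_key
    (hsg : IsSafeSplitAndGlue κ G 𝒳 a b σ τ H 𝒴 K L φ) {x y : SplitVertex a b}
    {Z : Finset (SplitVertex a b)} (hZ : Z ∈ safeSplitCover G 𝒳 a b σ τ) (hx : x ∈ Z) (hy : y ∈ Z)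
    (hxy : x ≠ y) (hxn : x ∈ newVertices a b) (hyn : y ∈ newVertices a b) :
    ∃ e ∈ keyPairs 𝒴 L, Sym2.map (glueRight φ) e = s(Sum.inl x, Sum.inl y) := by
  have hkey : s(x, y) ∈ keyPairs (safeSplitCover G 𝒳 a b σ τ) (newVertices a b) :=
    mem_keyPairs.2 ⟨⟨hxy, hxn, hyn⟩, Z, hZ, hx, hy⟩
  have hxK := hsg.key_mem _ hkey x (Sym2.mem_mk_left _ _)
  have hyK := hsg.key_mem _ hkey y (Sym2.mem_mk_right _ _)
  refine ⟨_, (hsg.key_iff ⟨x, hxK⟩ ⟨y, hyK⟩).1 hkey, ?_⟩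
  rw [Sym2.map_mk, glueRight_apply, glueRight_apply]

theorem IsSafeSplitAndGlue.noTwins_of_pair
    (hsg : IsSafeSplitAndGlue κ G 𝒳 a b σ τ H 𝒴 K L φ) {X : Finset V} (hX : X ∈ 𝒳)
    (ha : a ∈ X) (hb : b ∈ X) :
    NoTwins (splitCluster G a b σ τ X) :=
  hsg.base.safe.noTwins X hX ⟨s(a, b), hsg.base.safe.mem_shared, hsg.base.safe.nonedge, by
    simp [ha, hb]⟩

/-- A lift of the pair `ab` comes from the ear, or it is one of five pairs with a phantom. -/
theorem IsSafeSplitAndGlue.liftsOfPair_cases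
    (hsg : IsSafeSplitAndGlue κ G 𝒳 a b σ τ H 𝒴 K L φ) {e : Sym2 (PhantomGlueVertex a b L)}
    (he : e ∈ liftsOfPair G 𝒳 a b σ τ L) : e ∈ gluedEarPairs 𝒴 φ ∨
      ((∃ k, e = s(Sum.inr 0, Sum.inl (Sum.inl (copyB a b k)))) ∨ e = s(Sum.inr 0, Sum.inr 1) ∨
        ∃ k, e = s(Sum.inr 1, Sum.inl (Sum.inl (copyA a b k)))) := by
  obtain ⟨X, hX, ha, hb, rfl⟩ := he
  have ht := hsg.noTwins_of_pair hX ha hb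
  have hA : ∀ x : SplitVertex a b, splitProj x = a → ∃ k, x = copyA a b k := by
    rintro (v | k | k) h
    · exact absurd h v.2.1
    · exact ⟨k, rfl⟩
    · exact absurd h.symm hsg.ne
  have hB : ∀ x : SplitVertex a b, splitProj x = b → ∃ k, x = copyB a b k := by
    rintro (v | k | k) h
    · exact absurd h v.2.2
    · exact absurd h hsg.ne
    · exact ⟨k, rfl⟩
  rw [Sym2.map_mk, glueLift, glueLift]
  rcases clusterLift_cases (G := G) (a := a) (b := b) (σ := σ) (τ := τ) ha with
    ⟨x, hx, hxa, hl⟩ | ⟨-, ⟨-, hl⟩ | ⟨h, -⟩⟩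
  · rcases clusterLift_cases (G := G) (a := a) (b := b) (σ := σ) (τ := τ) hb with
      ⟨y, hy, hyb, hl'⟩ | ⟨-, ⟨h, -⟩ | ⟨-, hl'⟩⟩
    · left
      -- Both copies are genuine, so they lie in a common cluster of the split cover and form a key
      -- gluing pair, which is matched by one of the ear.
      rw [hl, hl']
      have hne : x ≠ y := by
        rintro rfl
        exact hsg.ne (hxa.symm.trans hyb)
      obtain ⟨e, he, heq⟩ := hsg.mem_gluedEarPairs_of_key (mem_safeSplitCover.2 (Or.inl
        (mem_bigSplitClusters.2 ⟨X, hX, rfl, two_lt_card_of_new hsg.ne hx hy hxa hyb, ht⟩)))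
        hx hy hne (mem_newVertices.2 (Or.inl hxa)) (mem_newVertices.2 (Or.inr hyb))
      refine ⟨e, Finset.mem_union_right _ he, ?_⟩
      rw [← map_inl_glueRight, heq]
      rfl
    · exact absurd h.symm hsg.ne
    · obtain ⟨k, rfl⟩ := hA x hxa
      rw [hl, hl']
      exact Or.inr (Or.inr (Or.inr ⟨k, Sym2.eq_swap⟩))
  · rcases clusterLift_cases (G := G) (a := a) (b := b) (σ := σ) (τ := τ) hb with
      ⟨y, hy, hyb, hl'⟩ | ⟨-, ⟨h, -⟩ | ⟨-, hl'⟩⟩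
    · obtain ⟨k, rfl⟩ := hB y hyb
      rw [hl, hl']
      exact Or.inr (Or.inl ⟨k, rfl⟩)
    · exact absurd h.symm hsg.ne
    · rw [hl, hl']
      exact Or.inr (Or.inr (Or.inl rfl))
  · exact absurd h hsg.ne

theorem map_glueLift_mem {X : Finset V} (hX : X ∈ 𝒳)
    (ht : NoTwins (splitCluster G a b σ τ X)) {f : Sym2 V} (hf : f ∈ sharedSet 𝒳)
    (hfX : ∀ v ∈ f, v ∈ X) : Sym2.map (glueLift G a b σ τ L X) f ∈
      gluedLiftedPairs G 𝒳 a b σ τ L ∪ liftsOfPair G 𝒳 a b σ τ L := by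
  by_cases hne : f = s(a, b)
  · subst hne
    exact Or.inr ⟨X, hX, hfX a (Sym2.mem_mk_left _ _), hfX b (Sym2.mem_mk_right _ _), rfl⟩
  · exact Or.inl ⟨_, Or.inl ⟨X, hX, ht, f, hf, hne, hfX, rfl⟩, (map_glueLift X f).symm⟩

theorem IsSafeSplitAndGlue.indep_earPairs
    (hsg : IsSafeSplitAndGlue κ G 𝒳 a b σ τ H 𝒴 K L φ) :
    IndepEdges κ (earPairs 𝒴 L : Set (Sym2 W)) := by
  refine hsg.ear.indep.subset ?_
  rw [earPairs, Finset.coe_union]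
  refine Set.union_subset_union_right _ ?_
  exact_mod_cast Finset.filter_subset _ _

/-! ### Rank bounds and the removal of phantoms. -/

/-- The upper bound on the rank of the glued graph together with all lifted pairs. -/
theorem IsSafeSplitAndGlue.edgeRank_le
    (hsg : IsSafeSplitAndGlue κ G 𝒳 a b σ τ H 𝒴 K L φ) : edgeRank κ (gluedEdges G σ τ H φ ∪
      (gluedLiftedPairs G 𝒳 a b σ τ L ∪ liftsOfPair G 𝒳 a b σ τ L ∪ gluedEarPairs 𝒴 φ)) ≤
    (glueGraph (splitGraph G a b σ τ) H φ).edgeSet.ncard +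
      (liftsOfPair G 𝒳 a b σ τ L \ gluedEarPairs 𝒴 φ).ncard := by
  classical
  set T₁ := gluedLiftedPairs G 𝒳 a b σ τ L with hT₁
  set P := liftsOfPair G 𝒳 a b σ τ L with hP
  set B := gluedEarPairs 𝒴 φ with hB
  let A : Finset V → Set (Sym2 (PhantomGlueVertex a b L)) := fun X =>
    if NoTwins (splitCluster G a b σ τ X) then
      Sym2.map (glueLift G a b σ τ L X) '' inducedEdges G (sharedSet 𝒳) X
    else (fun f => Sym2.map (leftMap L) (Sym2.map Sum.inl f)) ''
      {f | f ∈ (splitGraph G a b σ τ).edgeSet ∧ (∀ v ∈ Sym2.map splitProj f, v ∈ X) ∧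
        Sym2.map splitProj f ∉ sharedSet 𝒳}
  -- A cluster without twins is attached along all its shared pairs. A cluster with twins
  -- contributes just its edges over unshared pairs, so it needs no overlap.
  let D : Finset V → Set (Sym2 (PhantomGlueVertex a b L)) := fun X =>
    if NoTwins (splitCluster G a b σ τ X) then
      Sym2.map (glueLift G a b σ τ L X) '' pairsIn (sharedSet 𝒳) X
    else ∅
  have hDi : ∀ X ∈ 𝒳, IndepEdges κ (D X) := by
    intro X _
    simp only [D]
    split_ifs
    · exact (hsg.base.cover.indep.subset (pairsIn_subset _ _)).image (glueLift_injective X)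
    · rw [IndepEdges, edgeRank_empty, Set.ncard_empty]
  have h1 := edgeRank_union_iUnion_le (κ := κ) 𝒳 (T₁ ∪ P ∪ B) A D (by
    intro X _
    simp only [A, D]
    split_ifs
    · exact Set.image_mono (pairsIn_subset_inducedEdges _ _ _)
    · exact Set.empty_subset _) (by
    intro X hX
    simp only [D]
    split_ifs with ht
    · rintro _ ⟨f, hf, rfl⟩
      exact Or.inl (map_glueLift_mem hX ht hf.1 hf.2)
    · exact Set.empty_subset _) hDi
  have h2 : ∑ X ∈ 𝒳, ((edgeRank κ (A X) : ℤ) - (D X).ncard) ≤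
      ∑ X ∈ 𝒳, ((edgeRank κ (inducedEdges G (sharedSet 𝒳) X) : ℤ) -
        (pairsIn (sharedSet 𝒳) X).ncard) := by
    refine Finset.sum_le_sum fun X hX => ?_
    simp only [A, D]
    split_ifs with ht
    · rw [edgeRank_image κ (glueLift_injective X), Set.ncard_image_of_injective _
        (Sym2.map.injective (glueLift_injective X))]
    · have h := ncard_le_of_not_noTwins hsg.base.indep hsg.ne hsg.base.safe hX ht
      refine le_trans ?_ h
      rw [Set.ncard_empty, Nat.cast_zero, sub_zero]
      exact_mod_cast (edgeRank_le_ncard κ _).trans (Set.ncard_image_le (Set.toFinite _))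
  -- The ear clusters are attached afterwards, along the ear pairs already present.
  have h3 := edgeRank_union_iUnion_le (κ := κ) 𝒴 (T₁ ∪ P ∪ B ∪ ⋃ X ∈ 𝒳, A X)
    (fun Y => Sym2.map (rightMap φ) '' inducedEdges H (earPairs 𝒴 L) Y)
    (fun Y => Sym2.map (rightMap φ) '' pairsIn (earPairs 𝒴 L) Y)
    (fun Y _ => Set.image_mono (pairsIn_subset_inducedEdges _ _ _))
    (fun Y _ => (Set.image_mono (pairsIn_subset _ _)).trans
      (Set.subset_union_right.trans Set.subset_union_left))
    (fun Y _ => (hsg.indep_earPairs.subset (pairsIn_subset _ _)).image (rightMap_injective φ))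
  simp only [edgeRank_image κ (rightMap_injective φ),
    Set.ncard_image_of_injective _ (Sym2.map.injective (rightMap_injective φ))] at h3
  have h4 : edgeRank κ (T₁ ∪ P ∪ B) ≤ T₁.ncard + (P \ B).ncard + B.ncard := by
    have hu : T₁ ∪ P ∪ B = T₁ ∪ (P \ B) ∪ B := by
      rw [Set.union_assoc, Set.union_assoc, Set.sdiff_union_self]
    rw [hu]
    exact (edgeRank_le_ncard κ _).trans ((Set.ncard_union_le _ _).trans
      (Nat.add_le_add_right (Set.ncard_union_le _ _) _))
  have h5 : B.ncard ≤ (earPairs 𝒴 L).card := by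
    rw [← Set.ncard_coe_finset]
    exact Set.ncard_image_le (Set.toFinite _)
  have h6 := hsg.ncard_gluedLiftedPairs_le
  rw [← hT₁] at h6
  have h7 := hsg.count_le_ncard
  have h8 : gluedEdges G σ τ H φ ∪ (T₁ ∪ P ∪ B) ⊆ (T₁ ∪ P ∪ B ∪ ⋃ X ∈ 𝒳, A X) ∪
      ⋃ Y ∈ 𝒴, Sym2.map (rightMap φ) '' inducedEdges H (earPairs 𝒴 L) Y := by
    rintro e (he | he)
    · rw [gluedEdges_eq] at he
      rcases he with ⟨f, hf, rfl⟩ | ⟨f, hf, rfl⟩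
      · left
        have hfG := map_splitProj_mem_edgeSet hf
        obtain ⟨X, hX, hfX⟩ : ∃ X ∈ 𝒳, ∀ v ∈ Sym2.map splitProj f, v ∈ X := by
          revert hfG
          generalize Sym2.map splitProj f = e
          induction e using Sym2.ind with
          | _ u v =>
            intro huv
            obtain ⟨X, hX, hu, hv⟩ := hsg.base.cover.covers u v huv
            exact ⟨X, hX, by simp [hu, hv]⟩
        by_cases ht : NoTwins (splitCluster G a b σ τ X)
        · right
          simp only [Set.mem_iUnion]
          refine ⟨X, hX, ?_⟩
          simp only [A, if_pos ht]
          refine ⟨_, ⟨Or.inl hfG, hfX⟩, ?_⟩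
          rw [map_glueLift, map_clusterLift_of_mem_edgeSet hsg.ne ht
            (mem_splitCluster_of_mem_edge hf hfX)]
        -- In a cluster with twins, an edge over a shared pair is itself a lifted pair and hence
        -- belongs to `T₁`.
        · by_cases hS : Sym2.map splitProj f ∈ sharedSet 𝒳
          · exact Or.inl (Or.inl (Or.inl ⟨_, Or.inr ⟨f, hf, hS, rfl⟩, rfl⟩))
          · right
            simp only [Set.mem_iUnion]
            refine ⟨X, hX, ?_⟩
            simp only [A, if_neg ht]
            exact ⟨f, ⟨hf, hfX, hS⟩, rfl⟩
      · right
        induction f using Sym2.ind with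
        | _ u v =>
          obtain ⟨Y, hY, hu, hv⟩ := hsg.ear.cover.covers u v hf
          simp only [Set.mem_iUnion]
          exact ⟨Y, hY, _, ⟨Or.inl hf, by simp [hu, hv]⟩, rfl⟩
    · exact Or.inl (Or.inl he)
  have h9 := edgeRank_mono κ h8
  zify at h4 h5 h6 h9 ⊢
  linarith

theorem ncard_le_three {α : Type*} {s : Set α} {x y z : α} (h : ∀ e ∈ s, e = x ∨ e = y ∨ e = z) :
    s.ncard ≤ 3 := by
  classical
  have h1 : s ⊆ (({x, y, z} : Finset α) : Set α) := by
    intro e he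
    simpa using h e he
  refine (Set.ncard_le_ncard h1 (Finset.finite_toSet _)).trans ?_
  rw [Set.ncard_coe_finset]
  exact Finset.card_le_three

theorem gluedEdges_indep
    (hN : IndepEdges κ (glueGraph (splitGraph G a b σ τ) H φ).edgeSet) :
    IndepEdges κ (gluedEdges G σ τ H φ) := hN.image Sum.inl_injective

theorem ncard_gluedEdges : (gluedEdges G σ τ H φ).ncard =
    (glueGraph (splitGraph G a b σ τ) H φ).edgeSet.ncard :=
  Set.ncard_image_of_injective _ (Sym2.map.injective Sum.inl_injective)

theorem inr_notMem_of_mem_gluedEdges {e : Sym2 (PhantomGlueVertex a b L)}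
    (he : e ∈ gluedEdges G σ τ H φ) (k : Fin 2) : Sum.inr k ∉ e := by
  obtain ⟨f, -, rfl⟩ := he
  exact inr_notMem_map_inl f k

theorem inr_notMem_of_mem_gluedEarPairs {e : Sym2 (PhantomGlueVertex a b L)}
    (he : e ∈ gluedEarPairs 𝒴 φ) (k : Fin 2) : Sum.inr k ∉ e := by
  obtain ⟨f, -, rfl⟩ := he
  exact inr_notMem_map_rightMap φ f k

/-- Zero-extensions with the phantoms: adding the lifts of `ab` that meet a phantom, and at most one
further edge at a phantom. -/
theorem IsSafeSplitAndGlue.edgeRank_union_phantom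
    (hsg : IsSafeSplitAndGlue κ G 𝒳 a b σ τ H 𝒴 K L φ)
    {E Q : Set (Sym2 (PhantomGlueVertex a b L))} (hE : ∀ e ∈ E, ∀ k : Fin 2, Sum.inr k ∉ e)
    {k : Fin 2}
    {w : GlueVertex (SplitVertex a b) L}
    (hQ : Q ⊆ insert s(Sum.inr k, Sum.inl w)
      (liftsOfPair G 𝒳 a b σ τ L \ gluedEarPairs 𝒴 φ)) :
    edgeRank κ (E ∪ Q) = edgeRank κ E + Q.ncard := by
  have hQ' : ∀ e ∈ Q, e = s(Sum.inr k, Sum.inl w) ∨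
      e = s(Sum.inr 0, Sum.inl (Sum.inl (copyB a b 0))) ∨
      e = s(Sum.inr 0, Sum.inl (Sum.inl (copyB a b 1))) ∨ e = s(Sum.inr 0, Sum.inr 1) ∨
      e = s(Sum.inr 1, Sum.inl (Sum.inl (copyA a b 0))) ∨
      e = s(Sum.inr 1, Sum.inl (Sum.inl (copyA a b 1))) := by
    intro e he
    rcases hQ he with rfl | ⟨h1, h2⟩
    · exact Or.inl rfl
    rcases (hsg.liftsOfPair_cases h1).resolve_left h2 with ⟨l, rfl⟩ | rfl | ⟨l, rfl⟩
    · fin_cases l <;> simp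
    · simp
    · fin_cases l <;> simp
  have hmem : ∀ e ∈ Q, (Sum.inr 0 ∈ e ∨ Sum.inr 1 ∈ e) ∧ ¬ e.IsDiag := by
    intro e he
    rcases hQ' e he with rfl | rfl | rfl | rfl | rfl | rfl
    · fin_cases k <;> simp
    all_goals simp
  have hk : k = 0 ∨ k = 1 := by
    fin_cases k <;> simp
  -- The phantom carrying the additional edge is added first. Its star has that edge and two lifts
  -- of `ab`; the pair of phantoms goes to the other star, so neither exceeds three edges.
  rcases hk with rfl | rfl
  · refine edgeRank_union_two_stars (x := Sum.inr 0) (y := Sum.inr 1)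
      (fun e he => ⟨hE e he 0, hE e he 1⟩) hmem ?_ ?_
    · refine ncard_le_three (x := s(Sum.inr 0, Sum.inl w))
        (y := s(Sum.inr 0, Sum.inl (Sum.inl (copyB a b 0))))
        (z := s(Sum.inr 0, Sum.inl (Sum.inl (copyB a b 1)))) ?_
      rintro e ⟨he, hy⟩
      rcases hQ' e he with rfl | rfl | rfl | rfl | rfl | rfl <;> simp at hy ⊢
    · refine ncard_le_three (x := s(Sum.inr 0, Sum.inr 1))
        (y := s(Sum.inr 1, Sum.inl (Sum.inl (copyA a b 0))))
        (z := s(Sum.inr 1, Sum.inl (Sum.inl (copyA a b 1)))) ?_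
      rintro e ⟨he, hy⟩
      rcases hQ' e he with rfl | rfl | rfl | rfl | rfl | rfl <;> simp at hy ⊢
  · refine edgeRank_union_two_stars (x := Sum.inr 1) (y := Sum.inr 0)
      (fun e he => ⟨hE e he 1, hE e he 0⟩) (fun e he => ⟨(hmem e he).1.symm, (hmem e he).2⟩) ?_ ?_
    · refine ncard_le_three (x := s(Sum.inr 1, Sum.inl w))
        (y := s(Sum.inr 1, Sum.inl (Sum.inl (copyA a b 0))))
        (z := s(Sum.inr 1, Sum.inl (Sum.inl (copyA a b 1)))) ?_
      rintro e ⟨he, hy⟩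
      rcases hQ' e he with rfl | rfl | rfl | rfl | rfl | rfl <;> simp at hy ⊢
    · refine ncard_le_three (x := s(Sum.inr 0, Sum.inr 1))
        (y := s(Sum.inr 0, Sum.inl (Sum.inl (copyB a b 0))))
        (z := s(Sum.inr 0, Sum.inl (Sum.inl (copyB a b 1)))) ?_
      rintro e ⟨he, hy⟩
      rcases hQ' e he with rfl | rfl | rfl | rfl | rfl | rfl <;> simp at hy ⊢

theorem IsSafeSplitAndGlue.edgeRank_le_of_subset
    (hsg : IsSafeSplitAndGlue κ G 𝒳 a b σ τ H 𝒴 K L φ)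
    {E : Set (Sym2 (PhantomGlueVertex a b L))} (hE : E ⊆ gluedEdges G σ τ H φ ∪
      (gluedLiftedPairs G 𝒳 a b σ τ L ∪ liftsOfPair G 𝒳 a b σ τ L ∪ gluedEarPairs 𝒴 φ)) :
    edgeRank κ E ≤ (gluedEdges G σ τ H φ).ncard +
      (liftsOfPair G 𝒳 a b σ τ L \ gluedEarPairs 𝒴 φ).ncard := by
  rw [ncard_gluedEdges]
  exact (edgeRank_mono κ hE).trans hsg.edgeRank_le

/-- If the glued graph is independent, then no lifted pair contains a phantom. -/
theorem IsSafeSplitAndGlue.inr_notMem_of_mem_gluedLiftedPairs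
    (hsg : IsSafeSplitAndGlue κ G 𝒳 a b σ τ H 𝒴 K L φ)
    (hN : IndepEdges κ (glueGraph (splitGraph G a b σ τ) H φ).edgeSet)
    {e : Sym2 (PhantomGlueVertex a b L)} (he : e ∈ gluedLiftedPairs G 𝒳 a b σ τ L) (k : Fin 2) :
    Sum.inr k ∉ e := by
  intro hk
  have he' := he
  obtain ⟨f, hf, rfl⟩ := he
  obtain ⟨z, v, rfl⟩ := exists_eq_of_mem_liftedPairs hsg.base.safe.nonedge hf
  have heq : Sym2.map (leftMap L) s(z, Sum.inl (Sum.inl v)) =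
      s(Sum.inr k, Sum.inl (Sum.inl (Sum.inl v))) := by
    rw [Sym2.map_mk] at hk ⊢
    rcases Sym2.mem_iff.1 hk with h | h
    · rw [← h]
      rfl
    · exact absurd h.symm Sum.inl_ne_inr
  rw [heq] at he'
  have hnot : s(Sum.inr k, Sum.inl (Sum.inl (Sum.inl v))) ∉
      liftsOfPair G 𝒳 a b σ τ L \ gluedEarPairs 𝒴 φ := by
    rintro ⟨h1, h2⟩
    rcases (hsg.liftsOfPair_cases h1).resolve_left h2 with ⟨l, h⟩ | h | ⟨l, h⟩ <;> simp at h
  -- A lifted pair at a phantom is a further zero-extension edge, so it would push the rank one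
  -- above the upper bound.
  have h1 := hsg.edgeRank_union_phantom (E := gluedEdges G σ τ H φ)
    (fun e he k => inr_notMem_of_mem_gluedEdges he k) (k := k)
    (w := Sum.inl (Sum.inl v)) subset_rfl
  have h2 := hsg.edgeRank_le_of_subset (E := gluedEdges G σ τ H φ ∪
    insert s(Sum.inr k, Sum.inl (Sum.inl (Sum.inl v)))
      (liftsOfPair G 𝒳 a b σ τ L \ gluedEarPairs 𝒴 φ))
    (Set.union_subset_union_right _ (Set.insert_subset (Or.inl (Or.inl he'))
      fun e he => Or.inl (Or.inr he.1)))
  rw [h1, gluedEdges_indep hN, Set.ncard_insert_of_notMem hnot (Set.toFinite _)] at h2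
  omega

/-- If the glued graph is independent, then its closure contains the lifted pairs and the pairs
of the ear. -/
theorem IsSafeSplitAndGlue.edgeRank_insert_eq
    (hsg : IsSafeSplitAndGlue κ G 𝒳 a b σ τ H 𝒴 K L φ)
    (hN : IndepEdges κ (glueGraph (splitGraph G a b σ τ) H φ).edgeSet)
    {e : Sym2 (PhantomGlueVertex a b L)}
    (he : e ∈ gluedLiftedPairs G 𝒳 a b σ τ L ∪ gluedEarPairs 𝒴 φ) :
    edgeRank κ (insert e (gluedEdges G σ τ H φ)) = edgeRank κ (gluedEdges G σ τ H φ) := by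
  have hinr : ∀ k : Fin 2, Sum.inr k ∉ e := by
    rcases he with he | he
    · exact hsg.inr_notMem_of_mem_gluedLiftedPairs hN he
    · exact inr_notMem_of_mem_gluedEarPairs he
  by_contra hne
  have h1 := edgeRank_mono κ (Set.subset_insert e (gluedEdges G σ τ H φ))
  -- If `e` raised the rank, the phantom lifts of `ab` on top would exceed the upper bound. No
  -- additional phantom edge is used here, so `k` and `w` are arbitrary.
  have h2 := hsg.edgeRank_union_phantom (E := insert e (gluedEdges G σ τ H φ))
    (Q := liftsOfPair G 𝒳 a b σ τ L \ gluedEarPairs 𝒴 φ) (by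
      rintro f (rfl | hf)
      · exact hinr
      · exact inr_notMem_of_mem_gluedEdges hf) (k := 0) (w := Sum.inl (copyA a b 0))
    (Set.subset_insert _ _)
  have h3 := hsg.edgeRank_le_of_subset (E := insert e (gluedEdges G σ τ H φ) ∪
    (liftsOfPair G 𝒳 a b σ τ L \ gluedEarPairs 𝒴 φ)) (by
      rintro f ((rfl | hf) | hf)
      · exact Or.inr (he.imp_left Or.inl)
      · exact Or.inl hf
      · exact Or.inr (Or.inl (Or.inr hf.1)))
  have h4 : edgeRank κ (gluedEdges G σ τ H φ) = _ := gluedEdges_indep hN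
  omega

/-! ### Lifted pairs and ear pairs as pairs of the glued graph. -/

/-- The pairs of vertices of the glued graph that are lifted pairs or pairs of the ear. -/
noncomputable def gluedPairs (G : SimpleGraph V) (𝒳 : Finset (Finset V)) (a b : V) (σ τ : V → Fin 2)
    (𝒴 : Finset (Finset W)) {K : Finset (SplitVertex a b)} {L : Finset W} (φ : K ≃ L) :
    Finset (Sym2 (GlueVertex (SplitVertex a b) L)) :=
  (Set.toFinite (Sym2.map Sum.inl ⁻¹'
    (gluedLiftedPairs G 𝒳 a b σ τ L ∪ gluedEarPairs 𝒴 φ))).toFinset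

theorem mem_gluedPairs {e : Sym2 (GlueVertex (SplitVertex a b) L)} :
    e ∈ gluedPairs G 𝒳 a b σ τ 𝒴 φ ↔
      Sym2.map Sum.inl e ∈ gluedLiftedPairs G 𝒳 a b σ τ L ∪ gluedEarPairs 𝒴 φ := by
  rw [gluedPairs, Set.Finite.mem_toFinset, Set.mem_preimage]

theorem IsSafeSplitAndGlue.image_gluedPairs
    (hsg : IsSafeSplitAndGlue κ G 𝒳 a b σ τ H 𝒴 K L φ)
    (hN : IndepEdges κ (glueGraph (splitGraph G a b σ τ) H φ).edgeSet) :
    Sym2.map Sum.inl '' (gluedPairs G 𝒳 a b σ τ 𝒴 φ : Set _) =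
      gluedLiftedPairs G 𝒳 a b σ τ L ∪ gluedEarPairs 𝒴 φ := by
  ext e
  constructor
  · rintro ⟨f, hf, rfl⟩
    exact mem_gluedPairs.1 hf
  · intro he
    obtain ⟨f, rfl⟩ := exists_map_inl_eq (e := e) (by
      rcases he with he | he
      · exact hsg.inr_notMem_of_mem_gluedLiftedPairs hN he
      · exact inr_notMem_of_mem_gluedEarPairs he)
    exact ⟨f, mem_gluedPairs.2 he, rfl⟩

/-- This is `IndepEdges.union_of_split` along `glueProj`: lifted pairs project injectively to shared
pairs other than `ab`, and the ear pairs form an independent set over {a, b}. -/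
theorem IsSafeSplitAndGlue.indep_gluedPairs
    (hsg : IsSafeSplitAndGlue κ G 𝒳 a b σ τ H 𝒴 K L φ)
    (hN : IndepEdges κ (glueGraph (splitGraph G a b σ τ) H φ).edgeSet) :
    IndepEdges κ (gluedPairs G 𝒳 a b σ τ 𝒴 φ : Set (Sym2 (GlueVertex (SplitVertex a b) L))) := by
  have hi : IndepEdges κ (gluedLiftedPairs G 𝒳 a b σ τ L ∪ gluedEarPairs 𝒴 φ) := by
    refine hsg.base.cover.indep.union_of_split (π := glueProj) hsg.ne hsg.base.safe.mem_shared
      ?_ ?_ (hsg.indep_earPairs.image (rightMap_injective φ)) ?_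
    · rintro _ ⟨e, he, rfl⟩ _ ⟨f, hf, rfl⟩ h
      rw [map_glueProj_leftMap, map_glueProj_leftMap] at h
      rw [liftedPairs_injOn hsg.base.cover.toIsTwoThinCover hsg.base.safe hsg.ne he hf h]
    · rintro _ ⟨e, he, rfl⟩
      rw [map_glueProj_leftMap]
      exact map_phantomProj_mem_of_mem_liftedPairs hsg.base.safe.nonedge he
    · rintro _ ⟨e, -, rfl⟩ x hx
      obtain ⟨w, -, rfl⟩ := Sym2.mem_map.1 hx
      exact glueProj_rightMap hsg.gluing_subset w
  rw [← hsg.image_gluedPairs hN] at hi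
  rwa [IndepEdges, edgeRank_image κ Sum.inl_injective,
    Set.ncard_image_of_injective _ (Sym2.map.injective Sum.inl_injective)] at hi

theorem IsSafeSplitAndGlue.card_gluedPairs_le
    (hsg : IsSafeSplitAndGlue κ G 𝒳 a b σ τ H 𝒴 K L φ)
    (hN : IndepEdges κ (glueGraph (splitGraph G a b σ τ) H φ).edgeSet) :
    (gluedPairs G 𝒳 a b σ τ 𝒴 φ).card + 1 ≤ (sharedSet 𝒳).card + (earPairs 𝒴 L).card := by
  have h1 := hsg.ncard_gluedLiftedPairs_le
  have h2 : (gluedEarPairs 𝒴 φ).ncard ≤ (earPairs 𝒴 L).card := by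
    rw [← Set.ncard_coe_finset]
    exact Set.ncard_image_le (Set.toFinite _)
  have h3 := Set.ncard_union_le (gluedLiftedPairs G 𝒳 a b σ τ L) (gluedEarPairs 𝒴 φ)
  rw [← hsg.image_gluedPairs hN, Set.ncard_image_of_injective _
    (Sym2.map.injective Sum.inl_injective), Set.ncard_coe_finset] at h3
  omega

theorem IsSafeSplitAndGlue.edgeRank_insert_gluedPair
    (hsg : IsSafeSplitAndGlue κ G 𝒳 a b σ τ H 𝒴 K L φ)
    (hN : IndepEdges κ (glueGraph (splitGraph G a b σ τ) H φ).edgeSet)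
    {e : Sym2 (GlueVertex (SplitVertex a b) L)} (he : e ∈ gluedPairs G 𝒳 a b σ τ 𝒴 φ) :
    edgeRank κ (insert e (glueGraph (splitGraph G a b σ τ) H φ).edgeSet) =
      edgeRank κ (glueGraph (splitGraph G a b σ τ) H φ).edgeSet := by
  have h := hsg.edgeRank_insert_eq hN (mem_gluedPairs.1 he)
  rw [gluedEdges, ← Set.image_insert_eq] at h
  rwa [edgeRank_image κ Sum.inl_injective, edgeRank_image κ Sum.inl_injective] at h

theorem not_isDiag_map {α β : Type*} {f : α → β} (hf : Function.Injective f) {e : Sym2 α}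
    (he : ¬ e.IsDiag) : ¬ (Sym2.map f e).IsDiag := by
  rwa [Sym2.isDiag_map hf]

theorem not_isDiag_of_mem_earPairs {e : Sym2 W} (he : e ∈ earPairs 𝒴 L) : ¬ e.IsDiag := by
  rcases Finset.mem_union.1 he with he | he
  · exact not_isDiag_of_mem_sharedSet he
  · induction e using Sym2.ind with
    | _ u v => exact (mem_keyPairs.1 he).1.1

theorem IsSafeSplitAndGlue.not_isDiag_of_mem_gluedPairs
    (hsg : IsSafeSplitAndGlue κ G 𝒳 a b σ τ H 𝒴 K L φ)
    {e : Sym2 (GlueVertex (SplitVertex a b) L)} (he : e ∈ gluedPairs G 𝒳 a b σ τ 𝒴 φ) :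
    ¬ e.IsDiag := by
  intro hd
  rcases mem_gluedPairs.1 he with ⟨f, hf, heq⟩ | ⟨f, hf, heq⟩
  · have h1 := (map_phantomProj_mem_of_mem_liftedPairs hsg.base.safe.nonedge hf).1
    rw [← map_glueProj_leftMap (L := L), heq] at h1
    exact not_isDiag_of_mem_sharedSet h1 (hd.map.map)
  · have h1 := not_isDiag_map (rightMap_injective φ) (not_isDiag_of_mem_earPairs hf)
    rw [heq] at h1
    exact h1 hd.map

/-- The glued graph has an implied nonedge. -/
theorem IsSafeSplitAndGlue.exists_isImpliedNonedge
    (hsg : IsSafeSplitAndGlue κ G 𝒳 a b σ τ H 𝒴 K L φ)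
    (hN : IndepEdges κ (glueGraph (splitGraph G a b σ τ) H φ).edgeSet) :
    ∃ e, IsImpliedNonedge κ (glueGraph (splitGraph G a b σ τ) H φ) e := by
  have hH : IndepEdges κ H.edgeSet := by
    have h : IndepEdges κ (Sym2.map (glueRight φ) '' H.edgeSet) := by
      refine hN.subset ?_
      rw [glueGraph_edgeSet]
      exact Set.subset_union_right
    rwa [IndepEdges, edgeRank_image κ (glueRight_injective φ),
      Set.ncard_image_of_injective _ (Sym2.map.injective (glueRight_injective φ))] at h
  -- If all ear pairs were edges, the count would be at most |E(H)| = rank(H), whereas it equals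
  -- rank(H) + 1.
  obtain ⟨t, ht, htH⟩ : ∃ t ∈ earPairs 𝒴 L, t ∉ H.edgeSet := by
    by_contra! h
    have h1 := countWith_le_ncard_of_subset (κ := κ) hsg.ear.cover.toIsTwoThinCover
      (T := earPairs 𝒴 L) Finset.subset_union_left h
    have h2 := hsg.ear.rank_eq
    rw [← earPairs, hH] at h2
    omega
  have hmem : Sym2.map (glueRight φ) t ∈ gluedPairs G 𝒳 a b σ τ 𝒴 φ := by
    rw [mem_gluedPairs, map_inl_glueRight]
    exact Or.inr ⟨t, ht, rfl⟩
  refine ⟨_, isImpliedNonedge_of_edgeRank_insert hN (hsg.not_isDiag_of_mem_gluedPairs hmem) ?_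
    (hsg.edgeRank_insert_gluedPair hN hmem)⟩
  rw [glueGraph_edgeSet]
  rintro (⟨f, hf, heq⟩ | ⟨f, hf, heq⟩)
  · obtain ⟨v, hv⟩ := exists_inl_mem_of_mem_edgeSet hf
    have h' : (Sum.inl (Sum.inl v) : GlueVertex (SplitVertex a b) L) ∈
        Sym2.map (glueRight φ) t := by
      rw [← heq]
      exact Sym2.mem_map.2 ⟨_, hv, rfl⟩
    obtain ⟨w, -, hw⟩ := Sym2.mem_map.1 h'
    obtain ⟨hvK, -⟩ := glueRight_eq_inl hw
    rcases mem_newVertices.1 (hsg.gluing_subset hvK) with h | h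
    · exact v.2.1 h
    · exact v.2.2 h
  · exact htH (Sym2.map.injective (glueRight_injective φ) heq ▸ hf)

/-! ### The glued cover and its shared set. -/

theorem mem_glueClusters {𝒵 : Finset (Finset (SplitVertex a b))}
    {Z : Finset (GlueVertex (SplitVertex a b) L)} :
    Z ∈ glueClusters 𝒵 𝒴 φ ↔ (∃ X ∈ 𝒵, X.image Sum.inl = Z) ∨
      ∃ Y ∈ 𝒴, Y.image (glueRight φ) = Z := by
  simp only [glueClusters, Finset.mem_union, Finset.mem_image]

theorem mem_glueCover {𝒵 : Finset (Finset (SplitVertex a b))}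
    {Z : Finset (GlueVertex (SplitVertex a b) L)} :
    Z ∈ glueCover 𝒵 𝒴 φ ↔ Z ∈ glueClusters 𝒵 𝒴 φ ∧
      ∀ Z' ∈ glueClusters 𝒵 𝒴 φ, Z ⊆ Z' → Z' = Z := by
  simp only [glueCover, Finset.mem_filter]

theorem exists_mem_glueCover {𝒵 : Finset (Finset (SplitVertex a b))}
    {Z : Finset (GlueVertex (SplitVertex a b) L)} (hZ : Z ∈ glueClusters 𝒵 𝒴 φ) :
    ∃ Z' ∈ glueCover 𝒵 𝒴 φ, Z ⊆ Z' := by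
  obtain ⟨Z', hss, hZ'⟩ := (glueClusters 𝒵 𝒴 φ).exists_le_maximal hZ
  refine ⟨Z', mem_glueCover.2 ⟨hZ'.prop, fun Y hY h => ?_⟩, hss⟩
  exact le_antisymm (hZ'.le_of_ge hY h) h

/-- A vertex of the split graph that is also a vertex of the ear is a new vertex. -/
theorem IsSafeSplitAndGlue.mem_newVertices_of_eq
    (hsg : IsSafeSplitAndGlue κ G 𝒳 a b σ τ H 𝒴 K L φ) {w : W} {x : SplitVertex a b}
    (h : glueRight φ w = Sum.inl x) : x ∈ newVertices a b :=
  hsg.gluing_subset (glueRight_eq_inl h).1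

/-- Common vertices are copies of `a` or `b`, and a cluster of the split cover has at most one of
each. -/
theorem IsSafeSplitAndGlue.card_inter_le
    (hsg : IsSafeSplitAndGlue κ G 𝒳 a b σ τ H 𝒴 K L φ)
    {X : Finset (SplitVertex a b)} (hX : X ∈ safeSplitCover G 𝒳 a b σ τ) (Y : Finset W) :
    (X.image Sum.inl ∩ Y.image (glueRight φ)).card ≤ 2 := by
  have hsub : ∀ z ∈ X.image Sum.inl ∩ Y.image (glueRight φ), ∃ x ∈ X, z = Sum.inl x ∧
      (splitProj x = a ∨ splitProj x = b) := by
    intro z hz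
    rw [Finset.mem_inter, Finset.mem_image, Finset.mem_image] at hz
    obtain ⟨⟨x, hx, rfl⟩, w, -, hw⟩ := hz
    exact ⟨x, hx, rfl, mem_newVertices.1 (hsg.mem_newVertices_of_eq hw)⟩
  refine (Finset.card_le_card_of_injOn (t := {a, b})
    (fun z => glueProj (Sum.inl z : PhantomGlueVertex a b L)) ?_ ?_).trans Finset.card_le_two
  · intro z hz
    obtain ⟨x, -, rfl, hx⟩ := hsub z hz
    exact Finset.mem_coe.2 (by rw [Finset.mem_insert, Finset.mem_singleton]; exact hx)
  · intro z hz z' hz' h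
    obtain ⟨x, hx, rfl, -⟩ := hsub z hz
    obtain ⟨y, hy, rfl, -⟩ := hsub z' hz'
    rw [eq_of_splitProj_eq hsg.ne (noTwins_of_mem_safeSplitCover hX) hx hy h]

theorem IsSafeSplitAndGlue.isTwoThinCover
    (hsg : IsSafeSplitAndGlue κ G 𝒳 a b σ τ H 𝒴 K L φ) :
    IsTwoThinCover (glueGraph (splitGraph G a b σ τ) H φ)
      (glueCover (safeSplitCover G 𝒳 a b σ τ) 𝒴 φ) where
  two_le_card := by
    intro Z hZ
    rcases mem_glueClusters.1 (mem_glueCover.1 hZ).1 with ⟨X, hX, rfl⟩ | ⟨Y, hY, rfl⟩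
    · rw [Finset.card_image_of_injective _ Sum.inl_injective]
      exact two_le_card_of_mem_safeSplitCover hX
    · rw [Finset.card_image_of_injective _ (glueRight_injective φ)]
      exact hsg.ear.cover.two_le_card Y hY
  card_inter_le := by
    intro Z hZ Z' hZ' hne
    rcases mem_glueClusters.1 (mem_glueCover.1 hZ).1 with ⟨X, hX, rfl⟩ | ⟨Y, hY, rfl⟩ <;>
      rcases mem_glueClusters.1 (mem_glueCover.1 hZ').1 with ⟨X', hX', rfl⟩ | ⟨Y', hY', rfl⟩
    · rw [← Finset.image_inter _ _ Sum.inl_injective,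
        Finset.card_image_of_injective _ Sum.inl_injective]
      exact card_inter_le_of_mem_safeSplitCover hsg.ne hsg.base.cover.toIsTwoThinCover hX hX'
        fun h => hne (h ▸ rfl)
    · exact hsg.card_inter_le hX Y'
    · rw [Finset.inter_comm]
      exact hsg.card_inter_le hX' Y
    · rw [← Finset.image_inter _ _ (glueRight_injective φ),
        Finset.card_image_of_injective _ (glueRight_injective φ)]
      exact hsg.ear.cover.card_inter_le Y hY Y' hY' fun h => hne (h ▸ rfl)
  not_subset := by
    intro Z hZ Z' hZ' hne hss
    exact hne ((mem_glueCover.1 hZ).2 Z' (mem_glueCover.1 hZ').1 hss).symm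
  covers := by
    intro u v huv
    have key : ∃ Z ∈ glueClusters (safeSplitCover G 𝒳 a b σ τ) 𝒴 φ, ∀ x ∈ s(u, v), x ∈ Z := by
      have h : s(u, v) ∈ (glueGraph (splitGraph G a b σ τ) H φ).edgeSet := huv
      rw [glueGraph_edgeSet] at h
      rcases h with ⟨f, hf, heq⟩ | ⟨f, hf, heq⟩ <;> rw [← heq] <;>
        induction f using Sym2.ind with
        | _ x y => ?_
      · obtain ⟨Z, hZ, hx, hy⟩ := exists_mem_safeSplitCover (𝒳 := 𝒳) hf
        refine ⟨_, mem_glueClusters.2 (Or.inl ⟨Z, hZ, rfl⟩), ?_⟩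
        simp only [Sym2.map_mk, Sym2.mem_iff, forall_eq_or_imp, forall_eq]
        exact ⟨Finset.mem_image_of_mem _ hx, Finset.mem_image_of_mem _ hy⟩
      · obtain ⟨Y, hY, hx, hy⟩ := hsg.ear.cover.covers x y hf
        refine ⟨_, mem_glueClusters.2 (Or.inr ⟨Y, hY, rfl⟩), ?_⟩
        simp only [Sym2.map_mk, Sym2.mem_iff, forall_eq_or_imp, forall_eq]
        exact ⟨Finset.mem_image_of_mem _ hx, Finset.mem_image_of_mem _ hy⟩
    obtain ⟨Z, hZ, huvZ⟩ := key
    obtain ⟨Z', hZ', hss⟩ := exists_mem_glueCover hZ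
    exact ⟨Z', hZ', hss (huvZ u (Sym2.mem_mk_left _ _)), hss (huvZ v (Sym2.mem_mk_right _ _))⟩

/-- Two common vertices are new and share a cluster of the split cover, so they form a key gluing
pair. -/
theorem IsSafeSplitAndGlue.mem_gluedPairs_of_mem_inter
    (hsg : IsSafeSplitAndGlue κ G 𝒳 a b σ τ H 𝒴 K L φ)
    {X : Finset (SplitVertex a b)} (hX : X ∈ safeSplitCover G 𝒳 a b σ τ) {Y : Finset W}
    {u v : GlueVertex (SplitVertex a b) L} (huv : u ≠ v)
    (hu : u ∈ X.image Sum.inl ∩ Y.image (glueRight φ))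
    (hv : v ∈ X.image Sum.inl ∩ Y.image (glueRight φ)) :
    s(u, v) ∈ gluedPairs G 𝒳 a b σ τ 𝒴 φ := by
  simp only [Finset.mem_inter, Finset.mem_image] at hu hv
  obtain ⟨⟨x, hx, rfl⟩, w, -, hw⟩ := hu
  obtain ⟨⟨y, hy, rfl⟩, w', -, hw'⟩ := hv
  obtain ⟨e, he, heq⟩ := hsg.mem_gluedEarPairs_of_key hX hx hy (fun h => huv (h ▸ rfl))
    (hsg.mem_newVertices_of_eq hw) (hsg.mem_newVertices_of_eq hw')
  rw [mem_gluedPairs, ← heq, map_inl_glueRight]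
  exact Or.inr ⟨e, Finset.mem_union_right _ he, rfl⟩

/-- The shared set of the glued cover consists of lifted pairs and pairs of the ear. -/
theorem IsSafeSplitAndGlue.sharedSet_subset
    (hsg : IsSafeSplitAndGlue κ G 𝒳 a b σ τ H 𝒴 K L φ) :
    sharedSet (glueCover (safeSplitCover G 𝒳 a b σ τ) 𝒴 φ) ⊆ gluedPairs G 𝒳 a b σ τ 𝒴 φ := by
  intro e he
  simp only [sharedSet, Finset.mem_filter, Finset.mem_univ, true_and] at he
  obtain ⟨u, v, huv, rfl, Z, hZ, Z', hZ', hne, hint⟩ := he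
  have hu : u ∈ Z ∩ Z' := by
    rw [hint]
    simp
  have hv : v ∈ Z ∩ Z' := by
    rw [hint]
    simp
  clear hint
  rcases mem_glueClusters.1 (mem_glueCover.1 hZ).1 with ⟨X, hX, rfl⟩ | ⟨Y, hY, rfl⟩ <;>
    rcases mem_glueClusters.1 (mem_glueCover.1 hZ').1 with ⟨X', hX', rfl⟩ | ⟨Y', hY', rfl⟩
  · rw [← Finset.image_inter _ _ Sum.inl_injective, Finset.mem_image] at hu hv
    obtain ⟨x, hx, rfl⟩ := hu
    obtain ⟨y, hy, rfl⟩ := hv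
    have hxy : x ≠ y := fun h => huv (h ▸ rfl)
    obtain ⟨C, hC, D, hD, hCD, rfl, rfl⟩ := exists_clusters_of_mem_inter hX hX'
      (fun h => hne (h ▸ rfl)) hxy hx hy
    rw [Finset.mem_inter] at hx hy
    have ht := noTwins_of_mem_safeSplitCover hX
    have hπ : splitProj x ≠ splitProj y := fun h => hxy (eq_of_splitProj_eq hsg.ne ht hx.1 hy.1 h)
    have hmem : s(splitProj x, splitProj y) ∈ sharedSet 𝒳 :=
      mem_sharedSet_of_subset hsg.base.cover.toIsTwoThinCover hC hD hCD hπ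
        (by simp [splitProj_mem_of_mem_splitCluster hx.1, splitProj_mem_of_mem_splitCluster hy.1])
        (by simp [splitProj_mem_of_mem_splitCluster hx.2, splitProj_mem_of_mem_splitCluster hy.2])
    -- A shared pair over `ab` is a key gluing pair and comes from the ear; any other is a lifted
    -- pair.
    by_cases heq : s(splitProj x, splitProj y) = s(a, b)
    · have hnew : x ∈ newVertices a b ∧ y ∈ newVertices a b := by
        rw [mem_newVertices, mem_newVertices]
        rcases Sym2.eq_iff.1 heq with ⟨h1, h2⟩ | ⟨h1, h2⟩ <;> simp [h1, h2]
      obtain ⟨e, he, heq⟩ := hsg.mem_gluedEarPairs_of_key hX hx.1 hy.1 hxy hnew.1 hnew.2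
      rw [mem_gluedPairs, ← heq, map_inl_glueRight]
      exact Or.inr ⟨e, Finset.mem_union_right _ he, rfl⟩
    · rw [mem_gluedPairs]
      refine Or.inl ⟨_, Or.inl ⟨C, hC, ht, _, hmem, heq, by
        simp [splitProj_mem_of_mem_splitCluster hx.1, splitProj_mem_of_mem_splitCluster hy.1],
        rfl⟩, ?_⟩
      rw [Sym2.map_mk, clusterLift_splitProj hsg.ne ht hx.1, clusterLift_splitProj hsg.ne ht hy.1]
      rfl
  · exact hsg.mem_gluedPairs_of_mem_inter hX huv hu hv
  · rw [Finset.inter_comm] at hu hv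
    exact hsg.mem_gluedPairs_of_mem_inter hX' huv hu hv
  · rw [← Finset.image_inter _ _ (glueRight_injective φ), Finset.mem_image] at hu hv
    obtain ⟨x, hx, rfl⟩ := hu
    obtain ⟨y, hy, rfl⟩ := hv
    rw [Finset.mem_inter] at hx hy
    have hmem : s(x, y) ∈ sharedSet 𝒴 :=
      mem_sharedSet_of_subset hsg.ear.cover.toIsTwoThinCover hY hY' (fun h => hne (h ▸ rfl))
        (fun h => huv (congrArg (glueRight φ) h)) (by simp [hx.1, hy.1]) (by simp [hx.2, hy.2])
    rw [mem_gluedPairs]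
    exact Or.inr ⟨_, Finset.mem_union_left _ hmem, rfl⟩

/-! ### Cluster excesses and the rank formula. -/

/-- The contribution of a cluster to the count with respect to the lifted pairs and the pairs of the
ear. -/
noncomputable def clusterExcess (κ : RigidityModel) (G : SimpleGraph V) (𝒳 : Finset (Finset V))
    (a b : V) (σ τ : V → Fin 2) (H : SimpleGraph W) (𝒴 : Finset (Finset W))
    {K : Finset (SplitVertex a b)} {L : Finset W} (φ : K ≃ L)
    (Z : Finset (GlueVertex (SplitVertex a b) L)) : ℤ :=
  (edgeRank κ (inducedEdges (glueGraph (splitGraph G a b σ τ) H φ)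
    (gluedPairs G 𝒳 a b σ τ 𝒴 φ) Z) : ℤ) - (pairsIn (gluedPairs G 𝒳 a b σ τ 𝒴 φ) Z).ncard

theorem IsSafeSplitAndGlue.clusterExcess_nonneg
    (hsg : IsSafeSplitAndGlue κ G 𝒳 a b σ τ H 𝒴 K L φ)
    (hN : IndepEdges κ (glueGraph (splitGraph G a b σ τ) H φ).edgeSet)
    (Z : Finset (GlueVertex (SplitVertex a b) L)) :
    0 ≤ clusterExcess κ G 𝒳 a b σ τ H 𝒴 φ Z := by
  have h1 : edgeRank κ (pairsIn (gluedPairs G 𝒳 a b σ τ 𝒴 φ) Z) = _ :=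
    (hsg.indep_gluedPairs hN).subset (pairsIn_subset _ Z)
  have h2 := edgeRank_mono κ (pairsIn_subset_inducedEdges
    (glueGraph (splitGraph G a b σ τ) H φ) (gluedPairs G 𝒳 a b σ τ 𝒴 φ) Z)
  rw [clusterExcess]
  omega

theorem IsSafeSplitAndGlue.not_isDiag_of_mem_inducedEdges
    (hsg : IsSafeSplitAndGlue κ G 𝒳 a b σ τ H 𝒴 K L φ)
    {Z : Finset (GlueVertex (SplitVertex a b) L)} {e : Sym2 (GlueVertex (SplitVertex a b) L)}
    (he : e ∈ inducedEdges (glueGraph (splitGraph G a b σ τ) H φ)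
      (gluedPairs G 𝒳 a b σ τ 𝒴 φ) Z) : ¬ e.IsDiag := by
  rcases he.1 with he | he
  · exact SimpleGraph.not_isDiag_of_mem_edgeSet _ he
  · exact hsg.not_isDiag_of_mem_gluedPairs he

/-- The excess of the endpoints of an edge. -/
theorem IsSafeSplitAndGlue.clusterExcess_pair_le
    (hsg : IsSafeSplitAndGlue κ G 𝒳 a b σ τ H 𝒴 K L φ) (u v : GlueVertex (SplitVertex a b) L) :
    clusterExcess κ G 𝒳 a b σ τ H 𝒴 φ {u, v} ≤ 1 ∧
      (s(u, v) ∈ gluedPairs G 𝒳 a b σ τ 𝒴 φ →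
        clusterExcess κ G 𝒳 a b σ τ H 𝒴 φ {u, v} ≤ 0) := by
  have h1 : inducedEdges (glueGraph (splitGraph G a b σ τ) H φ)
      (gluedPairs G 𝒳 a b σ τ 𝒴 φ) {u, v} ⊆ {s(u, v)} := by
    intro e he
    have hd := hsg.not_isDiag_of_mem_inducedEdges he
    have h := he.2
    induction e using Sym2.ind with
    | _ x y =>
      have hxy : x ≠ y := hd
      simp only [Finset.mem_insert, Finset.mem_singleton, Sym2.mem_iff, forall_eq_or_imp,
        forall_eq] at h
      obtain ⟨rfl | rfl, rfl | rfl⟩ := h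
      · exact absurd rfl hxy
      · rfl
      · exact Sym2.eq_swap
      · exact absurd rfl hxy
  have h2 := edgeRank_mono κ h1
  have h3 := edgeRank_le_ncard κ ({s(u, v)} : Set (Sym2 (GlueVertex (SplitVertex a b) L)))
  rw [Set.ncard_singleton] at h3
  rw [clusterExcess]
  refine ⟨by omega, fun hmem => ?_⟩
  have h4 : 0 < (pairsIn (gluedPairs G 𝒳 a b σ τ 𝒴 φ) {u, v}).ncard :=
    (Set.ncard_pos (Set.toFinite _)).2 ⟨s(u, v), hmem, by simp⟩
  omega

/-- The excess of a cluster of the ear. -/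
theorem IsSafeSplitAndGlue.clusterExcess_right_le
    (hsg : IsSafeSplitAndGlue κ G 𝒳 a b σ τ H 𝒴 K L φ) (Y : Finset W) :
    clusterExcess κ G 𝒳 a b σ τ H 𝒴 φ (Y.image (glueRight φ)) ≤
      (edgeRank κ (inducedEdges H (earPairs 𝒴 L) Y) : ℤ) - (pairsIn (earPairs 𝒴 L) Y).ncard := by
  have hinj := glueRight_injective φ
  have hmapY : ∀ f : Sym2 W, (∀ x ∈ Sym2.map (glueRight φ) f, x ∈ Y.image (glueRight φ)) ↔
      ∀ w ∈ f, w ∈ Y := by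
    intro f
    simp only [Sym2.mem_map, forall_exists_index, and_imp, forall_apply_eq_imp_iff₂]
    exact forall₂_congr fun w _ => hinj.mem_finset_image
  have hnew : ∀ {x : SplitVertex a b}, (Sum.inl x : GlueVertex (SplitVertex a b) L) ∈
      Y.image (glueRight φ) → splitProj x = a ∨ splitProj x = b := by
    intro x hx
    obtain ⟨w, -, hw⟩ := Finset.mem_image.1 hx
    exact mem_newVertices.1 (hsg.mem_newVertices_of_eq hw)
  -- Split edges and lifted pairs have an old end, which lies in no ear cluster, so only ear edges
  -- and ear pairs remain.
  have h1 : inducedEdges (glueGraph (splitGraph G a b σ τ) H φ) (gluedPairs G 𝒳 a b σ τ 𝒴 φ)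
      (Y.image (glueRight φ)) ⊆ Sym2.map (glueRight φ) '' inducedEdges H (earPairs 𝒴 L) Y := by
    rintro e ⟨he, heY⟩
    rcases he with he | he
    · rw [glueGraph_edgeSet] at he
      rcases he with ⟨f, hf, rfl⟩ | ⟨f, hf, rfl⟩
      · obtain ⟨v, hv⟩ := exists_inl_mem_of_mem_edgeSet hf
        rcases hnew (heY _ (Sym2.mem_map.2 ⟨_, hv, rfl⟩)) with h | h
        · exact absurd h v.2.1
        · exact absurd h v.2.2
      · exact ⟨f, ⟨Or.inl hf, (hmapY f).1 heY⟩, rfl⟩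
    · rcases mem_gluedPairs.1 he with ⟨f, hf, heq⟩ | ⟨f, hf, heq⟩
      · obtain ⟨z, v, rfl⟩ := exists_eq_of_mem_liftedPairs hsg.base.safe.nonedge hf
        have hv : (Sum.inl (Sum.inl (Sum.inl v)) : PhantomGlueVertex a b L) ∈
            Sym2.map Sum.inl e := by
          rw [← heq]
          exact Sym2.mem_mk_right _ _
        obtain ⟨x, hx, hxv⟩ := Sym2.mem_map.1 hv
        rw [Sum.inl_injective hxv] at hx
        rcases hnew (heY _ hx) with h | h
        · exact absurd h v.2.1
        · exact absurd h v.2.2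
      · rw [← map_inl_glueRight] at heq
        have := Sym2.map.injective Sum.inl_injective heq
        subst this
        exact ⟨f, ⟨Or.inr hf, (hmapY f).1 heY⟩, rfl⟩
  have h2 : Sym2.map (glueRight φ) '' pairsIn (earPairs 𝒴 L) Y ⊆
      pairsIn (gluedPairs G 𝒳 a b σ τ 𝒴 φ) (Y.image (glueRight φ)) := by
    rintro _ ⟨f, hf, rfl⟩
    refine ⟨?_, (hmapY f).2 hf.2⟩
    rw [mem_gluedPairs, map_inl_glueRight]
    exact Or.inr ⟨f, hf.1, rfl⟩
  have h3 := edgeRank_mono κ h1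
  have h4 := Set.ncard_le_ncard h2 (Set.toFinite _)
  rw [edgeRank_image κ hinj] at h3
  rw [Set.ncard_image_of_injective _ (Sym2.map.injective hinj)] at h4
  rw [clusterExcess]
  omega

theorem exists_map_inl_eq_of_subset {α β : Type*} [DecidableEq α] [DecidableEq β]
    {e : Sym2 (α ⊕ β)} {Z : Finset α} (h : ∀ z ∈ e, z ∈ Z.image Sum.inl) :
    ∃ f : Sym2 α, Sym2.map Sum.inl f = e ∧ ∀ x ∈ f, x ∈ Z := by
  obtain ⟨f, rfl⟩ := exists_map_inl_eq (e := e) fun k hk => by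
    obtain ⟨x, -, hx⟩ := Finset.mem_image.1 (h _ hk)
    exact Sum.inl_ne_inr hx
  exact ⟨f, rfl, fun x hx =>
    Sum.inl_injective.mem_finset_image.1 (h _ (Sym2.mem_map.2 ⟨x, hx, rfl⟩))⟩

theorem map_splitProj_eq_of_new (hab : a ≠ b) {Z : Finset (SplitVertex a b)} (hZ : NoTwins Z)
    {f : Sym2 (SplitVertex a b)} (hf : ∀ x ∈ f, x ∈ Z) (hd : ¬ f.IsDiag)
    (hnew : ∀ x ∈ f, splitProj x = a ∨ splitProj x = b) : Sym2.map splitProj f = s(a, b) := by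
  induction f using Sym2.ind with
  | _ x y =>
    have hxy : x ≠ y := hd
    simp only [Sym2.mem_iff, forall_eq_or_imp, forall_eq] at hf hnew
    have hne : splitProj x ≠ splitProj y := fun h => hxy (eq_of_splitProj_eq hab hZ hf.1 hf.2 h)
    rw [Sym2.map_mk]
    rcases hnew with ⟨hx | hx, hy | hy⟩
    · exact absurd (hx.trans hy.symm) hne
    · rw [hx, hy]
    · rw [hx, hy, Sym2.eq_swap]
    · exact absurd (hx.trans hy.symm) hne

theorem map_inl_inl_eq_map_glueLift (hab : a ≠ b) {X : Finset V}
    (ht : NoTwins (splitCluster G a b σ τ X)) {f : Sym2 (SplitVertex a b)}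
    (hf : ∀ x ∈ f, x ∈ splitCluster G a b σ τ X) :
    (Sym2.map Sum.inl (Sym2.map Sum.inl f : Sym2 (GlueVertex (SplitVertex a b) L)) :
      Sym2 (PhantomGlueVertex a b L)) =
      Sym2.map (glueLift G a b σ τ L X) (Sym2.map splitProj f) := by
  rw [map_glueLift, map_clusterLift_of_mem_edgeSet hab ht hf, map_inl_inl]

/-- The pairs of the glued graph in a cluster without twins come from the original cluster. -/
theorem IsSafeSplitAndGlue.image_inducedEdges_subset
    (hsg : IsSafeSplitAndGlue κ G 𝒳 a b σ τ H 𝒴 K L φ) {X : Finset V}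
    (ht : NoTwins (splitCluster G a b σ τ X)) :
    Sym2.map Sum.inl '' inducedEdges (glueGraph (splitGraph G a b σ τ) H φ)
        (gluedPairs G 𝒳 a b σ τ 𝒴 φ) ((splitCluster G a b σ τ X).image Sum.inl) ⊆
      Sym2.map (glueLift G a b σ τ L X) '' inducedEdges G (sharedSet 𝒳) X := by
  rintro _ ⟨e, he, rfl⟩
  have hd := hsg.not_isDiag_of_mem_inducedEdges he
  obtain ⟨f, rfl, hf⟩ := exists_map_inl_eq_of_subset he.2
  rw [Sym2.isDiag_map Sum.inl_injective] at hd
  refine ⟨Sym2.map splitProj f, ⟨?_, ?_⟩, (map_inl_inl_eq_map_glueLift hsg.ne ht hf).symm⟩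
  · have hright : ∀ h : Sym2 W, Sym2.map (glueRight φ) h = Sym2.map Sum.inl f →
        Sym2.map splitProj f ∈ sharedSet 𝒳 := by
      intro h heq
      rw [map_splitProj_eq_of_new hsg.ne ht hf hd]
      · exact hsg.base.safe.mem_shared
      · intro x hx
        have hx' : (Sum.inl x : GlueVertex (SplitVertex a b) L) ∈ Sym2.map (glueRight φ) h := by
          rw [heq]
          exact Sym2.mem_map.2 ⟨x, hx, rfl⟩
        obtain ⟨w, -, hw⟩ := Sym2.mem_map.1 hx'
        exact mem_newVertices.1 (hsg.mem_newVertices_of_eq hw)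
    rcases he.1 with he | he
    · rw [glueGraph_edgeSet] at he
      rcases he with ⟨f', hf', heq⟩ | ⟨h, -, heq⟩
      · rw [← Sym2.map.injective Sum.inl_injective heq]
        exact Or.inl (map_splitProj_mem_edgeSet hf')
      · exact Or.inr (hright h heq)
    · rcases mem_gluedPairs.1 he with ⟨g, hg, heq⟩ | ⟨h, -, heq⟩
      · have h1 := (map_phantomProj_mem_of_mem_liftedPairs hsg.base.safe.nonedge hg).1
        rw [← map_glueProj_leftMap (L := L), heq, Sym2.map_map, Sym2.map_map] at h1
        exact Or.inr h1
      · rw [← map_inl_glueRight] at heq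
        exact Or.inr (hright h (Sym2.map.injective Sum.inl_injective heq))
  · intro v hv
    obtain ⟨x, hx, rfl⟩ := Sym2.mem_map.1 hv
    exact splitProj_mem_of_mem_splitCluster (hf x hx)

/-- A pair of the shared set whose lift contains no phantom gives a pair of the glued graph. -/
theorem IsSafeSplitAndGlue.map_glueLift_mem_image
    (hsg : IsSafeSplitAndGlue κ G 𝒳 a b σ τ H 𝒴 K L φ) {X : Finset V} (hX : X ∈ 𝒳)
    (ht : NoTwins (splitCluster G a b σ τ X)) {f : Sym2 V} (hf : f ∈ pairsIn (sharedSet 𝒳) X)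
    (hinr : ∀ k : Fin 2, Sum.inr k ∉ Sym2.map (glueLift G a b σ τ L X) f) :
    Sym2.map (glueLift G a b σ τ L X) f ∈
      Sym2.map Sum.inl '' pairsIn (gluedPairs G 𝒳 a b σ τ 𝒴 φ)
        ((splitCluster G a b σ τ X).image Sum.inl) := by
  obtain ⟨g, hg⟩ := exists_map_inl_eq hinr
  refine ⟨g, ⟨?_, ?_⟩, hg⟩
  · rw [mem_gluedPairs, hg]
    rcases map_glueLift_mem (L := L) hX ht hf.1 hf.2 with h | h
    · exact Or.inl h
    · rcases hsg.liftsOfPair_cases h with h | ⟨k, h⟩ | h | ⟨k, h⟩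
      · exact Or.inr h
      · exact absurd (h ▸ Sym2.mem_mk_left _ _) (hinr 0)
      · exact absurd (h ▸ Sym2.mem_mk_left _ _) (hinr 0)
      · exact absurd (h ▸ Sym2.mem_mk_left _ _) (hinr 1)
  · intro z hz
    have hz' : (Sum.inl z : PhantomGlueVertex a b L) ∈ Sym2.map (glueLift G a b σ τ L X) f := by
      rw [← hg]
      exact Sym2.mem_map.2 ⟨z, hz, rfl⟩
    obtain ⟨v, hv, hvz⟩ := Sym2.mem_map.1 hz'
    rw [glueLift] at hvz
    rcases clusterLift_cases (G := G) (a := a) (b := b) (σ := σ) (τ := τ) (hf.2 v hv) with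
      ⟨x, hx, -, hl⟩ | ⟨-, ⟨-, hl⟩ | ⟨-, hl⟩⟩
    · rw [hl] at hvz
      exact Finset.mem_image.2 ⟨x, hx, Sum.inl_injective hvz⟩
    · rw [hl] at hvz
      exact absurd hvz Sum.inr_ne_inl
    · rw [hl] at hvz
      exact absurd hvz Sum.inr_ne_inl

/-- If the copy of `c` in a cluster without twins is a phantom, then `ab` is the only pair at `c` in
this cluster. -/
theorem IsSafeSplitAndGlue.eq_of_glueLift_eq_inr
    (hsg : IsSafeSplitAndGlue κ G 𝒳 a b σ τ H 𝒴 K L φ)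
    (hN : IndepEdges κ (glueGraph (splitGraph G a b σ τ) H φ).edgeSet)
    {X : Finset V} (hX : X ∈ 𝒳) (ht : NoTwins (splitCluster G a b σ τ X)) {c : V} {k : Fin 2}
    (hc : glueLift G a b σ τ L X c = Sum.inr k) {e : Sym2 V}
    (he : e ∈ inducedEdges G (sharedSet 𝒳) X) (hce : c ∈ e) : e = s(a, b) := by
  rcases he.1 with heG | heS
  · exfalso
    obtain ⟨g, hg, rfl⟩ := exists_splitGraph_edge (σ := σ) (τ := τ) hsg.base.safe.nonedge heG
    obtain ⟨x, hx, rfl⟩ := Sym2.mem_map.1 hce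
    rw [glueLift, clusterLift_splitProj hsg.ne ht (mem_splitCluster_of_mem_edge hg he.2 x hx)] at hc
    exact Sum.inl_ne_inr hc
  -- Any shared pair at `c` other than `ab` would lift to a pair containing a phantom, which
  -- independence of the glued graph excludes.
  · by_contra hne
    refine hsg.inr_notMem_of_mem_gluedLiftedPairs hN
      ⟨_, Or.inl ⟨X, hX, ht, e, heS, hne, he.2, rfl⟩, rfl⟩ k ?_
    rw [← map_glueLift]
    exact Sym2.mem_map.2 ⟨c, hce, hc⟩

/-- The excess of a split cluster without twins. -/
theorem IsSafeSplitAndGlue.clusterExcess_left_le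
    (hsg : IsSafeSplitAndGlue κ G 𝒳 a b σ τ H 𝒴 K L φ)
    (hN : IndepEdges κ (glueGraph (splitGraph G a b σ τ) H φ).edgeSet)
    {X : Finset V} (hX : X ∈ 𝒳) (ht : NoTwins (splitCluster G a b σ τ X)) :
    clusterExcess κ G 𝒳 a b σ τ H 𝒴 φ ((splitCluster G a b σ τ X).image Sum.inl) ≤
      (edgeRank κ (inducedEdges G (sharedSet 𝒳) X) : ℤ) - (pairsIn (sharedSet 𝒳) X).ncard := by
  have hinj := glueLift_injective (G := G) (a := a) (b := b) (σ := σ) (τ := τ) (L := L) X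
  have hsub := hsg.image_inducedEdges_subset (H := H) (φ := φ) ht
  rw [clusterExcess]
  by_cases hph : ∃ f ∈ pairsIn (sharedSet 𝒳) X, ∃ k : Fin 2,
      Sum.inr k ∈ Sym2.map (glueLift G a b σ τ L X) f
  · obtain ⟨f, hf, k, hk⟩ := hph
    obtain ⟨c, hcf, hc⟩ := Sym2.mem_map.1 hk
    have hfab := hsg.eq_of_glueLift_eq_inr hN hX ht hc (pairsIn_subset_inducedEdges G _ _ hf) hcf
    rw [hfab] at hf hcf hk
    have h1 : Sym2.map Sum.inl '' inducedEdges (glueGraph (splitGraph G a b σ τ) H φ)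
        (gluedPairs G 𝒳 a b σ τ 𝒴 φ) ((splitCluster G a b σ τ X).image Sum.inl) ⊆
        Sym2.map (glueLift G a b σ τ L X) '' (inducedEdges G (sharedSet 𝒳) X \ {s(a, b)}) := by
      rintro _ ⟨e, he, rfl⟩
      obtain ⟨g, hg, heq⟩ := hsub ⟨e, he, rfl⟩
      refine ⟨g, ⟨hg, ?_⟩, heq⟩
      rintro rfl
      rw [heq] at hk
      exact inr_notMem_map_inl e k hk
    have h2 : Sym2.map (glueLift G a b σ τ L X) '' (pairsIn (sharedSet 𝒳) X \ {s(a, b)}) ⊆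
        Sym2.map Sum.inl '' pairsIn (gluedPairs G 𝒳 a b σ τ 𝒴 φ)
          ((splitCluster G a b σ τ X).image Sum.inl) := by
      rintro _ ⟨g, ⟨hg, hne⟩, rfl⟩
      refine hsg.map_glueLift_mem_image hX ht hg fun l hl => hne ?_
      obtain ⟨d, hd, hdl⟩ := Sym2.mem_map.1 hl
      exact hsg.eq_of_glueLift_eq_inr hN hX ht hdl (pairsIn_subset_inducedEdges G _ _ hg) hd
    -- Here `ab` is the only pair at `c`, so deleting it lowers the rank by exactly one. The number
    -- of shared pairs also drops by one, and the excess is unchanged.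
    have h3 := edgeRank_union_star (κ := κ) (x := c)
      (E := inducedEdges G (sharedSet 𝒳) X \ {s(a, b)}) (D := {s(a, b)})
      (fun e he hce => he.2 (hsg.eq_of_glueLift_eq_inr hN hX ht hc he.1 hce))
      (by
        rintro e rfl
        exact ⟨hcf, hsg.ne⟩) (by simp)
    rw [Set.sdiff_union_self, Set.union_eq_self_of_subset_right (Set.singleton_subset_iff.2
      (pairsIn_subset_inducedEdges G _ _ hf)), Set.ncard_singleton] at h3
    have h4 := edgeRank_mono κ h1
    rw [edgeRank_image κ Sum.inl_injective, edgeRank_image κ hinj] at h4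
    have h5 := Set.ncard_le_ncard h2 (Set.toFinite _)
    rw [Set.ncard_image_of_injective _ (Sym2.map.injective Sum.inl_injective),
      Set.ncard_image_of_injective _ (Sym2.map.injective hinj)] at h5
    have h6 := Set.ncard_sdiff_singleton_add_one hf (Set.toFinite _)
    omega
  · push Not at hph
    have h2 : Sym2.map (glueLift G a b σ τ L X) '' pairsIn (sharedSet 𝒳) X ⊆
        Sym2.map Sum.inl '' pairsIn (gluedPairs G 𝒳 a b σ τ 𝒴 φ)
          ((splitCluster G a b σ τ X).image Sum.inl) := by
      rintro _ ⟨g, hg, rfl⟩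
      exact hsg.map_glueLift_mem_image hX ht hg (hph g hg)
    have h4 := edgeRank_mono κ hsub
    rw [edgeRank_image κ Sum.inl_injective, edgeRank_image κ hinj] at h4
    have h5 := Set.ncard_le_ncard h2 (Set.toFinite _)
    rw [Set.ncard_image_of_injective _ (Sym2.map.injective Sum.inl_injective),
      Set.ncard_image_of_injective _ (Sym2.map.injective hinj)] at h5
    omega

/-- The contribution of the clusters of the split graph and of the ear to the count. -/
theorem IsSafeSplitAndGlue.sum_clusterExcess_le
    (hsg : IsSafeSplitAndGlue κ G 𝒳 a b σ τ H 𝒴 K L φ)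
    (hN : IndepEdges κ (glueGraph (splitGraph G a b σ τ) H φ).edgeSet) :
    ∑ Z ∈ glueCover (safeSplitCover G 𝒳 a b σ τ) 𝒴 φ, clusterExcess κ G 𝒳 a b σ τ H 𝒴 φ Z ≤
      ∑ X ∈ 𝒳, ((edgeRank κ (inducedEdges G (sharedSet 𝒳) X) : ℤ) -
        (pairsIn (sharedSet 𝒳) X).ncard) +
      ∑ Y ∈ 𝒴, ((edgeRank κ (inducedEdges H (earPairs 𝒴 L) Y) : ℤ) -
        (pairsIn (earPairs 𝒴 L) Y).ncard) := by
  classical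
  let F : Finset V → Finset (Sym2 (SplitVertex a b)) := fun X =>
    (Set.toFinite {f | f ∈ (splitGraph G a b σ τ).edgeSet ∧
      (∀ v ∈ Sym2.map splitProj f, v ∈ X) ∧ Sym2.map splitProj f ∉ sharedSet 𝒳}).toFinset
  have hF : ∀ X f, f ∈ F X ↔ f ∈ (splitGraph G a b σ τ).edgeSet ∧
      (∀ v ∈ Sym2.map splitProj f, v ∈ X) ∧ Sym2.map splitProj f ∉ sharedSet 𝒳 := by
    intro X f
    simp only [F, Set.Finite.mem_toFinset, Set.mem_ofPred_eq]
  -- Each original cluster is made responsible for glued clusters: its own image, or in the case of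
  -- twins the endpoint sets of its edges over unshared pairs. Nonnegativity of the excess makes
  -- repetitions harmless.
  let t : Finset V ⊕ Finset W → Finset (Finset (GlueVertex (SplitVertex a b) L)) :=
    Sum.elim (fun X =>
      if NoTwins (splitCluster G a b σ τ X) then {(splitCluster G a b σ τ X).image Sum.inl}
      else (F X).image fun f => f.toFinset.image Sum.inl)
      fun Y => {Y.image (glueRight φ)}
  have hpair : ∀ x y : SplitVertex a b, (Sym2.toFinset s(x, y)).image Sum.inl =
      ({Sum.inl x, Sum.inl y} : Finset (GlueVertex (SplitVertex a b) L)) := by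
    intro x y
    rw [Sym2.toFinset_mk_eq, Finset.image_insert, Finset.image_singleton]
  -- Endpoint sets of edges over shared pairs have excess zero and need not be assigned, so only
  -- nonzero terms are kept.
  rw [← Finset.sum_filter_ne_zero]
  refine (sum_le_sum_sum_of_subset_biUnion (𝒳.disjSum 𝒴) t _ _ ?_
    fun _ _ Z _ => hsg.clusterExcess_nonneg hN Z).trans ?_
  · intro Z hZ
    obtain ⟨hZ, hne⟩ := Finset.mem_filter.1 hZ
    rw [Finset.mem_biUnion]
    rcases mem_glueClusters.1 (mem_glueCover.1 hZ).1 with ⟨C, hC, rfl⟩ | ⟨Y, hY, rfl⟩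
    · rcases mem_safeSplitCover.1 hC with h | ⟨⟨x, y, hxy, rfl⟩, hbig⟩
      · obtain ⟨X, hX, rfl, -, ht⟩ := mem_bigSplitClusters.1 h
        refine ⟨Sum.inl X, Finset.inl_mem_disjSum.2 hX, ?_⟩
        simp only [t, Sum.elim_inl, if_pos ht, Finset.mem_singleton]
      · obtain ⟨X, hX, hx, hy⟩ := hsg.base.cover.covers _ _ (splitGraph_adj_proj hxy)
        have hxX := mem_splitCluster_of_adj hxy hx hy
        have hyX := mem_splitCluster_of_adj hxy.symm hy hx
        have hsub : ({x, y} : Finset (SplitVertex a b)) ⊆ splitCluster G a b σ τ X :=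
          Finset.insert_subset hxX (Finset.singleton_subset_iff.2 hyX)
        refine ⟨Sum.inl X, Finset.inl_mem_disjSum.2 hX, ?_⟩
        by_cases ht : NoTwins (splitCluster G a b σ τ X)
        -- A twin-free split cluster containing an edge that no big cluster contains has exactly two
        -- vertices, so it equals the endpoint set.
        · simp only [t, Sum.elim_inl, if_pos ht, Finset.mem_singleton]
          rw [Finset.eq_of_subset_of_card_le hsub]
          rw [Finset.card_pair hxy.ne]
          by_contra! hcard
          exact hbig _ (mem_bigSplitClusters.2 ⟨X, hX, rfl, hcard, ht⟩) hsub
        · simp only [t, Sum.elim_inl, if_neg ht]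
          rw [Finset.mem_image]
          refine ⟨s(x, y), (hF X _).2 ⟨hxy, by simp [hx, hy], fun hS => hne ?_⟩, ?_⟩
          · refine le_antisymm ?_ (hsg.clusterExcess_nonneg hN _)
            rw [Finset.image_insert, Finset.image_singleton]
            refine (hsg.clusterExcess_pair_le _ _).2 (mem_gluedPairs.2 (Or.inl ?_))
            exact ⟨_, Or.inr ⟨s(x, y), hxy, hS, rfl⟩, rfl⟩
          · rw [hpair, Finset.image_insert, Finset.image_singleton]
    · refine ⟨Sum.inr Y, Finset.inr_mem_disjSum.2 hY, ?_⟩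
      simp only [t, Sum.elim_inr, Finset.mem_singleton]
  · rw [Finset.sum_disjSum]
    refine add_le_add (Finset.sum_le_sum fun X hX => ?_) (Finset.sum_le_sum fun Y _ => ?_)
    · by_cases ht : NoTwins (splitCluster G a b σ τ X)
      · simp only [t, Sum.elim_inl, if_pos ht, Finset.sum_singleton]
        exact hsg.clusterExcess_left_le hN hX ht
      · simp only [t, Sum.elim_inl, if_neg ht]
        refine le_trans ?_ (ncard_le_of_not_noTwins hsg.base.indep hsg.ne hsg.base.safe hX ht)
        rw [Set.ncard_eq_toFinset_card _ (Set.toFinite _)]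
        refine (Finset.sum_le_card_nsmul _ _ 1 fun Z hZ => ?_).trans ?_
        · obtain ⟨f, -, rfl⟩ := Finset.mem_image.1 hZ
          induction f using Sym2.ind with
          | _ x y =>
            rw [hpair]
            exact (hsg.clusterExcess_pair_le _ _).1
        · rw [nsmul_eq_mul, mul_one]
          exact_mod_cast Finset.card_image_le
    · simp only [t, Sum.elim_inr, Finset.sum_singleton]
      exact hsg.clusterExcess_right_le Y

/-- The rank of an independent glued graph is the inclusion-exclusion count. -/
theorem IsSafeSplitAndGlue.edgeRank_eq_inclExcl
    (hsg : IsSafeSplitAndGlue κ G 𝒳 a b σ τ H 𝒴 K L φ)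
    (hN : IndepEdges κ (glueGraph (splitGraph G a b σ τ) H φ).edgeSet) :
    (edgeRank κ (glueGraph (splitGraph G a b σ τ) H φ).edgeSet : ℤ) =
      inclExcl κ (glueGraph (splitGraph G a b σ τ) H φ)
        (glueCover (safeSplitCover G 𝒳 a b σ τ) 𝒴 φ) := by
  have hS := hsg.sharedSet_subset
  apply le_antisymm
  · refine le_trans ?_ (edgeRank_union_le_countWith hsg.isTwoThinCover
      ((hsg.indep_gluedPairs hN).subset (Finset.coe_subset.2 hS)))
    exact_mod_cast edgeRank_mono κ Set.subset_union_left
  -- Passing from the shared set to all glued pairs does not lower the count. The excess comparison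
  -- bounds the larger count by |E(N)|, which is the rank.
  · have h1 := countWith_mono (κ := κ) (G := glueGraph (splitGraph G a b σ τ) H φ)
      (𝒳 := glueCover (safeSplitCover G 𝒳 a b σ τ) 𝒴 φ) hS fun e he heS =>
        coverDegree_le_one hsg.isTwoThinCover (hsg.not_isDiag_of_mem_gluedPairs he) heS
    rw [countWith_eq (T := gluedPairs G 𝒳 a b σ τ 𝒴 φ)] at h1
    have h2 := hsg.sum_clusterExcess_le hN
    simp only [clusterExcess] at h2
    have h3 := hsg.card_gluedPairs_le hN
    have h4 := hsg.count_le_ncard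
    have h5 : edgeRank κ (glueGraph (splitGraph G a b σ τ) H φ).edgeSet = _ := hN
    rw [inclExcl, h5]
    zify at h3
    linarith

end SplitAndGlue

theorem theorem3p7 {V W : Type*} [DecidableEq V] [Fintype V] [DecidableEq W] [Fintype W]
    (κ : RigidityModel) (G : SimpleGraph V) (𝒳 : Finset (Finset V)) (a b : V) (σ τ : V → Fin 2)
    (H : SimpleGraph W) (𝒴 : Finset (Finset W)) (K : Finset (SplitVertex a b)) (L : Finset W)
    (φ : K ≃ L) (hsg : IsSafeSplitAndGlue κ G 𝒳 a b σ τ H 𝒴 K L φ) :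
    IsImpliedNonedge κ G s(a, b) ∧
    (IndepEdges κ (glueGraph (splitGraph G a b σ τ) H φ).edgeSet →
      (∃ e, IsImpliedNonedge κ (glueGraph (splitGraph G a b σ τ) H φ) e) ∧
      (∀ e ∈ sharedSet (glueCover (safeSplitCover G 𝒳 a b σ τ) 𝒴 φ),
        e ∉ (glueGraph (splitGraph G a b σ τ) H φ).edgeSet →
          IsImpliedNonedge κ (glueGraph (splitGraph G a b σ τ) H φ) e) ∧
      IsIndepTwoThinCover κ (glueGraph (splitGraph G a b σ τ) H φ)
        (glueCover (safeSplitCover G 𝒳 a b σ τ) 𝒴 φ) ∧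
      (edgeRank κ (glueGraph (splitGraph G a b σ τ) H φ).edgeSet : ℤ) =
        inclExcl κ (glueGraph (splitGraph G a b σ τ) H φ)
          (glueCover (safeSplitCover G 𝒳 a b σ τ) 𝒴 φ)) := by
  refine ⟨hsg.isImpliedNonedge_base, fun hN => ⟨hsg.exists_isImpliedNonedge hN,
    fun e he hne => isImpliedNonedge_of_edgeRank_insert hN (not_isDiag_of_mem_sharedSet he) hne
      (hsg.edgeRank_insert_gluedPair hN (hsg.sharedSet_subset he)),
    ⟨hsg.isTwoThinCover, ?_⟩, hsg.edgeRank_eq_inclExcl hN⟩⟩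
  exact (hsg.indep_gluedPairs hN).subset (Finset.coe_subset.2 hsg.sharedSet_subset)
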